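/- Let $p$ be an odd prime and $G=C_p\times C_p=\langle n\rangle\times\langle c\rangle$, $N=\langle n\rangle$, $C=\langle c\rangle$. For a finite group $Q$ and a commutative ring $R$, an $R[Q]$-lattice is an $R[Q]$-module that is free of finite rank over $R$; it is a permutation module if it has an $R$-basis that is set-wise preserved by $Q$. For a $\mathbb{Z}_p[G]$-lattice $U$, $U^N$ and $U_N$ denote the $\mathbb{Z}_p[G/N]$-modules of $N$-invariants and of $N$-coinvariants. Let $I$ consist of $0$ and of the $p+1$ subgroups $H$ of $G$ of order $p$. In $\mathbb{Q}_p[G]$ put $\widehat{H}=\sum_{h\in H}h$, $e_0=p^{-2}\widehat{G}$, $e_H=p^{-2}(p\widehat{H}-\widehat{G})$, and let $\Lambda_{(i)}=e_i\mathbb{Z}_p[G]$ for $i\in I$. A $\mathbb{Z}_p[G]$-lattice is reduced if it has neither a nonzero free direct summand nor a direct summand isomorphic to some $\Lambda_{(i)}$. A diagram is a finitely generated $\mathbb{F}_p[G]$-module $V$ with submodules $V_{(i)}$ ($i\in I$) such that $\sum_{i\neq j}V_{(i)}=V$ for every $j\in I$, and such that for each $i$ the action of $\mathbb{Z}_p[G]$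 on $V_{(i)}$ factors through $\mathbb{Z}_p[G]\to\Lambda_{(i)}$, $a\mapsto e_ia$. A lattice corresponding to a diagram is obtained as follows: let $F_{(i)}$ be the direct sum of $\dim_{\mathbb{F}_p}(V_{(i)}/\mathrm{Rad}\,V_{(i)})$ copies of $\Lambda_{(i)}$, choose surjective homomorphisms $f_i:F_{(i)}\to V_{(i)}$ inducing isomorphisms $F_{(i)}/\mathrm{Rad}\,F_{(i)}\to V_{(i)}/\mathrm{Rad}\,V_{(i)}$, and take the kernel of their sum $f:\bigoplus_{i\in I}F_{(i)}\to V$. Let $V$ be the $\mathbb{F}_p$-vector space with basis $v_1,\dots,v_{p+2}$ and the action of $G$ given by $$n v_1=v_1,\quad n v_2=v_2,\quad n v_j=v_1+v_j\ (j\geq 3),$$ $$c v_1=v_1,\quad c v_2=v_1+v_2,\quad c v_3=v_3,\quad c v_j=-k_jv_1+v_j\ (j\geq 4),$$ where $(j-3)k_j\equiv 1 \pmod p$, and let $$V_{(0)}=\langle v_1,\ v_2-v_3+v_4,\ (k_{j+1}-k_j)v_2-v_j+v_{j+1}\ (4\leq j\leq p+1)\rangle,$$ $$V_{(N)}=\langle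 v_1,v_2\rangle,\quad V_{(C)}=\langle v_1,v_3\rangle,\quad V_{(\langle nc^a\rangle)}=\langle v_1,v_{a+3}\rangle\ (1\leq a\leq p-1).$$ Then $(V;V_{(i)},i\in I)$ is a diagram, homomorphisms $f_i$ as above exist, and for every choice of them the corresponding $\mathbb{Z}_p[G]$-module $U=\ker f$ is a reduced lattice of $\mathbb{Z}_p$-rank $p^2+p-1$ such that $U^N$ and $U_N$ are permutation $\mathbb{Z}_p[G/N]$-modules, but $U$ is not a permutation module. If $p=3$, then $U$ has a $\mathbb{Z}_3$-basis with respect to which the matrices of $n$ and $c$ (acting on column vectors) are, respectively, $$\begin{pmatrix} 1 & 0 & -1 & -1 & -1 & -1 & 0 & 0 & 0 & 0 & 0 \\ 0 & 1 & 0 & 0 & 0 & 0 & 0 & 0 & 0 & 0 & 0 \\ 0 & 0 & -2 & 0 & 0 & -1 & 1 & 0 & 1 & 0 & 0 \\ 0 & 0 & 0 & -2 & 0 & -1 & -1 & 0 & 0 & 1 & 0 \\ 0 & 0 & 0 & 0 & -2 & -1 & 0 & 0 & 0 & 0 & 1 \\ 0 & 0 & 0 & 0 & 0 & 1 & 0 &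 0 & 0 & 0 & 0 \\ 0 & 0 & 0 & 0 & 0 & 0 & 1 & 0 & 0 & 0 & 0 \\ 0 & 0 & 0 & 0 & 0 & 0 & 0 & 1 & 0 & 0 & 0 \\ 0 & 0 & -3 & 0 & 0 & -1 & 1 & 0 & 1 & 0 & 0 \\ 0 & 0 & 0 & -3 & 0 & -1 & -1 & 0 & 0 & 1 & 0 \\ 0 & 0 & 0 & 0 & -3 & -1 & 0 & 0 & 0 & 0 & 1 \end{pmatrix}\quad\text{and}\quad \begin{pmatrix} 1 & -1 & 0 & 1 & -1 & 0 & 0 & 0 & 0 & -1 & 0 \\ 0 & -2 & 0 & 0 & 0 & 0 & -1 & 1 & 0 & 0 & 0 \\ 0 & 0 & 1 & 0 & 0 & 0 & 0 & 0 & 0 & 0 & 0 \\ 0 & 0 & 0 & 1 & 0 & 0 & 0 & 0 & 0 & -1 & 0 \\ 0 & 0 & 0 & 0 & -2 & -1 & 0 & 0 & 0 & 0 & 1 \\ 0 & 0 & 0 & 0 & 0 & 1 & 0 & 0 & 0 & 0 & 0 \\ 0 & 0 & 0 & 0 & 0 & 0 & 1 & 0 & 0 & 0 & 0 \\ 0 &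 -3 & 0 & 0 & 0 & 0 & -1 & 1 & 0 & 0 & 0 \\ 0 & 0 & 0 & 0 & 0 & 0 & 0 & 0 & 1 & 0 & 0 \\ 0 & 0 & 0 & 3 & 0 & 1 & 1 & 0 & 0 & -2 & 0 \\ 0 & 0 & 0 & 0 & -3 & -1 & 0 & 0 & 0 & 0 & 1 \end{pmatrix}.$$ In particular, it is not true that every $\mathbb{Z}_p[G]$-lattice $U$ for which $U^N$ and $U_N$ are permutation $\mathbb{Z}_p[G/N]$-modules is a permutation module. That is, in the characterization "$U$ is a permutation module if and only if (1) $U^N$ and $U_N$ are permutation $\mathbb{Z}_p[G/N]$-modules and (2) $(U/U^N)_N$ is a permutation $\mathbb{F}_p[G/N]$-module", Condition (2) cannot be dropped. -/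

import Mathlib

namespace CpCpLattice

open Representation

/-! ### Permutation modules and lattices

A module over the group algebra `R[G]` is given as a representation of `G` over `R`. -/

/-- An `R[G]`-lattice: the underlying `R`-module is free of finite rank. -/
def IsLattice {R G U : Type*} [CommRing R] [Monoid G] [AddCommMonoid U] [Module R U]
    (_σ : Representation R G U) : Prop :=
  Module.Free R U ∧ Module.Finite R U

/-- A permutation module: there is a finite `R`-basis set-wise preserved by `G`. -/
def IsPermutation {R G U : Type*} [CommRing R] [Monoid G] [AddCommMonoid U] [Module R U]
    (σ : Representation R G U) : Prop :=
  ∃ (m : ℕ) (b : Module.Basis (Fin m) R U), ∀ (g : G) (i : Fin m), ∃ j : Fin m, σ g (b i) = b j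

/-- The radical of a module, i.e. the intersection of its maximal submodules. -/
noncomputable def radical {R G U : Type*} [CommRing R] [Monoid G] [AddCommGroup U] [Module R U]
    (σ : Representation R G U) : Submodule R U :=
  ((Module.jacobson (MonoidAlgebra R G) σ.asModule).restrictScalars R).map
    (σ.asModuleEquiv : σ.asModule →ₗ[R] U)

/-- The coordinatewise representation on a product of representations. -/
def piRep {R G ι : Type*} {U : ι → Type*} [CommRing R] [Monoid G]
    [∀ i, AddCommGroup (U i)] [∀ i, Module R (U i)]
    (σ : ∀ i, Representation R G (U i)) : Representation R G (∀ i, U i) where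
  toFun g := LinearMap.pi fun i => (σ i g) ∘ₗ LinearMap.proj i
  map_one' := by ext; simp
  map_mul' g h := by ext; simp

section Prime

variable (p : ℕ) [Fact p.Prime]

/-! ### The group `C_p × C_p`, its idempotents and the modules `Λ_i` -/

/-- The group `G = C_p × C_p`. -/
abbrev G : Type := Multiplicative (ZMod p) × Multiplicative (ZMod p)

/-- The generator `n` of the first factor. -/
def n : G p := (Multiplicative.ofAdd 1, 1)

/-- The generator `c` of the second factor. -/
def c : G p := (1, Multiplicative.ofAdd 1)

/-- The subgroup `N = ⟨n⟩`. -/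
abbrev N : Subgroup (G p) := Subgroup.zpowers (n p)

/-- The subgroup `C = ⟨c⟩`. -/
abbrev C : Subgroup (G p) := Subgroup.zpowers (c p)

/-- The index set `I` of the primitive idempotents of `ℚ_p G`:
`none` is the index `0`, and `some H` is the index of the subgroup `H` of order `p`. -/
abbrev Idx : Type := Option {H : Subgroup (G p) // Nat.card H = p}

noncomputable instance : Fintype (Idx p) := Fintype.ofFinite _

open scoped Classical in
/-- The element `∑_{h ∈ H} h` of `ℚ_p G`. -/
noncomputable def hat (H : Subgroup (G p)) : MonoidAlgebra ℚ_[p] (G p) :=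
  ∑ g : G p, if g ∈ H then MonoidAlgebra.of ℚ_[p] (G p) g else 0

/-- The primitive idempotents `e_0 = p⁻² Ĝ` and `e_H = p⁻² (p Ĥ - Ĝ)`. -/
noncomputable def e : Idx p → MonoidAlgebra ℚ_[p] (G p)
  | none => ((p : ℚ_[p]) ^ 2)⁻¹ • hat p ⊤
  | some H => ((p : ℚ_[p]) ^ 2)⁻¹ • ((p : ℚ_[p]) • hat p H.1 - hat p ⊤)

/-- The inclusion `ℤ_p G → ℚ_p G`. -/
noncomputable def toQp : MonoidAlgebra ℤ_[p] (G p) →+* MonoidAlgebra ℚ_[p] (G p) :=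
  MonoidAlgebra.mapRingHom (G p) (algebraMap ℤ_[p] ℚ_[p])

/-- The reduction `ℤ_p G → 𝔽_p G`. -/
noncomputable def toFp : MonoidAlgebra ℤ_[p] (G p) →+* MonoidAlgebra (ZMod p) (G p) :=
  MonoidAlgebra.mapRingHom (G p) PadicInt.toZMod

/-- `Λ_i = e_i ℤ_p G`, inside `ℚ_p G`. -/
noncomputable def Lam (i : Idx p) : Submodule ℤ_[p] (MonoidAlgebra ℚ_[p] (G p)) where
  carrier := {x | ∃ a : MonoidAlgebra ℤ_[p] (G p), x = e p i * toQp p a}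
  zero_mem' := ⟨0, by simp⟩
  add_mem' := by
    rintro _ _ ⟨a, rfl⟩ ⟨b, rfl⟩
    exact ⟨a + b, by rw [map_add, mul_add]⟩
  smul_mem' := by
    rintro r _ ⟨a, rfl⟩
    refine ⟨r • a, ?_⟩
    have h : toQp p (r • a) = r • toQp p a := by
      ext g
      simp [toQp, Algebra.smul_def]
    rw [h, mul_smul_comm]

/-- The action of `G` on `Λ_i` by multiplication. -/
noncomputable def lamRep (i : Idx p) : Representation ℤ_[p] (G p) (Lam p i) where
  toFun g := (LinearMap.mulLeft ℤ_[p] (MonoidAlgebra.of ℚ_[p] (G p) g)).restrict (by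
    rintro _ ⟨a, rfl⟩
    refine ⟨MonoidAlgebra.of ℤ_[p] (G p) g * a, ?_⟩
    have h : toQp p (MonoidAlgebra.of ℤ_[p] (G p) g) = MonoidAlgebra.of ℚ_[p] (G p) g := by
      simp [toQp]
    change MonoidAlgebra.of ℚ_[p] (G p) g * (e p i * toQp p a) = _
    rw [map_mul, h]
    exact mul_left_comm _ _ _)
  map_one' := by
    refine LinearMap.ext fun x => Subtype.ext ?_
    change MonoidAlgebra.of ℚ_[p] (G p) 1 * x.1 = x.1
    rw [map_one, one_mul]
  map_mul' g h := by
    refine LinearMap.ext fun x => Subtype.ext ?_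
    change MonoidAlgebra.of ℚ_[p] (G p) (g * h) * x.1 =
      MonoidAlgebra.of ℚ_[p] (G p) g * (MonoidAlgebra.of ℚ_[p] (G p) h * x.1)
    rw [map_mul, mul_assoc]

/-- A `ℤ_p G`-lattice is reduced if it has no direct summand that is free (of rank one) or
isomorphic to one of the `Λ_i`. -/
def IsReduced {U : Type*} [AddCommGroup U] [Module ℤ_[p] U]
    (σ : Representation ℤ_[p] (G p) U) : Prop :=
  ∀ A B : Subrepresentation σ, IsCompl A B →
    IsEmpty (A.toRepresentation.Equiv (leftRegular ℤ_[p] (G p))) ∧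
      ∀ i : Idx p, IsEmpty (A.toRepresentation.Equiv (lamRep p i))

/-! ### Butler's diagrams and the lattice of a diagram -/

section Diagram

variable {p} {V : Type*} [AddCommGroup V] [Module (ZMod p) V]
  {ρ : Representation (ZMod p) (G p) V}

/-- The tuple `(V; V_i, i ∈ I)` is a diagram: `V` is finitely generated, all but any one of the
`V_i` together span `V`, and the action of `ℤ_p G` on `V_i` factors through the surjection
`ℤ_p G → Λ_i`, `a ↦ e_i a`. -/
def IsDiagram (D : Idx p → Subrepresentation ρ) : Prop :=
  Module.Finite (ZMod p) V ∧
  (∀ j : Idx p, ⨆ i : {i : Idx p // i ≠ j}, (D i.1).toSubmodule = ⊤) ∧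
  ∀ (i : Idx p) (a : MonoidAlgebra ℤ_[p] (G p)), e p i * toQp p a = 0 →
    ∀ v ∈ D i, ρ.asAlgebraHom (toFp p a) v = 0

/-- `dim_{𝔽_p} (V_i / Rad V_i)`. -/
noncomputable def headDim (A : Subrepresentation ρ) : ℕ :=
  Module.finrank (ZMod p) (A.toSubmodule ⧸ radical A.toRepresentation)

/-- `F_i`, the direct sum of `dim (V_i / Rad V_i)` copies of `Λ_i`. -/
abbrev Fi (D : Idx p → Subrepresentation ρ) (i : Idx p) : Type :=
  Fin (headDim (D i)) → Lam p i

/-- The action of `G` on `F_i`. -/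
noncomputable def fiRep (D : Idx p → Subrepresentation ρ) (i : Idx p) :
    Representation ℤ_[p] (G p) (Fi D i) :=
  piRep fun _ => lamRep p i

/-- The direct sum `F` of the `F_i`, with its action of `G`. -/
noncomputable def fRep (D : Idx p → Subrepresentation ρ) :
    Representation ℤ_[p] (G p) (∀ i, Fi D i) :=
  piRep fun i => fiRep D i

/-- A choice of surjective homomorphisms `f_i : F_i → V_i` that induce isomorphisms
`F_i / Rad F_i → V_i / Rad V_i`.  For a surjective map this last condition says that
the preimage of `Rad V_i` is `Rad F_i`. -/
structure Cover (D : Idx p → Subrepresentation ρ) where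
  /-- The map `f_i`. -/
  f : ∀ i, Fi D i →ₛₗ[(PadicInt.toZMod : ℤ_[p] →+* ZMod p)] (D i).toSubmodule
  equivariant : ∀ (i : Idx p) (g : G p) (x : Fi D i),
    f i (fiRep D i g x) = (D i).toRepresentation g (f i x)
  surjective : ∀ i, Function.Surjective (f i)
  mem_radical_iff : ∀ (i : Idx p) (x : Fi D i),
    f i x ∈ radical (D i).toRepresentation ↔ x ∈ radical (fiRep D i)

/-- The sum `f : F → V` of the maps `F_i → V_i → V`. -/
noncomputable def Cover.total {D : Idx p → Subrepresentation ρ} (φ : Cover D) :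
    (∀ i, Fi D i) →ₛₗ[(PadicInt.toZMod : ℤ_[p] →+* ZMod p)] V :=
  ∑ i, ((D i).toSubmodule.subtype.comp (φ.f i)).comp (LinearMap.proj i)

theorem Cover.total_apply {D : Idx p → Subrepresentation ρ} (φ : Cover D) (x : ∀ i, Fi D i) :
    φ.total x = ∑ i, (φ.f i (x i) : V) := by
  simp [Cover.total]

/-- The kernel of `f`, as a subrepresentation of `F`. -/
noncomputable def Cover.kernel {D : Idx p → Subrepresentation ρ} (φ : Cover D) :
    Subrepresentation (fRep D) where
  toSubmodule := LinearMap.ker φ.total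
  apply_mem_toSubmodule g x hx := by
    have key : φ.total (fRep D g x) = ρ g (φ.total x) := by
      rw [Cover.total_apply, Cover.total_apply, map_sum]
      refine Finset.sum_congr rfl fun i _ => ?_
      have h := congrArg Subtype.val (φ.equivariant i g (x i))
      exact h
    rw [LinearMap.mem_ker] at hx ⊢
    rw [key, hx, map_zero]

/-- The underlying `ℤ_p`-module of the reduced lattice corresponding to the diagram. -/
abbrev Cover.Lattice {D : Idx p → Subrepresentation ρ} (φ : Cover D) : Type :=
  φ.kernel.toSubmodule

/-- The reduced lattice `U = Ker f` corresponding to the diagram. -/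
noncomputable def Cover.lattice {D : Idx p → Subrepresentation ρ} (φ : Cover D) :
    Representation ℤ_[p] (G p) φ.Lattice :=
  φ.kernel.toRepresentation

end Diagram

/-! ### The explicit diagram -/

/-- The `𝔽_p`-vector space with coordinates indexed by `1, …, p + 2`. -/
abbrev V : Type := Finset.Icc 1 (p + 2) → ZMod p

/-- The basis vector `v_j`, for `1 ≤ j ≤ p + 2`. -/
def v (j : ℕ) : V p := fun i => if i.1 = j then 1 else 0

/-- `k_j`, the inverse of `j - 3` modulo `p`. -/
def k (j : ℕ) : ZMod p := ((j : ZMod p) - 3)⁻¹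

/-- `n v_j - v_j = coeffN j • v_1`. -/
def coeffN (j : ℕ) : ZMod p := if 3 ≤ j then 1 else 0

/-- `c v_j - v_j = coeffC j • v_1`. -/
def coeffC (j : ℕ) : ZMod p := if j = 2 then 1 else if 4 ≤ j then -k p j else 0

/-- The element `n ^ a * c ^ b` sends `x` to `x + shift a b x • v_1`. -/
def shift (a b : ZMod p) : V p →ₗ[ZMod p] ZMod p :=
  ∑ j : Finset.Icc 1 (p + 2), (a * coeffN p j + b * coeffC p j) • LinearMap.proj j

variable {p} in
theorem shift_apply (a b : ZMod p) (x : V p) :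
    shift p a b x = ∑ j : Finset.Icc 1 (p + 2), (a * coeffN p j + b * coeffC p j) * x j := by
  simp [shift]

variable {p} in
theorem shift_v (a b : ZMod p) {j : ℕ} (h1 : 1 ≤ j) (h2 : j ≤ p + 2) :
    shift p a b (v p j) = a * coeffN p j + b * coeffC p j := by
  rw [shift_apply, Finset.sum_eq_single ⟨j, Finset.mem_Icc.2 ⟨h1, h2⟩⟩]
  · simp [v]
  · intro i _ hi
    have : i.1 ≠ j := fun h => hi (Subtype.ext h)
    simp [v, this]
  · simp

variable {p} in
theorem shift_v_one (a b : ZMod p) : shift p a b (v p 1) = 0 := by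
  rw [shift_v a b le_rfl (by omega)]
  simp [coeffN, coeffC]

/-- The action of `G` on `V`. -/
def rho : Representation (ZMod p) (G p) (V p) where
  toFun g := LinearMap.id +
    (shift p (Multiplicative.toAdd g.1) (Multiplicative.toAdd g.2)).smulRight (v p 1)
  map_one' := by
    refine LinearMap.ext fun x => ?_
    simp [shift_apply]
  map_mul' g h := by
    refine LinearMap.ext fun x => ?_
    have hs : shift p (Multiplicative.toAdd (g * h).1) (Multiplicative.toAdd (g * h).2) x =
        shift p (Multiplicative.toAdd g.1) (Multiplicative.toAdd g.2) x +
          shift p (Multiplicative.toAdd h.1) (Multiplicative.toAdd h.2) x := by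
      simp only [shift_apply, ← Finset.sum_add_distrib, Prod.fst_mul, Prod.snd_mul, toAdd_mul]
      exact Finset.sum_congr rfl fun j _ => by ring
    simp only [LinearMap.add_apply, LinearMap.id_apply, LinearMap.smulRight_apply,
      Module.End.mul_apply, map_add, map_smul, shift_v_one, hs, add_smul,
      zero_smul, add_zero]
    abel

variable {p} in
theorem rho_apply (g : G p) (x : V p) : rho p g x =
    x + shift p (Multiplicative.toAdd g.1) (Multiplicative.toAdd g.2) x • v p 1 := rfl

variable {p} in
theorem rho_n_of_le_two {j : ℕ} (h1 : 1 ≤ j) (h2 : j ≤ 2) : rho p (n p) (v p j) = v p j := by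
  rw [rho_apply, shift_v _ _ h1 (by omega)]
  simp [n, coeffN, show ¬ 3 ≤ j by omega]

variable {p} in
theorem rho_n_of_three_le {j : ℕ} (h1 : 3 ≤ j) (h2 : j ≤ p + 2) :
    rho p (n p) (v p j) = v p 1 + v p j := by
  rw [rho_apply, shift_v _ _ (by omega) h2]
  simp [n, coeffN, h1, add_comm]

variable {p} in
theorem rho_c_one : rho p (c p) (v p 1) = v p 1 := by
  rw [rho_apply, shift_v_one]
  simp

variable {p} in
theorem rho_c_two : rho p (c p) (v p 2) = v p 1 + v p 2 := by
  rw [rho_apply, shift_v _ _ (by omega) (by omega)]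
  simp [c, coeffC, add_comm]

variable {p} in
theorem rho_c_three : rho p (c p) (v p 3) = v p 3 := by
  rw [rho_apply, shift_v _ _ (by omega) (by have := (Fact.out : p.Prime).two_le; omega)]
  simp [c, coeffC]

variable {p} in
theorem rho_c_of_four_le {j : ℕ} (h1 : 4 ≤ j) (h2 : j ≤ p + 2) :
    rho p (c p) (v p j) = -k p j • v p 1 + v p j := by
  rw [rho_apply, shift_v _ _ (by omega) h2]
  simp [c, coeffC, h1, show j ≠ 2 by omega, add_comm]

/-- Generators of the subspaces `V_0` and `V_H`.  Each subgroup `H` of order `p` is exactly one of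
`N`, `C`, `⟨n c ^ a⟩` with `1 ≤ a ≤ p - 1`. -/
def gens : Idx p → Set (V p)
  | none => {v p 1, v p 2 - v p 3 + v p 4} ∪
      {x | ∃ j : ℕ, 4 ≤ j ∧ j ≤ p + 1 ∧
        x = (k p (j + 1) - k p j) • v p 2 - v p j + v p (j + 1)}
  | some H => {x | x = v p 1 ∨
      (H.1 = N p ∧ x = v p 2) ∨
      (H.1 = C p ∧ x = v p 3) ∨
      ∃ a : ℕ, 1 ≤ a ∧ a ≤ p - 1 ∧ H.1 = Subgroup.zpowers (n p * c p ^ a) ∧ x = v p (a + 3)}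

/-- The submodules `V_0` and `V_H`, spanned over `𝔽_p` by the generators above. -/
def diagram (i : Idx p) : Subrepresentation (rho p) where
  toSubmodule := Submodule.span (ZMod p) (gens p i)
  apply_mem_toSubmodule g x hx := by
    have h1 : v p 1 ∈ Submodule.span (ZMod p) (gens p i) := by
      apply Submodule.subset_span
      cases i <;> simp [gens]
    rw [rho_apply]
    exact Submodule.add_mem _ hx (Submodule.smul_mem _ _ h1)

end Prime

/-! ### The matrices for `p = 3` -/

/-- The matrix of `n` for `p = 3`. -/
def matN : Matrix (Fin 11) (Fin 11) ℤ :=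
  !![1, 0, -1, -1, -1, -1, 0, 0, 0, 0, 0;
     0, 1, 0, 0, 0, 0, 0, 0, 0, 0, 0;
     0, 0, -2, 0, 0, -1, 1, 0, 1, 0, 0;
     0, 0, 0, -2, 0, -1, -1, 0, 0, 1, 0;
     0, 0, 0, 0, -2, -1, 0, 0, 0, 0, 1;
     0, 0, 0, 0, 0, 1, 0, 0, 0, 0, 0;
     0, 0, 0, 0, 0, 0, 1, 0, 0, 0, 0;
     0, 0, 0, 0, 0, 0, 0, 1, 0, 0, 0;
     0, 0, -3, 0, 0, -1, 1, 0, 1, 0, 0;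
     0, 0, 0, -3, 0, -1, -1, 0, 0, 1, 0;
     0, 0, 0, 0, -3, -1, 0, 0, 0, 0, 1]

/-- The matrix of `c` for `p = 3`. -/
def matC : Matrix (Fin 11) (Fin 11) ℤ :=
  !![1, -1, 0, 1, -1, 0, 0, 0, 0, -1, 0;
     0, -2, 0, 0, 0, 0, -1, 1, 0, 0, 0;
     0, 0, 1, 0, 0, 0, 0, 0, 0, 0, 0;
     0, 0, 0, 1, 0, 0, 0, 0, 0, -1, 0;
     0, 0, 0, 0, -2, -1, 0, 0, 0, 0, 1;
     0, 0, 0, 0, 0, 1, 0, 0, 0, 0, 0;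
     0, 0, 0, 0, 0, 0, 1, 0, 0, 0, 0;
     0, -3, 0, 0, 0, 0, -1, 1, 0, 0, 0;
     0, 0, 0, 0, 0, 0, 0, 0, 1, 0, 0;
     0, 0, 0, 3, 0, 1, 1, 0, 0, -2, 0;
     0, 0, 0, 0, -3, -1, 0, 0, 0, 0, 1]

end CpCpLattice

namespace CpCpLattice

open Representation

/-! ### The radical of a representation over a local ring with maximal ideal `(p)` -/

section Radical

variable {R G U : Type*} [CommRing R] [AddCommGroup U] [Module R U]

/-! Write `F = ⨁ F_i`. Since `V` is killed by `p`, one has `p F ⊆ U ⊆ F`, so `U` and `F` have the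
same rank. Here `V_0` is a trivial module of dimension `p` and each `V_H` has a one-dimensional
head, so the rank is `p + (p + 1)(p - 1)`, which is `-1` modulo `p`.

`U` is reduced. The `V_i` still span `V` after one of them is dropped, so `U` maps onto every `F_i`.
If `Λ_i` were a summand of `U`, its generator would be an element of `U` concentrated in component
`i`, hence killed by `f_i`, hence in `Rad F_i`, which is the image of `Rad U`. Projecting back to
the summand puts the generator of `Λ_i` into `Rad Λ_i`, against Nakayama (`Cover.lam_not_summand`).
A free summand is impossible because `p² e_0 U ⊆ p U`, whereas `p² e_0` is the sum of all group
elements, which is not divisible by `p` in `ℤ_p G` (`Cover.free_not_summand`).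

`U` is not a permutation module. The orbits of `G` on a permutation basis have `p`-power length, so
a rank prime to `p` forces a fixed basis element, and this splits off a copy of `Λ_0`.

`U^N` and `U_N` are permutation modules. `N` acts trivially on `F_0` and `F_N` and has no nonzero
fixed points on the other `F_H`. So `U^N` is the kernel of `F_0 ⊕ F_N → V`, and `V_0` meets `V_N` in
the line of `v_1`. On the other side, `U_N` is the image of `U` in `F_0 ⊕ F_N`: the kernel of this
projection is `(n - 1) U` (`Cover.exists_eq_sub`), and its image is cut out by the vanishing of the
`v_2`-coordinate in `V` (`Cover.exists_component_eq`). Either way a trivial lattice of rank `p` and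
a cyclic lattice `ℤ_p[G/N]` modulo the norm are glued along one line over `𝔽_p`. The `c`-orbit of a
glued generator, together with multiples of the remaining trivial basis vectors, is a permuted basis
(`isPermutation_of_glue`).

All radicals are computed from `Rad U = p U + ∑ (g - 1) U` (`radical_eq_augRadical`). The matrices
for `p = 3` reduce to identities between integer matrices. -/

theorem mem_radical [Monoid G] {σ : Representation R G U} {x : U} :
    x ∈ radical σ ↔ σ.asModuleEquiv.symm x ∈ Module.jacobson (MonoidAlgebra R G) σ.asModule := by
  rw [radical, Submodule.mem_map]
  constructor
  · rintro ⟨y, hy, rfl⟩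
    simpa using hy
  · intro h
    exact ⟨_, h, by simp⟩

/-- The submodule generated by all `p y` and `g y - y`. -/
def augRadical (p : ℕ) [Monoid G] (σ : Representation R G U) : Submodule R U :=
  Submodule.span R ({x | ∃ y, x = (p : R) • y} ∪ {x | ∃ g y, x = σ g y - y})

theorem smul_mem_augRadical {p : ℕ} [Monoid G] (σ : Representation R G U) (y : U) :
    (p : R) • y ∈ augRadical p σ :=
  Submodule.subset_span (Or.inl ⟨y, rfl⟩)

theorem sub_mem_augRadical {p : ℕ} [Monoid G] (σ : Representation R G U) (g : G) (y : U) :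
    σ g y - y ∈ augRadical p σ :=
  Submodule.subset_span (Or.inr ⟨g, y, rfl⟩)

/-- A larger `R[G]`-submodule is in particular a larger `R`-submodule. This produces maximal
`R[G]`-submodules from maximal `R`-submodules that happen to be stable. -/
theorem isCoatom_asSubmodule [Monoid G] {σ : Representation R G U} (S : Subrepresentation σ)
    (hS : IsCoatom S.toSubmodule) : IsCoatom S.asSubmodule := by
  refine ⟨fun h => hS.1 ?_, fun T hT => ?_⟩
  · rw [eq_top_iff]
    intro x _
    have : (x : σ.asModule) ∈ S.asSubmodule := by rw [h]; trivial
    exact this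
  · have h1 : S.toSubmodule < (T.restrictScalars R).map (σ.asModuleEquiv : σ.asModule →ₗ[R] U) := by
      refine lt_of_le_of_ne (fun x hx => ⟨σ.asModuleEquiv.symm x, hT.le hx, by simp⟩) fun h => ?_
      apply hT.ne
      ext x
      refine ⟨fun hx => hT.le hx, fun hx => ?_⟩
      have : σ.asModuleEquiv x ∈ S.toSubmodule := by rw [h]; exact ⟨x, hx, rfl⟩
      exact this
    have h2 := hS.2 _ h1
    rw [eq_top_iff]
    intro x _
    have : σ.asModuleEquiv x ∈ (T.restrictScalars R).map (σ.asModuleEquiv : σ.asModule →ₗ[R] U) := by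
      rw [h2]; trivial
    obtain ⟨y, hy, hyx⟩ := this
    have := σ.asModuleEquiv.injective hyx
    exact this ▸ hy

/-- The quotient by `augRadical` is a vector space over the residue field, hence semisimple with
zero Jacobson radical. So an element outside `augRadical` avoids some maximal `R`-submodule
containing `augRadical`, and such a submodule is stable because it contains all `g y - y`. -/
theorem radical_le_augRadical {p : ℕ} [Monoid G] [IsLocalRing R]
    (hR : IsLocalRing.maximalIdeal R = Ideal.span {(p : R)}) (σ : Representation R G U) :
    radical σ ≤ augRadical p σ := by
  intro x hx
  by_contra hx'
  have htor : Module.IsTorsionBySet R (U ⧸ augRadical p σ) (IsLocalRing.maximalIdeal R) := by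
    rintro y ⟨a, ha⟩
    rw [SetLike.mem_coe, hR, Ideal.mem_span_singleton'] at ha
    obtain ⟨b, rfl⟩ := ha
    obtain ⟨y, rfl⟩ := Submodule.Quotient.mk_surjective _ y
    change (b * (p : R)) • Submodule.Quotient.mk y = _
    rw [mul_smul, ← Submodule.Quotient.mk_smul, ← Submodule.Quotient.mk_smul,
      Submodule.Quotient.mk_eq_zero]
    exact Submodule.smul_mem _ _ (smul_mem_augRadical σ y)
  have hss : IsSemisimpleModule R (U ⧸ augRadical p σ) := by
    let := htor.module
    let : Field (R ⧸ IsLocalRing.maximalIdeal R) := Ideal.Quotient.field _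
    exact htor.isSemisimpleModule_iff.1 inferInstance
  have hj := IsSemisimpleModule.jacobson_eq_bot R (U ⧸ augRadical p σ)
  have hx2 : Submodule.Quotient.mk x ∉ Module.jacobson R (U ⧸ augRadical p σ) := by
    rw [hj, Submodule.mem_bot, Submodule.Quotient.mk_eq_zero]
    exact hx'
  rw [Module.jacobson, Submodule.mem_sInf] at hx2
  push Not at hx2
  obtain ⟨N, hN, hxN⟩ := hx2
  have hN' : IsCoatom (N.comap (augRadical p σ).mkQ) := by
    exact Submodule.isCoatom_comap_iff (Submodule.mkQ_surjective _) |>.2 hN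
  have hle : augRadical p σ ≤ N.comap (augRadical p σ).mkQ := by
    intro y hy
    rw [Submodule.mem_comap, (Submodule.Quotient.mk_eq_zero _ (x := y)).2 hy |> fun h => (h :
      (augRadical p σ).mkQ y = 0)]
    exact N.zero_mem
  let S : Subrepresentation σ := ⟨N.comap (augRadical p σ).mkQ, fun g y hy => by
    have := Submodule.add_mem _ (hle (sub_mem_augRadical σ g y)) hy
    simpa using this⟩
  have hS := isCoatom_asSubmodule S hN'
  rw [mem_radical, Module.jacobson, Submodule.mem_sInf] at hx
  exact hxN (hx _ hS)

/-- `R[G]` is integral over the local ring `R`, so `M` contracts to the maximal ideal and contains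
`p`. In the field `R[G] / M` of characteristic `p`, `(g - 1) ^ p = g ^ p - 1 = 0`. -/
theorem mem_of_isMaximal {p : ℕ} [Fact p.Prime] [CommGroup G] [Finite G] [IsLocalRing R]
    (hR : IsLocalRing.maximalIdeal R = Ideal.span {(p : R)}) (hG : ∀ g : G, g ^ p = 1)
    (M : Ideal (MonoidAlgebra R G)) [hM : M.IsMaximal] :
    (algebraMap R (MonoidAlgebra R G) p ∈ M) ∧
      ∀ g : G, MonoidAlgebra.of R G g - 1 ∈ M := by
  have hint : Algebra.IsIntegral R (MonoidAlgebra R G) := inferInstance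
  have h1 : (M.comap (algebraMap R (MonoidAlgebra R G))).IsMaximal :=
    Ideal.isMaximal_comap_of_isIntegral_of_isMaximal M
  have h2 := IsLocalRing.eq_maximalIdeal h1
  have hp : algebraMap R (MonoidAlgebra R G) p ∈ M := by
    have : (p : R) ∈ M.comap (algebraMap R (MonoidAlgebra R G)) := by
      rw [h2, hR]; exact Ideal.mem_span_singleton_self _
    exact this
  refine ⟨hp, fun g => ?_⟩
  have hprime : p.Prime := Fact.out
  have hp0 : ((p : ℕ) : MonoidAlgebra R G ⧸ M) = 0 := by
    rw [← map_natCast (Ideal.Quotient.mk M), Ideal.Quotient.eq_zero_iff_mem]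
    simpa using hp
  have : Nontrivial (MonoidAlgebra R G ⧸ M) := Ideal.Quotient.nontrivial_iff.2 hM.ne_top
  have hchar : CharP (MonoidAlgebra R G ⧸ M) p := (CharP.charP_iff_prime_eq_zero hprime).2 hp0
  rw [← Ideal.Quotient.eq_zero_iff_mem]
  have : IsDomain (MonoidAlgebra R G ⧸ M) := Ideal.Quotient.isDomain M
  refine eq_zero_of_pow_eq_zero (n := p) ?_
  rw [map_sub, map_one, sub_pow_char, one_pow, ← map_pow, ← map_pow, hG, map_one, map_one, sub_self]

/-- `p` and all `g - 1` lie in the Jacobson radical of the ring `R[G]`, which multiplies any module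
into its own radical. -/
theorem augRadical_le_radical {p : ℕ} [Fact p.Prime] [CommGroup G] [Finite G] [IsLocalRing R]
    (hR : IsLocalRing.maximalIdeal R = Ideal.span {(p : R)}) (hG : ∀ g : G, g ^ p = 1)
    (σ : Representation R G U) :
    augRadical p σ ≤ radical σ := by
  have key : ∀ (a : MonoidAlgebra R G), (∀ M : Ideal (MonoidAlgebra R G), M.IsMaximal → a ∈ M) →
      ∀ y : σ.asModule, a • y ∈ Module.jacobson (MonoidAlgebra R G) σ.asModule := by
    intro a ha y
    apply Ring.jacobson_smul_top_le
    refine Submodule.smul_mem_smul ?_ trivial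
    rw [Ring.jacobson_eq_sInf_isMaximal, Submodule.mem_sInf]
    exact ha
  refine Submodule.span_le.2 ?_
  rintro x (⟨y, rfl⟩ | ⟨g, y, rfl⟩)
  · rw [SetLike.mem_coe, mem_radical, map_smul]
    have := key (algebraMap R (MonoidAlgebra R G) p)
      (fun M hM => (mem_of_isMaximal hR hG M).1) (σ.asModuleEquiv.symm y)
    rwa [algebraMap_smul] at this
  · rw [SetLike.mem_coe, mem_radical, map_sub]
    have := key (MonoidAlgebra.of R G g - 1)
      (fun M hM => (mem_of_isMaximal hR hG M).2 g) (σ.asModuleEquiv.symm y)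
    rw [sub_smul, one_smul] at this
    rwa [asModuleEquiv_symm_map_rho]

theorem radical_eq_augRadical {p : ℕ} [Fact p.Prime] [CommGroup G] [Finite G] [IsLocalRing R]
    (hR : IsLocalRing.maximalIdeal R = Ideal.span {(p : R)}) (hG : ∀ g : G, g ^ p = 1)
    (σ : Representation R G U) : radical σ = augRadical p σ :=
  le_antisymm (radical_le_augRadical hR σ) (augRadical_le_radical hR hG σ)

/-- Nakayama's lemma for the radical of a representation. -/
theorem eq_top_of_sup_radical_eq_top [Monoid G] [Module.Finite R U] {σ : Representation R G U}
    (S : Subrepresentation σ) (h : S.toSubmodule ⊔ radical σ = ⊤) : S.toSubmodule = ⊤ := by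
  by_contra hne
  have hfin : Module.Finite (MonoidAlgebra R G) σ.asModule := by
    have : Module.Finite R σ.asModule := Module.Finite.equiv σ.asModuleEquiv.symm
    exact Module.Finite.of_restrictScalars_finite R _ _
  have hne' : S.asSubmodule ≠ ⊤ := by
    intro h'
    apply hne
    rw [eq_top_iff]
    intro x _
    have : (x : σ.asModule) ∈ S.asSubmodule := by rw [h']; trivial
    exact this
  obtain ⟨T, hT, hST⟩ := (eq_top_or_exists_le_coatom S.asSubmodule).resolve_left hne'
  apply hT.1
  rw [eq_top_iff]
  intro x _
  have hx : σ.asModuleEquiv x ∈ S.toSubmodule ⊔ radical σ := by rw [h]; trivial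
  obtain ⟨a, ha, b, hb, hab⟩ := Submodule.mem_sup.1 hx
  have hb' : σ.asModuleEquiv.symm b ∈ T := by
    rw [mem_radical, Module.jacobson, Submodule.mem_sInf] at hb
    exact hb T hT
  have ha' : σ.asModuleEquiv.symm a ∈ T := hST ha
  have := T.add_mem ha' hb'
  rw [← map_add, hab] at this
  simpa using this

theorem radical_lt_top [Monoid G] [Module.Finite R U] [Nontrivial U] (σ : Representation R G U) :
    radical σ ≠ ⊤ := by
  intro h
  have := eq_top_of_sup_radical_eq_top (σ := σ) (⊥ : Subrepresentation σ) (by rw [h]; simp)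
  exact bot_ne_top this

end Radical

/-! ### Equivariant maps and the radical -/

section Maps

/-- An equivariant linear map commutes with the group algebra. -/
theorem map_asAlgebraHom {R G U W : Type*} [CommRing R] [Monoid G] [AddCommMonoid U] [Module R U]
    [AddCommMonoid W] [Module R W] {σ : Representation R G U} {τ : Representation R G W} (T : U →ₗ[R] W)
    (hT : ∀ g x, T (σ g x) = τ g (T x)) (a : MonoidAlgebra R G) (x : U) :
    T (σ.asAlgebraHom a x) = τ.asAlgebraHom a (T x) := by
  induction a using MonoidAlgebra.induction_linear with
  | zero => simp
  | add a b ha hb => simp [ha, hb]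
  | single g r => simp [hT]

variable {R G U W : Type*} [CommRing R] [Monoid G] [AddCommGroup U] [Module R U]
  [AddCommGroup W] [Module R W]

theorem map_augRadical_le {p : ℕ} {σ : Representation R G U} {τ : Representation R G W}
    (T : U →ₗ[R] W) (hT : ∀ g x, T (σ g x) = τ g (T x)) :
    (augRadical p σ).map T ≤ augRadical p τ := by
  rw [augRadical, Submodule.map_span, Submodule.span_le]
  rintro _ ⟨x, ⟨y, rfl⟩ | ⟨g, y, rfl⟩, rfl⟩
  · rw [map_smul]; exact smul_mem_augRadical _ _
  · rw [map_sub, hT]; exact sub_mem_augRadical _ _ _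

theorem le_map_augRadical {p : ℕ} {σ : Representation R G U} {τ : Representation R G W}
    (T : U →ₗ[R] W) (hT : ∀ g x, T (σ g x) = τ g (T x)) (hs : Function.Surjective T) :
    augRadical p τ ≤ (augRadical p σ).map T := by
  rw [augRadical, Submodule.span_le]
  rintro _ (⟨y, rfl⟩ | ⟨g, y, rfl⟩)
  · obtain ⟨y, rfl⟩ := hs y
    exact ⟨_, smul_mem_augRadical _ y, by simp⟩
  · obtain ⟨y, rfl⟩ := hs y
    exact ⟨_, sub_mem_augRadical _ g y, by simp [hT]⟩

end Maps

end CpCpLattice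

namespace CpCpLattice

open Representation

/-! ### Subgroups of order `p` and coset decompositions -/

section Group

variable {p : ℕ} [Fact p.Prime]

theorem pow_p_eq_one (g : G p) : g ^ p = 1 := by
  ext <;> simp

theorem natCard_G : Nat.card (G p) = p * p := by
  simp [G, Nat.card_eq_fintype_card, ZMod.card]

theorem pow_mem_of_coprime {H : Subgroup (G p)} {g : G p} {m : ℤ} (hm : ¬ (p : ℤ) ∣ m)
    (h : g ^ m ∈ H) : g ∈ H := by
  have hp : Prime (p : ℤ) := Nat.prime_iff_prime_int.1 Fact.out
  obtain ⟨a, b, hab⟩ := (hp.coprime_iff_not_dvd).2 hm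
  have : g = (g ^ m) ^ b := by
    have h1 : g = g ^ (a * p + b * m) := by rw [hab, zpow_one]
    rw [zpow_add, mul_comm a, zpow_mul, zpow_natCast, pow_p_eq_one, one_zpow, one_mul, mul_comm,
      zpow_mul] at h1
    exact h1
  rw [this]
  exact H.zpow_mem h b

/-- A coincidence puts `g ^ (i - j)` in `H`; as `|i - j| < p` and `g ∉ H`, this forces `i = j`.
Surjectivity then follows by counting. -/
theorem decomp_bijective {H : Subgroup (G p)} (hH : Nat.card H = p) {g : G p} (hg : g ∉ H) :
    Function.Bijective (fun x : H × Fin p => (x.1 : G p) * g ^ (x.2 : ℕ)) := by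
  have hinj : Function.Injective (fun x : H × Fin p => (x.1 : G p) * g ^ (x.2 : ℕ)) := by
    rintro ⟨h, i⟩ ⟨h', j⟩ hij
    dsimp only at hij
    have hmem : g ^ ((i : ℤ) - (j : ℤ)) ∈ H := by
      have : g ^ ((i : ℤ) - (j : ℤ)) = (h : G p)⁻¹ * h' := by
        rw [zpow_sub, zpow_natCast, zpow_natCast, mul_inv_eq_iff_eq_mul, mul_assoc, ← hij]
        simp
      rw [this]
      exact H.mul_mem (H.inv_mem h.2) h'.2
    have hdvd : (p : ℤ) ∣ (i : ℤ) - (j : ℤ) := by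
      by_contra hd
      exact hg (pow_mem_of_coprime hd hmem)
    have hij' : i = j := by
      have h0 := Int.eq_zero_of_abs_lt_dvd hdvd (by
        rw [abs_lt]; have := i.2; have := j.2; omega)
      exact Fin.ext (by omega)
    subst hij'
    simpa using hij
  refine (Nat.bijective_iff_injective_and_card _).2 ⟨hinj, ?_⟩
  rw [Nat.card_prod, hH, natCard_G, Nat.card_eq_fintype_card, Fintype.card_fin]

/-- Distinct subgroups of order `p` meet trivially, so by their orders they are complements. -/
theorem mul_bijective {H K : Subgroup (G p)} (hH : Nat.card H = p) (hK : Nat.card K = p)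
    (h : K ≠ H) : Function.Bijective (fun x : K × H => (x.1 : G p) * (x.2 : G p)) := by
  have hdisj : Disjoint K H := by
    rw [disjoint_iff]
    have hdvd : Nat.card (K ⊓ H : Subgroup (G p)) ∣ p := by
      conv_rhs => rw [← hK]
      exact Subgroup.card_dvd_of_le inf_le_left
    rcases (Nat.dvd_prime Fact.out).1 hdvd with h1 | h1
    · exact Subgroup.card_eq_one.1 h1
    · refine absurd ?_ h
      have h2 : K ⊓ H = K := Subgroup.eq_of_le_of_card_ge inf_le_left (by rw [h1, hK])
      exact Subgroup.eq_of_le_of_card_ge (inf_eq_left.1 h2) (by rw [hH, hK])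
  exact Subgroup.isComplement'_of_card_mul_and_disjoint (by rw [hH, hK, natCard_G]) hdisj

end Group

/-! ### Sums over subgroups in the group algebra -/

section Hat

noncomputable instance (p : ℕ) [Fact p.Prime] (H : Subgroup (G p)) : Fintype H := Fintype.ofFinite _

variable {p : ℕ} [Fact p.Prime] (R : Type*) [CommRing R]

/-- The sum of the elements of `H` in `R[G]`. -/
noncomputable def sumOver (H : Subgroup (G p)) : MonoidAlgebra R (G p) :=
  ∑ h : H, MonoidAlgebra.of R (G p) h

theorem hat_eq_sumOver (H : Subgroup (G p)) : hat p H = sumOver ℚ_[p] H := by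
  classical
  rw [hat, sumOver, ← Finset.sum_filter]
  exact (Finset.sum_subtype (p := fun x => x ∈ H) _ (by simp) _)

variable {R}

theorem of_mul_sumOver {H : Subgroup (G p)} {h : G p} (hh : h ∈ H) :
    MonoidAlgebra.of R (G p) h * sumOver R H = sumOver R H := by
  rw [sumOver, Finset.mul_sum]
  refine Fintype.sum_equiv (Equiv.mulLeft (⟨h, hh⟩ : H)) _ _ fun x => ?_
  rw [← map_mul]; rfl

theorem sumOver_mul_sumOver_of_le {H K : Subgroup (G p)} (h : K ≤ H) :
    sumOver R K * sumOver R H = (Nat.card K : R) • sumOver R H := by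
  conv_lhs => rw [sumOver, Finset.sum_mul]
  rw [Finset.sum_congr rfl fun x _ => of_mul_sumOver (h x.2)]
  simp [Nat.cast_smul_eq_nsmul]

theorem sumOver_mul_sumOver_of_ne {H K : Subgroup (G p)} (hH : Nat.card H = p)
    (hK : Nat.card K = p) (h : K ≠ H) :
    sumOver R K * sumOver R H = sumOver R ⊤ := by
  rw [sumOver, sumOver, sumOver, Finset.sum_mul_sum, ← Finset.sum_product',
    Finset.univ_product_univ]
  refine Fintype.sum_bijective (fun x : K × H => (⟨(x.1 : G p) * (x.2 : G p), trivial⟩ :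
    (⊤ : Subgroup (G p)))) ⟨fun x y hxy => ?_, fun x => ?_⟩ _ _ fun x => by rw [← map_mul]
  · exact (mul_bijective hH hK h).1 (congrArg Subtype.val hxy)
  · obtain ⟨y, hy⟩ := (mul_bijective hH hK h).2 x
    exact ⟨y, Subtype.ext hy⟩

theorem coeff_sumOver (H : Subgroup (G p)) [DecidablePred (· ∈ H)] (x : G p) :
    (sumOver R H).coeff x = if x ∈ H then 1 else 0 := by
  classical
  rw [sumOver, MonoidAlgebra.coeff_sum, Finsupp.finsetSum_apply]
  simp only [MonoidAlgebra.of_apply, MonoidAlgebra.coeff_single, Finsupp.single_apply]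
  split_ifs with h
  · rw [Finset.sum_eq_single ⟨x, h⟩] <;> simp
    intro a b hab h1 h2
    exact absurd h2 (by simpa using h1)
  · refine Finset.sum_eq_zero fun y _ => if_neg ?_
    rintro rfl
    exact h y.2

end Hat

/-! ### Action of the group algebra on elements fixed by a subgroup of order `p` -/

section NormalForm

variable {p : ℕ} [Fact p.Prime] {R U : Type*} [CommRing R] [AddCommGroup U] [Module R U]

/-- The sum of the coefficients of `a` over the coset `H g ^ i`. -/
noncomputable def cosetSum (H : Subgroup (G p)) (g : G p) (a : MonoidAlgebra R (G p)) (i : ℕ) : R :=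
  ∑ h : H, a.coeff (h * g ^ i)

theorem asAlgebraHom_apply_eq_sum (σ : Representation R (G p) U) (a : MonoidAlgebra R (G p))
    (x : U) : σ.asAlgebraHom a x = ∑ g, a.coeff g • σ g x := by
  induction a using MonoidAlgebra.induction_linear with
  | zero => simp
  | add a b ha hb => simp [ha, hb, add_smul, Finset.sum_add_distrib]
  | single g r =>
    classical
    simp [Finsupp.single_apply, ite_smul]

/-- On an element fixed by `H` only the image of `a` in `R[G/H]` matters. Its coefficients are the
coset sums, and `G/H` is cyclic, generated by `g`. -/
theorem asAlgebraHom_eq_cosetSum {H : Subgroup (G p)} (hH : Nat.card H = p) {g : G p} (hg : g ∉ H)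
    (σ : Representation R (G p) U) {x : U} (hx : ∀ h ∈ H, σ h x = x)
    (a : MonoidAlgebra R (G p)) :
    σ.asAlgebraHom a x = ∑ i : Fin p, cosetSum H g a i • σ (g ^ (i : ℕ)) x := by
  rw [asAlgebraHom_apply_eq_sum]
  rw [← (Equiv.ofBijective _ (decomp_bijective hH hg)).sum_comp, ← Finset.univ_product_univ,
    Finset.sum_product_right]
  refine Finset.sum_congr rfl fun i _ => ?_
  rw [cosetSum, Finset.sum_smul]
  refine Finset.sum_congr rfl fun h _ => ?_
  simp only [Equiv.ofBijective_apply]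
  rw [show σ ((h : G p) * g ^ (i : ℕ)) x = σ (g ^ (i : ℕ)) x by
    rw [mul_comm, map_mul, Module.End.mul_apply, hx _ h.2]]

theorem cosetSum_sumOver_top {H : Subgroup (G p)} (hH : Nat.card H = p) (g : G p) (i : ℕ) :
    cosetSum H g (sumOver R ⊤) i = p := by
  classical
  simp only [cosetSum, coeff_sumOver, Subgroup.mem_top, if_true, Finset.sum_const,
    Finset.card_univ, nsmul_eq_mul, mul_one]
  rw [← Nat.card_eq_fintype_card, hH]

end NormalForm

/-! ### Orthogonal idempotents and the modules `Λ_i` -/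

section Lam

variable {p : ℕ} [Fact p.Prime]

theorem prime_ne_zero_padic : (p : ℚ_[p]) ≠ 0 := Nat.cast_ne_zero.2 (NeZero.ne p)

/-- The element `p² e_i` of `ℤ_p G`. -/
noncomputable def intIdem : Idx p → MonoidAlgebra ℤ_[p] (G p)
  | none => sumOver ℤ_[p] ⊤
  | some H => (p : ℤ_[p]) • sumOver ℤ_[p] H.1 - sumOver ℤ_[p] ⊤

theorem toQp_of (g : G p) :
    toQp p (MonoidAlgebra.of ℤ_[p] (G p) g) = MonoidAlgebra.of ℚ_[p] (G p) g := by
  simp [toQp]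

theorem toQp_smul (r : ℤ_[p]) (a : MonoidAlgebra ℤ_[p] (G p)) : toQp p (r • a) = r • toQp p a := by
  ext g
  simp [toQp, Algebra.smul_def]

theorem toQp_sumOver (H : Subgroup (G p)) : toQp p (sumOver ℤ_[p] H) = sumOver ℚ_[p] H := by
  simp only [sumOver, map_sum, toQp_of]

theorem coe_smul_eq (r : ℤ_[p]) (x : MonoidAlgebra ℚ_[p] (G p)) : r • x = (r : ℚ_[p]) • x := by
  ext g
  simp [Algebra.smul_def]

theorem toQp_intIdem (i : Idx p) : toQp p (intIdem i) = ((p : ℚ_[p]) ^ 2) • e p i := by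
  have h0 : ((p : ℚ_[p]) ^ 2) ≠ 0 := pow_ne_zero 2 prime_ne_zero_padic
  rcases i with _ | H
  · rw [intIdem, e, smul_smul, mul_inv_cancel₀ h0, one_smul, toQp_sumOver, hat_eq_sumOver]
  · rw [intIdem, e, smul_smul, mul_inv_cancel₀ h0, one_smul, map_sub, toQp_smul, toQp_sumOver,
      toQp_sumOver, hat_eq_sumOver, hat_eq_sumOver, coe_smul_eq]
    simp

/-- Orthogonality of the `e_i` with denominators cleared, so that it can be applied to `ℤ_p
G`-modules. It rests on `Ĥ K̂ = Ĝ` for `H ≠ K`, `Ĥ² = p Ĥ`, `Ĥ Ĝ = p Ĝ` and `Ĝ² = p² Ĝ`. -/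
theorem intIdem_mul_intIdem (i j : Idx p) [Decidable (i = j)] :
    (intIdem i * intIdem j : MonoidAlgebra ℤ_[p] (G p)) =
      if i = j then (p : ℤ_[p]) ^ 2 • intIdem i else 0 := by
  have htop : (Nat.card (⊤ : Subgroup (G p)) : ℤ_[p]) = p * p := by
    rw [Subgroup.card_top, natCard_G, Nat.cast_mul]
  have h1 (H : Subgroup (G p)) (hH : Nat.card H = p) :
      sumOver ℤ_[p] H * sumOver ℤ_[p] ⊤ = (p : ℤ_[p]) • sumOver ℤ_[p] ⊤ := by
    rw [sumOver_mul_sumOver_of_le le_top, hH]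
  have h2 : sumOver ℤ_[p] (⊤ : Subgroup (G p)) * sumOver ℤ_[p] ⊤ =
      ((p : ℤ_[p]) * p) • sumOver ℤ_[p] ⊤ := by
    rw [sumOver_mul_sumOver_of_le le_top, htop]
  rcases i with _ | ⟨H, hH⟩ <;> rcases j with _ | ⟨K, hK⟩
  · rw [if_pos rfl, intIdem, h2, sq]
  · rw [if_neg (by simp), intIdem, intIdem, mul_sub, mul_smul_comm, mul_comm, h1 _ hK, h2]
    module
  · rw [if_neg (by simp), intIdem, intIdem, sub_mul, smul_mul_assoc, h1 _ hH, h2]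
    module
  · simp only [intIdem, mul_sub, sub_mul, smul_mul_assoc, mul_smul_comm, h1 _ hH, h1 _ hK, h2,
      mul_comm (sumOver ℤ_[p] ⊤) (sumOver ℤ_[p] K)]
    split_ifs with h
    · obtain rfl : H = K := by simpa using h
      rw [sumOver_mul_sumOver_of_le le_rfl, hH]
      module
    · rw [sumOver_mul_sumOver_of_ne hK hH (by simpa using h)]
      module

theorem e_mul_e (i j : Idx p) [Decidable (i = j)] : e p i * e p j = if i = j then e p i else 0 := by
  have h0 : ((p : ℚ_[p]) ^ 2) ≠ 0 := pow_ne_zero 2 prime_ne_zero_padic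
  have h := congrArg (toQp p) (intIdem_mul_intIdem i j)
  rw [map_mul, toQp_intIdem, toQp_intIdem, smul_mul_smul_comm] at h
  have h' : e p i * e p j = ((p : ℚ_[p]) ^ 2 * (p : ℚ_[p]) ^ 2)⁻¹ •
      toQp p (if i = j then (p : ℤ_[p]) ^ 2 • intIdem i else 0) := by
    rw [← h, smul_smul, inv_mul_cancel₀ (mul_ne_zero h0 h0), one_smul]
  rw [h']
  split_ifs
  · rw [toQp_smul, toQp_intIdem, coe_smul_eq, PadicInt.coe_pow, PadicInt.coe_natCast,
      smul_smul ((p : ℚ_[p]) ^ 2), smul_smul, inv_mul_cancel₀ (mul_ne_zero h0 h0), one_smul]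
  · simp

theorem asAlgebraHom_lamRep (i : Idx p) (a : MonoidAlgebra ℤ_[p] (G p)) (x : Lam p i) :
    ((lamRep p i).asAlgebraHom a x : MonoidAlgebra ℚ_[p] (G p)) = toQp p a * x := by
  induction a using MonoidAlgebra.induction_linear with
  | zero => simp
  | add a b ha hb => simp [ha, hb, add_mul]
  | single g r =>
    have h1 : MonoidAlgebra.single g r = r • MonoidAlgebra.of ℤ_[p] (G p) g := by simp
    rw [h1, map_smul, asAlgebraHom_of, toQp_smul, toQp_of, smul_mul_assoc]
    rfl

/-- The generator `e_i` of `Λ_i`. -/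
noncomputable def lamGen (i : Idx p) : Lam p i := ⟨e p i, 1, by simp⟩

theorem exists_asAlgebraHom_lamGen {i : Idx p} (x : Lam p i) :
    ∃ a : MonoidAlgebra ℤ_[p] (G p), x = (lamRep p i).asAlgebraHom a (lamGen i) := by
  obtain ⟨x, a, rfl⟩ := x
  exact ⟨a, Subtype.ext ((mul_comm _ _).trans (asAlgebraHom_lamRep i a (lamGen i)).symm)⟩

theorem asAlgebraHom_lamGen_eq_zero_iff (i : Idx p) (a : MonoidAlgebra ℤ_[p] (G p)) :
    (lamRep p i).asAlgebraHom a (lamGen i) = 0 ↔ e p i * toQp p a = 0 := by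
  rw [← Subtype.coe_inj, asAlgebraHom_lamRep, mul_comm]
  rfl

theorem asAlgebraHom_intIdem_lam (i j : Idx p) [Decidable (i = j)] (x : Lam p j) :
    (lamRep p j).asAlgebraHom (intIdem i) x = if i = j then (p : ℤ_[p]) ^ 2 • x else 0 := by
  obtain ⟨x, a, rfl⟩ := x
  apply Subtype.ext
  rw [asAlgebraHom_lamRep, toQp_intIdem, smul_mul_assoc, ← mul_assoc, e_mul_e]
  split_ifs with h
  · subst h
    simp [coe_smul_eq]
  · simp

instance : Module.IsTorsionFree ℤ_[p] (MonoidAlgebra ℚ_[p] (G p)) where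
  isSMulRegular r hr x y hxy := by
    have h0 : (r : ℚ_[p]) ≠ 0 := by simpa using hr.ne_zero
    dsimp only at hxy
    rw [coe_smul_eq, coe_smul_eq] at hxy
    exact smul_right_injective _ h0 hxy

theorem lamRep_of_mem {H : {H : Subgroup (G p) // Nat.card H = p}} {h : G p} (hh : h ∈ H.1)
    (x : Lam p (some H)) : lamRep p (some H) h x = x := by
  obtain ⟨x, a, rfl⟩ := x
  apply Subtype.ext
  change MonoidAlgebra.of ℚ_[p] (G p) h * (e p (some H) * toQp p a) = e p (some H) * toQp p a
  rw [← mul_assoc, e, mul_smul_comm, mul_sub, mul_smul_comm, hat_eq_sumOver, hat_eq_sumOver,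
    of_mul_sumOver hh, of_mul_sumOver (Subgroup.mem_top h)]

theorem lamRep_none (g : G p) (x : Lam p none) : lamRep p none g x = x := by
  obtain ⟨x, a, rfl⟩ := x
  apply Subtype.ext
  change MonoidAlgebra.of ℚ_[p] (G p) g * (e p none * toQp p a) = e p none * toQp p a
  rw [← mul_assoc, e, mul_smul_comm, hat_eq_sumOver, of_mul_sumOver (Subgroup.mem_top g)]

theorem prime_ne_zero_padicInt : (p : ℤ_[p]) ≠ 0 := Nat.cast_ne_zero.2 (NeZero.ne p)

/-- `Ĝ = p² e_0` kills `Λ_H` and acts on its `H`-fixed elements as `p ∑ g ^ i`; torsion-freeness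
removes the factor `p`. -/
theorem sum_lamRep_pow {H : {H : Subgroup (G p) // Nat.card H = p}} {g : G p} (hg : g ∉ H.1)
    (x : Lam p (some H)) : ∑ i : Fin p, lamRep p (some H) (g ^ (i : ℕ)) x = 0 := by
  classical
  have h := asAlgebraHom_intIdem_lam none (some H) x
  rw [if_neg (by simp), intIdem,
    asAlgebraHom_eq_cosetSum H.2 hg _ (fun h hh => lamRep_of_mem hh x)] at h
  simp only [cosetSum_sumOver_top H.2, ← Finset.smul_sum] at h
  exact (smul_eq_zero_iff_right prime_ne_zero_padicInt).1 h

theorem coeff_e_some (H : {H : Subgroup (G p) // Nat.card H = p}) [DecidablePred (· ∈ H.1)]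
    (x : G p) : (e p (some H)).coeff x =
      ((p : ℚ_[p]) ^ 2)⁻¹ * (p * (if x ∈ H.1 then 1 else 0) - 1) := by
  classical
  simp [e, hat_eq_sumOver, coeff_sumOver]

/-- The coefficient of `g ^ i * e_H` at `g ^ j` is `p⁻² (p δ_ij - 1)`. It follows that all `l j` are
equal: the norm is the only relation in `Λ_H` as a quotient of `ℤ_p[G/H]`. -/
theorem eq_sum_of_sum_smul_lamGen_eq_zero {H : {H : Subgroup (G p) // Nat.card H = p}} {g : G p}
    (hg : g ∉ H.1) {l : Fin p → ℤ_[p]}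
    (h : ∑ i, l i • lamRep p (some H) (g ^ (i : ℕ)) (lamGen (some H)) = 0) (j : Fin p) :
    p * l j = ∑ i, l i := by
  classical
  have h1 := congrArg (fun x : Lam p (some H) => x.1.coeff (g ^ (j : ℕ))) h
  have h2 : ∀ i : Fin p, ((lamRep p (some H) (g ^ (i : ℕ)) (lamGen (some H))).1).coeff
      (g ^ (j : ℕ)) = ((p : ℚ_[p]) ^ 2)⁻¹ * (p * (if i = j then 1 else 0) - 1) := by
    intro i
    change (MonoidAlgebra.of ℚ_[p] (G p) (g ^ (i : ℕ)) * e p (some H)).coeff (g ^ (j : ℕ)) = _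
    rw [MonoidAlgebra.of_apply, MonoidAlgebra.coeff_single_mul_apply, one_mul, coeff_e_some]
    congr 4
    rw [eq_iff_iff]
    constructor
    · intro hmem
      have := (decomp_bijective H.2 hg).1 (a₁ := (⟨_, hmem⟩, i)) (a₂ := (1, j)) (by simp)
      exact (Prod.ext_iff.1 this).2
    · rintro rfl
      simp
  simp only [Submodule.coe_sum, Submodule.coe_smul, MonoidAlgebra.coeff_sum,
    Finsupp.finsetSum_apply, coe_smul_eq, MonoidAlgebra.coeff_smul, Finsupp.smul_apply, h2,
    smul_eq_mul] at h1
  have h0 : ((p : ℚ_[p]) ^ 2)⁻¹ ≠ 0 := inv_ne_zero (pow_ne_zero 2 prime_ne_zero_padic)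
  have h3 : ((p : ℚ_[p]) ^ 2)⁻¹ * (p * (l j : ℚ_[p]) - ∑ i, (l i : ℚ_[p])) = 0 := by
    refine Eq.trans ?_ (h1.trans (by simp))
    rw [mul_sub, Finset.mul_sum]
    simp only [mul_sub, mul_ite, mul_one, mul_zero, Finset.sum_sub_distrib,
      Finset.sum_ite_eq', Finset.mem_univ, if_true]
    congr 1
    · ring
    · exact Finset.sum_congr rfl fun i _ => by ring
  have h4 := (mul_eq_zero.1 h3).resolve_left h0
  have h5 : ((p * l j : ℤ_[p]) : ℚ_[p]) = ((∑ i, l i : ℤ_[p]) : ℚ_[p]) := by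
    rw [PadicInt.coe_sum]
    push_cast
    exact sub_eq_zero.1 h4
  exact PadicInt.ext h5

end Lam

end CpCpLattice

namespace CpCpLattice

open Representation

/-! ### Ranks of the `Λ_i` -/

section Rank

/-- The all-ones relation makes the last generator redundant, and a relation among the others,
extended by `0`, has constant coefficients, hence is trivial. -/
theorem finrank_of_sum_eq_zero {R M : Type*} [CommRing R] [Nontrivial R] [AddCommGroup M]
    [Module R M] {m : ℕ} (z : Fin (m + 1) → M) (hspan : ⊤ ≤ Submodule.span R (Set.range z))
    (hsum : ∑ i, z i = 0) (hconst : ∀ l : Fin (m + 1) → R, ∑ i, l i • z i = 0 → ∀ i j, l i = l j) :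
    Module.finrank R M = m := by
  have hind : LinearIndependent R (fun i : Fin m => z i.castSucc) := by
    rw [Fintype.linearIndependent_iff]
    intro l hl i
    have := hconst (Fin.snoc l 0) (by rw [Fin.sum_univ_castSucc]; simpa using hl) i.castSucc
      (Fin.last m)
    simpa using this
  have hsp : ⊤ ≤ Submodule.span R (Set.range fun i : Fin m => z i.castSucc) := by
    refine hspan.trans (Submodule.span_le.2 ?_)
    rintro _ ⟨i, rfl⟩
    refine Fin.lastCases ?_ (fun i => Submodule.subset_span ⟨i, rfl⟩) i
    rw [Fin.sum_univ_castSucc] at hsum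
    rw [SetLike.mem_coe, eq_neg_of_add_eq_zero_right hsum]
    exact Submodule.neg_mem _ (Submodule.sum_mem _ fun i _ => Submodule.subset_span ⟨i, rfl⟩)
  rw [Module.finrank_eq_card_basis (Module.Basis.mk hind hsp), Fintype.card_fin]

variable {p : ℕ} [Fact p.Prime]

instance (i : Idx p) : Module.Finite ℤ_[p] (Lam p i) := by
  have : Module.Finite ℤ_[p] (MonoidAlgebra ℤ_[p] (G p)) := inferInstance
  refine Module.Finite.of_surjective
    (((lamRep p i).asAlgebraHom.toLinearMap).flip (lamGen i)) fun x => ?_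
  obtain ⟨a, ha⟩ := exists_asAlgebraHom_lamGen x
  exact ⟨a, ha.symm⟩

instance (i : Idx p) : Module.Free ℤ_[p] (Lam p i) := inferInstance

theorem lamGen_ne_zero (i : Idx p) : lamGen i ≠ 0 := by
  classical
  intro h
  have h2 : e p i * toQp p (intIdem i) = 0 := by
    rw [← asAlgebraHom_lamGen_eq_zero_iff, h, map_zero]
  have h3 := congrArg (fun x => x.coeff 1) h2
  rw [toQp_intIdem, mul_smul_comm, e_mul_e, if_pos rfl] at h3
  have h0 := prime_ne_zero_padic (p := p)
  have hp : (p : ℚ_[p]) - 1 ≠ 0 := by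
    rw [sub_ne_zero]
    exact_mod_cast (Fact.out : p.Prime).one_lt.ne'
  rcases i with _ | H
  · simp [e, hat_eq_sumOver, coeff_sumOver, h0] at h3
  · simp [coeff_e_some, h0, hp] at h3

theorem finrank_lam_none : Module.finrank ℤ_[p] (Lam p none) = 1 := by
  have hspan : ∀ x : Lam p none, ∃ r : ℤ_[p], x = r • lamGen none := by
    intro x
    obtain ⟨a, rfl⟩ := exists_asAlgebraHom_lamGen x
    refine ⟨∑ g, a.coeff g, ?_⟩
    simp [asAlgebraHom_apply_eq_sum, lamRep_none, Finset.sum_smul]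
  let b : Module.Basis Unit ℤ_[p] (Lam p none) := Module.Basis.mk (v := fun _ => lamGen none)
    (linearIndependent_unique_iff.2 (lamGen_ne_zero none)) (by
      intro x _
      obtain ⟨r, rfl⟩ := hspan x
      exact Submodule.smul_mem _ _ (Submodule.subset_span ⟨(), rfl⟩))
  rw [Module.finrank_eq_card_basis b, Fintype.card_unit]

theorem exists_notMem {H : Subgroup (G p)} (hH : Nat.card H = p) : ∃ g, g ∉ H := by
  by_contra! h
  have : H = ⊤ := (Subgroup.eq_top_iff' H).2 h
  rw [this, Subgroup.card_top, natCard_G] at hH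
  nlinarith [(Fact.out : p.Prime).one_lt]

theorem finrank_lam_some (H : {H : Subgroup (G p) // Nat.card H = p}) :
    Module.finrank ℤ_[p] (Lam p (some H)) = p - 1 := by
  obtain ⟨g, hg⟩ := exists_notMem H.2
  obtain ⟨m, hm⟩ : ∃ m, p = m + 1 := ⟨p - 1, by have := (Fact.out : p.Prime).pos; omega⟩
  have hcast : ∀ {M : Type} [AddCommMonoid M] (f : ℕ → M), ∑ i : Fin (m + 1), f i = ∑ i : Fin p, f i := by
    intro M _ f; rw [Fin.sum_univ_eq_sum_range, Fin.sum_univ_eq_sum_range, hm]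
  rw [show p - 1 = m by omega]
  refine finrank_of_sum_eq_zero
    (fun i : Fin (m + 1) => lamRep p (some H) (g ^ (i : ℕ)) (lamGen (some H))) ?_ ?_ ?_
  · intro x _
    obtain ⟨a, rfl⟩ := exists_asAlgebraHom_lamGen x
    rw [asAlgebraHom_eq_cosetSum H.2 hg _ (fun h hh => lamRep_of_mem hh _)]
    refine Submodule.sum_mem _ fun i _ => Submodule.smul_mem _ _ (Submodule.subset_span ?_)
    exact ⟨Fin.cast hm i, by simp⟩
  · exact (hcast fun i => lamRep p (some H) (g ^ i) (lamGen (some H))).trans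
      (sum_lamRep_pow hg _)
  · intro l hl
    have hl' : ∑ i : Fin p, l (Fin.cast hm i) • lamRep p (some H) (g ^ (i : ℕ)) (lamGen (some H)) = 0 := by
      rw [← hl]
      exact Fintype.sum_equiv (finCongr hm) _ _ fun i => by simp
    have := eq_sum_of_sum_smul_lamGen_eq_zero hg hl'
    intro i j
    refine mul_left_cancel₀ prime_ne_zero_padicInt ((this (Fin.cast hm.symm i)).trans
      (this (Fin.cast hm.symm j)).symm)

end Rank

section PiRep

variable {R G ι : Type*} {U : ι → Type*} [CommRing R] [Monoid G]
    [∀ i, AddCommGroup (U i)] [∀ i, Module R (U i)]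
    (σ : ∀ i, Representation R G (U i))

theorem piRep_apply (g : G) (x : ∀ i, U i) (i : ι) : piRep σ g x i = σ i g (x i) := rfl

theorem asAlgebraHom_piRep (a : MonoidAlgebra R G) (x : ∀ i, U i) (i : ι) :
    (piRep σ).asAlgebraHom a x i = (σ i).asAlgebraHom a (x i) :=
  map_asAlgebraHom (LinearMap.proj i) (fun _ _ => rfl) a x

end PiRep

/-! ### Reduction from `ℤ_p` to `𝔽_p` -/

section Residue

variable {p : ℕ} [Fact p.Prime]

theorem maximalIdeal_padicInt : IsLocalRing.maximalIdeal ℤ_[p] = Ideal.span {(p : ℤ_[p])} :=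
  PadicInt.maximalIdeal_eq_span_p

theorem maximalIdeal_zmod : IsLocalRing.maximalIdeal (ZMod p) = Ideal.span {(p : ZMod p)} := by
  rw [CharP.cast_eq_zero, Ideal.span_singleton_zero]
  exact IsLocalRing.eq_maximalIdeal Ideal.bot_isMaximal |>.symm

theorem radical_padicInt {U : Type*} [AddCommGroup U] [Module ℤ_[p] U]
    (σ : Representation ℤ_[p] (G p) U) : radical σ = augRadical p σ :=
  radical_eq_augRadical maximalIdeal_padicInt pow_p_eq_one σ

theorem radical_zmod {U : Type*} [AddCommGroup U] [Module (ZMod p) U]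
    (σ : Representation (ZMod p) (G p) U) : radical σ = augRadical p σ :=
  radical_eq_augRadical maximalIdeal_zmod pow_p_eq_one σ

theorem toZMod_surjective : Function.Surjective (PadicInt.toZMod : ℤ_[p] →+* ZMod p) :=
  ZMod.ringHom_surjective _

instance : RingHomSurjective (PadicInt.toZMod : ℤ_[p] →+* ZMod p) := ⟨toZMod_surjective⟩

theorem toZMod_eq_zero_iff {r : ℤ_[p]} : PadicInt.toZMod r = 0 ↔ ∃ s, r = p * s := by
  rw [← RingHom.mem_ker, PadicInt.ker_toZMod, maximalIdeal_padicInt, Ideal.mem_span_singleton]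
  rfl

theorem toFp_single (g : G p) (r : ℤ_[p]) :
    toFp p (MonoidAlgebra.single g r) = MonoidAlgebra.single g (PadicInt.toZMod r) := by
  simp [toFp]

theorem coeff_toFp (a : MonoidAlgebra ℤ_[p] (G p)) (g : G p) :
    (toFp p a).coeff g = PadicInt.toZMod (a.coeff g) := by
  simp [toFp]

end Residue

end CpCpLattice

namespace CpCpLattice

open Representation

variable {p : ℕ} [Fact p.Prime] {V : Type*} [AddCommGroup V] [Module (ZMod p) V]
  {ρ : Representation (ZMod p) (G p) V}

/-! ### Existence of the covering maps `f_i` -/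

section Existence

theorem asAlgebraHom_toRepresentation {R G U : Type*} [CommRing R] [Monoid G] [AddCommMonoid U]
    [Module R U] {σ : Representation R G U} (A : Subrepresentation σ) (a : MonoidAlgebra R G)
    (x : A.toSubmodule) : (A.toRepresentation.asAlgebraHom a x : U) = σ.asAlgebraHom a x :=
  map_asAlgebraHom A.toSubmodule.subtype (fun _ _ => rfl) a x

/-- Modulo the radical, every element of the group algebra acts through its augmentation. -/
theorem asAlgebraHom_sub_mem_augRadical {R U : Type*} [CommRing R] [AddCommGroup U] [Module R U]
    (σ : Representation R (G p) U) (a : MonoidAlgebra R (G p)) (x : U) :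
    σ.asAlgebraHom a x - (∑ g, a.coeff g) • x ∈ augRadical p σ := by
  rw [asAlgebraHom_apply_eq_sum, Finset.sum_smul, ← Finset.sum_sub_distrib]
  refine Submodule.sum_mem _ fun g _ => ?_
  rw [← smul_sub]
  exact Submodule.smul_mem _ _ (sub_mem_augRadical σ g x)

theorem map_mem_augRadical {U W : Type*} [AddCommGroup U] [Module ℤ_[p] U]
    [AddCommGroup W] [Module (ZMod p) W] {σ : Representation ℤ_[p] (G p) U}
    {τ : Representation (ZMod p) (G p) W} (T : U →ₛₗ[(PadicInt.toZMod : ℤ_[p] →+* ZMod p)] W)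
    (hT : ∀ g x, T (σ g x) = τ g (T x)) {x : U} (hx : x ∈ augRadical p σ) :
    T x ∈ augRadical p τ := by
  have : augRadical p σ ≤ (augRadical p τ).comap T := by
    refine Submodule.span_le.2 ?_
    rintro _ (⟨y, rfl⟩ | ⟨g, y, rfl⟩)
    · simp
    · rw [SetLike.mem_coe, Submodule.mem_comap, map_sub, hT]
      exact sub_mem_augRadical _ _ _
  exact this hx

/-- The action of `ℤ_p G` on `A` factors through `Λ_i`. -/
def FactorsThrough (i : Idx p) (A : Subrepresentation ρ) : Prop :=
  ∀ a : MonoidAlgebra ℤ_[p] (G p), e p i * toQp p a = 0 →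
    ∀ v ∈ A, ρ.asAlgebraHom (toFp p a) v = 0

/-- This is what makes `FactorsThrough.lamMap` independent of the chosen representatives in `ℤ_p G`.
-/
theorem FactorsThrough.asAlgebraHom_eq {i : Idx p} {A : Subrepresentation ρ}
    (hA : FactorsThrough i A) {a b : MonoidAlgebra ℤ_[p] (G p)}
    (h : (lamRep p i).asAlgebraHom a (lamGen i) = (lamRep p i).asAlgebraHom b (lamGen i))
    (w : A.toSubmodule) :
    A.toRepresentation.asAlgebraHom (toFp p a) w = A.toRepresentation.asAlgebraHom (toFp p b) w := by
  apply Subtype.ext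
  rw [asAlgebraHom_toRepresentation, asAlgebraHom_toRepresentation, ← sub_eq_zero,
    ← LinearMap.sub_apply, ← map_sub, ← map_sub]
  refine hA _ ?_ _ w.2
  rw [← asAlgebraHom_lamGen_eq_zero_iff, map_sub, LinearMap.sub_apply, h, sub_self]

/-- The homomorphism `Λ_i → A` that sends `e_i` to `w`. -/
noncomputable def FactorsThrough.lamMap {i : Idx p} {A : Subrepresentation ρ}
    (hA : FactorsThrough i A) (w : A.toSubmodule) :
    Lam p i →ₛₗ[(PadicInt.toZMod : ℤ_[p] →+* ZMod p)] A.toSubmodule where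
  toFun x := A.toRepresentation.asAlgebraHom (toFp p (exists_asAlgebraHom_lamGen x).choose) w
  map_add' x y := by
    rw [← LinearMap.add_apply, ← map_add, ← map_add]
    refine hA.asAlgebraHom_eq ?_ w
    rw [map_add, LinearMap.add_apply, ← (exists_asAlgebraHom_lamGen (x + y)).choose_spec,
      ← (exists_asAlgebraHom_lamGen x).choose_spec, ← (exists_asAlgebraHom_lamGen y).choose_spec]
  map_smul' r x := by
    have h : toFp p (r • (exists_asAlgebraHom_lamGen x).choose) =
        (PadicInt.toZMod r) • toFp p (exists_asAlgebraHom_lamGen x).choose := by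
      ext g
      simp [coeff_toFp]
    rw [← LinearMap.smul_apply, ← map_smul, ← h]
    refine hA.asAlgebraHom_eq ?_ w
    rw [map_smul, LinearMap.smul_apply, ← (exists_asAlgebraHom_lamGen (r • x)).choose_spec,
      ← (exists_asAlgebraHom_lamGen x).choose_spec]

theorem FactorsThrough.lamMap_apply {i : Idx p} {A : Subrepresentation ρ}
    (hA : FactorsThrough i A) (w : A.toSubmodule) (a : MonoidAlgebra ℤ_[p] (G p)) :
    hA.lamMap w ((lamRep p i).asAlgebraHom a (lamGen i)) =
      A.toRepresentation.asAlgebraHom (toFp p a) w := by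
  refine hA.asAlgebraHom_eq ?_ w
  rw [← (exists_asAlgebraHom_lamGen _).choose_spec]

theorem FactorsThrough.lamMap_lamRep {i : Idx p} {A : Subrepresentation ρ}
    (hA : FactorsThrough i A) (w : A.toSubmodule) (g : G p) (x : Lam p i) :
    hA.lamMap w (lamRep p i g x) = A.toRepresentation g (hA.lamMap w x) := by
  obtain ⟨a, rfl⟩ := exists_asAlgebraHom_lamGen x
  have h1 : lamRep p i g ((lamRep p i).asAlgebraHom a (lamGen i)) =
      (lamRep p i).asAlgebraHom (MonoidAlgebra.single g 1 * a) (lamGen i) := by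
    rw [map_mul, asAlgebraHom_single_one]; rfl
  rw [h1, hA.lamMap_apply, hA.lamMap_apply, map_mul, toFp_single, map_one, map_mul,
    asAlgebraHom_single_one]
  rfl

/-- Lift a basis of the head of `A` to vectors `w k` and send the generator of the `k`-th copy of
`Λ_i` to `w k`. Nakayama gives surjectivity, and the induced map of heads is injective because the
`w k` are independent modulo the radical. -/
theorem FactorsThrough.exists_cover {i : Idx p} {A : Subrepresentation ρ} [Module.Finite (ZMod p) V]
    (hA : FactorsThrough i A) :
    ∃ f : (Fin (headDim A) → Lam p i) →ₛₗ[(PadicInt.toZMod : ℤ_[p] →+* ZMod p)] A.toSubmodule,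
      (∀ (g : G p) (x : Fin (headDim A) → Lam p i),
        f (piRep (fun _ => lamRep p i) g x) = A.toRepresentation g (f x)) ∧
      Function.Surjective f ∧
      ∀ x, f x ∈ radical A.toRepresentation ↔
        x ∈ radical (piRep (fun _ : Fin (headDim A) => lamRep p i)) := by
  let b : Module.Basis (Fin (headDim A)) (ZMod p) (A.toSubmodule ⧸ radical A.toRepresentation) :=
    Module.finBasis _ _
  choose w hw using fun k => Submodule.Quotient.mk_surjective _ (b k)
  let f : (Fin (headDim A) → Lam p i) →ₛₗ[(PadicInt.toZMod : ℤ_[p] →+* ZMod p)] A.toSubmodule :=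
    ∑ k, (hA.lamMap (w k)).comp (LinearMap.proj k)
  have hf : ∀ x, f x = ∑ k, hA.lamMap (w k) (x k) := fun x => by simp [f]
  have heq : ∀ (g : G p) (x : Fin (headDim A) → Lam p i),
      f (piRep (fun _ => lamRep p i) g x) = A.toRepresentation g (f x) := by
    intro g x
    simp only [hf, map_sum, piRep_apply, hA.lamMap_lamRep]
  have hfw : ∀ k, w k ∈ LinearMap.range f := by
    intro k
    refine ⟨Pi.single k (lamGen i), ?_⟩
    rw [hf, Finset.sum_eq_single k]
    · have := hA.lamMap_apply (w k) 1
      simpa using this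
    · intro j _ hj
      rw [Pi.single_eq_of_ne hj, map_zero]
    · simp
  refine ⟨f, heq, ?_, fun x => ⟨fun hx => ?_, fun hx => ?_⟩⟩
  · let S : Subrepresentation A.toRepresentation := ⟨LinearMap.range f, by
      rintro g _ ⟨x, rfl⟩
      exact ⟨_, heq g x⟩⟩
    have hS : S.toSubmodule ⊔ radical A.toRepresentation = ⊤ := by
      rw [eq_top_iff]
      intro y _
      have hy : y - ∑ k, b.repr (Submodule.Quotient.mk y) k • w k ∈ radical A.toRepresentation := by
        rw [← Submodule.Quotient.mk_eq_zero, Submodule.Quotient.mk_sub, sub_eq_zero]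
        conv_lhs => rw [← b.sum_repr (Submodule.Quotient.mk y)]
        change _ = (radical A.toRepresentation).mkQ _
        rw [map_sum]
        exact Finset.sum_congr rfl fun k _ => by rw [map_smul, Submodule.mkQ_apply, hw]
      rw [← sub_add_cancel y (∑ k, b.repr (Submodule.Quotient.mk y) k • w k), add_comm]
      exact Submodule.add_mem_sup (Submodule.sum_mem _ fun k _ => Submodule.smul_mem _ _ (hfw k)) hy
    have := eq_top_of_sup_radical_eq_top S hS
    exact LinearMap.range_eq_top.1 this
  · choose a ha using fun k => exists_asAlgebraHom_lamGen (x k)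
    -- Modulo the radical only augmentations count. Independence of the basis of the head makes each
    -- augmentation vanish in `𝔽_p`, so that of `a k` is divisible by `p` and `x k` lies in `Rad
    -- Λ_i`.
    have h1 : ∑ k, (∑ g, (toFp p (a k)).coeff g) • w k ∈ radical A.toRepresentation := by
      have h2 : f x - ∑ k, (∑ g, (toFp p (a k)).coeff g) • w k ∈ radical A.toRepresentation := by
        rw [hf, ← Finset.sum_sub_distrib]
        refine Submodule.sum_mem _ fun k _ => ?_
        rw [ha k, hA.lamMap_apply, radical_zmod]
        exact asAlgebraHom_sub_mem_augRadical _ _ _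
      have := Submodule.sub_mem _ hx h2
      simpa using this
    rw [← Submodule.Quotient.mk_eq_zero, ← Submodule.mkQ_apply, map_sum] at h1
    simp only [map_smul, Submodule.mkQ_apply, hw] at h1
    have h3 := Fintype.linearIndependent_iff.1 b.linearIndependent _ h1
    rw [radical_padicInt, ← Finset.univ_sum_single x]
    refine Submodule.sum_mem _ fun k _ => ?_
    have h4 : x k ∈ augRadical p (lamRep p i) := by
      have h5 := h3 k
      simp only [coeff_toFp, ← map_sum] at h5
      obtain ⟨s, hs⟩ := toZMod_eq_zero_iff.1 h5
      have h6 := asAlgebraHom_sub_mem_augRadical (lamRep p i) (a k) (lamGen i)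
      rw [hs, ← ha k, mul_smul] at h6
      have := Submodule.add_mem _ h6 (smul_mem_augRadical (lamRep p i) (s • lamGen i))
      simpa using this
    refine map_augRadical_le (LinearMap.single ℤ_[p] (fun _ => Lam p i) k) (fun g y => ?_)
      ⟨_, h4, rfl⟩
    ext1 j
    rw [piRep_apply]
    by_cases hj : j = k
    · subst hj; simp
    · simp [Pi.single_eq_of_ne hj]
  · rw [radical_padicInt] at hx
    rw [radical_zmod]
    exact map_mem_augRadical f heq hx

theorem IsDiagram.nonempty_cover {D : Idx p → Subrepresentation ρ} (hD : IsDiagram D) :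
    Nonempty (Cover D) := by
  have := hD.1
  choose f h1 h2 h3 using fun i => FactorsThrough.exists_cover (i := i) (A := D i) (hD.2.2 i)
  exact ⟨⟨f, h1, h2, h3⟩⟩

end Existence

end CpCpLattice

namespace CpCpLattice

open Representation

variable {p : ℕ} [Fact p.Prime] {V : Type*} [AddCommGroup V] [Module (ZMod p) V]
  {ρ : Representation (ZMod p) (G p) V} {D : Idx p → Subrepresentation ρ}

/-! ### The kernel lattice between `p F` and `F` -/

section Basic

theorem asAlgebraHom_intIdem_fRep (i j : Idx p) [Decidable (i = j)] (x : ∀ i, Fi D i) :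
    (fRep D).asAlgebraHom (intIdem i) x j = if i = j then (p : ℤ_[p]) ^ 2 • x j else 0 := by
  ext1 k
  rw [fRep, asAlgebraHom_piRep, fiRep, asAlgebraHom_piRep, asAlgebraHom_intIdem_lam]
  split_ifs <;> rfl

namespace Cover

variable (φ : Cover D)

theorem mem_kernel {x : ∀ i, Fi D i} :
    x ∈ φ.kernel.toSubmodule ↔ ∑ i, (φ.f i (x i) : V) = 0 := by
  rw [← φ.total_apply]; rfl

theorem smul_mem_kernel (x : ∀ i, Fi D i) : (p : ℤ_[p]) • x ∈ φ.kernel.toSubmodule := by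
  rw [mem_kernel]
  refine Finset.sum_eq_zero fun i _ => ?_
  rw [Pi.smul_apply, map_smulₛₗ]
  simp

/-- The defect `-f_j y` is a sum of vectors of the other `V_i`, and these lift along the surjections
`f_i`. -/
theorem exists_mem_kernel (hD : ∀ j : Idx p, ⨆ i : {i : Idx p // i ≠ j}, (D i.1).toSubmodule = ⊤)
    (j : Idx p) (y : Fi D j) : ∃ x : φ.Lattice, x.1 j = y := by
  classical
  have h : -(φ.f j y : V) ∈ ⨆ i : {i : Idx p // i ≠ j}, (D i.1).toSubmodule := by
    rw [hD j]; trivial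
  obtain ⟨w, hw⟩ := (Submodule.mem_iSup_iff_exists_finsupp _ _).1 h
  obtain ⟨hw1, hw2⟩ := hw
  choose z hz using fun i : {i : Idx p // i ≠ j} => φ.surjective i.1 ⟨w i, hw1 i⟩
  refine ⟨⟨fun i => if hi : i = j then hi ▸ y else z ⟨i, hi⟩, ?_⟩, by simp⟩
  rw [mem_kernel, ← Finset.add_sum_erase _ _ (Finset.mem_univ j)]
  have h2 : ∑ i ∈ Finset.univ.erase j, (φ.f i (if hi : i = j then hi ▸ y else z ⟨i, hi⟩) : V) =
      ∑ i : {i : Idx p // i ≠ j}, w i := by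
    rw [Finset.sum_subtype (p := fun i => i ≠ j) _ (by simp)]
    refine Finset.sum_congr rfl fun i _ => ?_
    rw [dif_neg i.2, hz]
  rw [h2, dif_pos rfl]
  rw [Finsupp.sum_fintype _ _ (fun _ => rfl)] at hw2
  rw [hw2, add_neg_cancel]

instance : Module.Finite ℤ_[p] φ.Lattice :=
  inferInstanceAs (Module.Finite ℤ_[p] φ.kernel.toSubmodule)

instance : Module.Free ℤ_[p] φ.Lattice :=
  Module.free_of_finite_type_torsion_free' (R := ℤ_[p]) (M := φ.Lattice)

theorem isLattice : IsLattice φ.lattice :=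
  ⟨inferInstanceAs (Module.Free ℤ_[p] φ.Lattice), inferInstanceAs (Module.Finite ℤ_[p] φ.Lattice)⟩

/-- Multiplication by `p` embeds `F` into the lattice, which is itself a submodule of `F`. -/
theorem finrank_lattice : Module.finrank ℤ_[p] φ.Lattice =
    ∑ i, headDim (D i) * Module.finrank ℤ_[p] (Lam p i) := by
  have h1 : Module.finrank ℤ_[p] (∀ i, Fi D i) =
      ∑ i, headDim (D i) * Module.finrank ℤ_[p] (Lam p i) := by
    rw [Module.finrank_pi_fintype]
    refine Finset.sum_congr rfl fun i _ => ?_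
    rw [Module.finrank_pi_fintype]
    simp
  rw [← h1]
  apply le_antisymm (Submodule.finrank_le _)
  let T : (∀ i, Fi D i) →ₗ[ℤ_[p]] φ.Lattice :=
    LinearMap.codRestrict _ ((p : ℤ_[p]) • LinearMap.id) φ.smul_mem_kernel
  refine LinearMap.finrank_le_finrank_of_injective (f := T) fun x y hxy => ?_
  have : (p : ℤ_[p]) • x = (p : ℤ_[p]) • y := congrArg Subtype.val hxy
  exact smul_right_injective _ prime_ne_zero_padicInt this

end Cover

end Basic

section Projection

/-- The projection onto a direct summand is equivariant. -/
theorem exists_projection {R G U : Type*} [CommRing R] [Monoid G] [AddCommGroup U]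
    [Module R U] {σ : Representation R G U} {A B : Subrepresentation σ} (h : IsCompl A B) :
    ∃ θ : U →ₗ[R] A.toSubmodule, (∀ g x, θ (σ g x) = A.toRepresentation g (θ x)) ∧
      ∀ a : A.toSubmodule, θ a = a := by
  have h' : IsCompl A.toSubmodule B.toSubmodule := by
    refine ⟨disjoint_iff.2 ?_, codisjoint_iff.2 ?_⟩
    · exact congrArg Subrepresentation.toSubmodule (disjoint_iff.1 h.1)
    · exact congrArg Subrepresentation.toSubmodule (codisjoint_iff.1 h.2)
  refine ⟨Submodule.projectionOnto _ _ h', fun g x => ?_, fun a => ?_⟩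
  · obtain ⟨a, ha, b, hb, rfl⟩ := Submodule.mem_sup.1
      (show x ∈ A.toSubmodule ⊔ B.toSubmodule by rw [h'.sup_eq_top]; trivial)
    rw [map_add, map_add, map_add, map_add,
      Submodule.projectionOnto_apply_of_mem_left h' ha,
      Submodule.projectionOnto_apply_of_mem_left h' (A.apply_mem_toSubmodule g ha),
      (Submodule.projectionOnto_apply_eq_zero_iff h').2 hb,
      (Submodule.projectionOnto_apply_eq_zero_iff h').2 (B.apply_mem_toSubmodule g hb), map_zero,
      add_zero, add_zero]
    rfl
  · exact Submodule.projectionOnto_apply_left h' a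

end Projection

/-! ### The lattice of a diagram is reduced -/

section Reduced

/-- Every element is a scalar multiple of the generator modulo the radical, so otherwise `Λ_i` would
equal its radical. -/
theorem lamGen_notMem_augRadical (i : Idx p) : lamGen i ∉ augRadical p (lamRep p i) := by
  intro h
  have hnt : Nontrivial (Lam p i) := ⟨_, _, lamGen_ne_zero i⟩
  apply radical_lt_top (lamRep p i)
  rw [radical_padicInt, eq_top_iff]
  intro x _
  obtain ⟨a, rfl⟩ := exists_asAlgebraHom_lamGen x
  have h1 := asAlgebraHom_sub_mem_augRadical (lamRep p i) a (lamGen i)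
  have := Submodule.add_mem _ h1 (Submodule.smul_mem _ (∑ g, a.coeff g) h)
  simpa using this

/-- The projection `T` of `U` to a summand `Λ_i` depends only on component `i`. The element `a` of
the summand that corresponds to the generator has its component `i` in `Rad F_i`, which is the image
of `Rad U`. Replacing `a` by an element of `Rad U` with the same component does not change the value
of `T`, and puts the generator into `Rad Λ_i`. -/
theorem Cover.lam_not_summand (φ : Cover D)
    (hD : ∀ j : Idx p, ⨆ i : {i : Idx p // i ≠ j}, (D i.1).toSubmodule = ⊤)
    {A B : Subrepresentation φ.lattice} (h : IsCompl A B) (i : Idx p) :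
    IsEmpty (A.toRepresentation.Equiv (lamRep p i)) := by
  classical
  refine ⟨fun ψ => ?_⟩
  obtain ⟨θ, hθ, hθA⟩ := exists_projection (U := φ.Lattice) h
  have hψ : ∀ g x, ψ (A.toRepresentation g x) = lamRep p i g (ψ x) :=
    fun g x => IntertwiningMap.isIntertwining _ _ ψ.toIntertwiningMap g x
  let T : φ.Lattice →ₗ[ℤ_[p]] Lam p i := ψ.toLinearMap ∘ₗ θ
  have hT : ∀ g x, T (φ.lattice g x) = lamRep p i g (T x) := fun g x => by
    change ψ (θ _) = _
    rw [hθ, hψ]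
    rfl
  have hp2 : (p : ℤ_[p]) ^ 2 ≠ 0 := pow_ne_zero 2 prime_ne_zero_padicInt
  have hkernel : ∀ (j : Idx p) (x : φ.Lattice), (φ.lattice.asAlgebraHom (intIdem j) x).1 =
      (fRep D).asAlgebraHom (intIdem j) x.1 := fun j x =>
    asAlgebraHom_toRepresentation φ.kernel _ x
  -- `p² e_i` kills such an `x`, but acts on `Λ_i` as multiplication by `p²`.
  have hker : ∀ x : φ.Lattice, x.1 i = 0 → T x = 0 := by
    intro x hx
    have h1 := map_asAlgebraHom T hT (intIdem i) x
    have h2 : φ.lattice.asAlgebraHom (intIdem i) x = 0 := by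
      apply Subtype.ext
      rw [hkernel]
      ext1 j
      rw [asAlgebraHom_intIdem_fRep]
      split_ifs with hij
      · subst hij; rw [hx, smul_zero]; rfl
      · rfl
    rw [h2, map_zero, asAlgebraHom_intIdem_lam, if_pos rfl] at h1
    exact (smul_eq_zero_iff_right hp2).1 h1.symm
  obtain ⟨a, ha⟩ : ∃ a : A.toSubmodule, ψ a = lamGen i := ψ.toLinearEquiv.surjective _
  -- Conversely, `p² e_j` kills `A ≅ Λ_i` and multiplies component `j` by `p²`.
  have ha0 : ∀ j, j ≠ i → a.1.1 j = 0 := by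
    intro j hj
    have h1 : A.toRepresentation.asAlgebraHom (intIdem j) a = 0 := by
      apply ψ.toLinearEquiv.injective
      have := map_asAlgebraHom ψ.toLinearMap hψ (intIdem j) a
      refine this.trans ?_
      rw [asAlgebraHom_intIdem_lam, if_neg hj, map_zero]
    have h2 := congrArg (fun x => x.1.1 j) h1
    simp only [asAlgebraHom_toRepresentation, hkernel] at h2
    rw [asAlgebraHom_intIdem_fRep, if_pos rfl] at h2
    exact (smul_eq_zero_iff_right hp2).1 h2
  -- Only one term survives in the relation defining the kernel, so `f_i` kills this component, and
  -- `f_i` reflects the radical.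
  have hai : a.1.1 i ∈ augRadical p (fiRep D i) := by
    have h1 := φ.mem_kernel.1 a.1.2
    rw [Finset.sum_eq_single i (fun j _ hj => by rw [ha0 j hj]; simp) (by simp)] at h1
    have h2 : φ.f i (a.1.1 i) = 0 := Subtype.ext h1
    rw [← radical_padicInt, ← φ.mem_radical_iff, h2]
    exact Submodule.zero_mem _
  let P : φ.Lattice →ₗ[ℤ_[p]] Fi D i := LinearMap.proj i ∘ₗ φ.kernel.toSubmodule.subtype
  have hP : ∀ g x, P (φ.lattice g x) = fiRep D i g (P x) := fun _ _ => rfl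
  have hPs : Function.Surjective P := φ.exists_mem_kernel hD i
  have hle : augRadical p (fiRep D i) ≤ (augRadical (U := φ.Lattice) p φ.lattice).map P :=
    le_map_augRadical (R := ℤ_[p]) (U := φ.Lattice) (W := Fi D i) P hP hPs
  obtain ⟨u, hu, hui⟩ := hle hai
  have hTu : T u ∈ augRadical p (lamRep p i) := map_augRadical_le T hT ⟨u, hu, rfl⟩
  have hTa : T a.1 = lamGen i := by
    change ψ (θ _) = _
    rw [hθA, ha]
  apply lamGen_notMem_augRadical i
  have : T (a.1 - u) = 0 := by
    refine hker _ ?_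
    have : u.1 i = a.1.1 i := hui
    change a.1.1 i - u.1 i = 0
    rw [this, sub_self]
  rwa [← hTa, show T a.1 = T u by rw [← sub_eq_zero, ← map_sub, this]]

theorem Cover.free_not_summand (φ : Cover D) {A B : Subrepresentation φ.lattice}
    (h : IsCompl A B) : IsEmpty (A.toRepresentation.Equiv (leftRegular ℤ_[p] (G p))) := by
  classical
  refine ⟨fun ψ => ?_⟩
  obtain ⟨θ, hθ, hθA⟩ := exists_projection (U := φ.Lattice) h
  have hψ : ∀ g x, ψ (A.toRepresentation g x) = leftRegular ℤ_[p] (G p) g (ψ x) :=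
    fun g x => IntertwiningMap.isIntertwining _ _ ψ.toIntertwiningMap g x
  let T : φ.Lattice →ₗ[ℤ_[p]] MonoidAlgebra ℤ_[p] (G p) := ψ.toLinearMap ∘ₗ θ
  have hT : ∀ g x, T (φ.lattice g x) = leftRegular ℤ_[p] (G p) g (T x) := fun g x => by
    change ψ (θ _) = _
    rw [hθ, hψ]
    rfl
  obtain ⟨a, ha⟩ : ∃ a : A.toSubmodule, ψ a = 1 := ψ.toLinearEquiv.surjective _
  have hTa : T a.1 = 1 := by
    change ψ (θ _) = _
    rw [hθA, ha]
  -- `p² e_0 a` is `p²` times the component of `a` at `0`. One factor `p` already moves that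
  -- component into `U`, so `p² e_0 a` is divisible by `p` in `U`; its image `Ĝ` in the free module
  -- has coefficient `1` at the identity.
  let u : φ.Lattice := ⟨_, φ.smul_mem_kernel (Pi.single none (a.1.1 none))⟩
  have hu : φ.lattice.asAlgebraHom (intIdem none) a.1 = (p : ℤ_[p]) • u := by
    apply Subtype.ext
    refine (asAlgebraHom_toRepresentation φ.kernel _ a.1).trans ?_
    ext1 j
    rw [asAlgebraHom_intIdem_fRep]
    change _ = (p : ℤ_[p]) • (p : ℤ_[p]) • (Pi.single none (a.1.1 none) : ∀ i, Fi D i) j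
    rw [smul_smul, ← sq]
    split_ifs with hj
    · subst hj; simp
    · rw [Pi.single_eq_of_ne (Ne.symm hj), smul_zero]
  have h1 := map_asAlgebraHom T hT (intIdem none) a.1
  rw [hu, map_smul, hTa, asAlgebraHom_apply_eq_sum] at h1
  have h2 := congrArg (fun x => x.coeff 1) h1
  simp [intIdem, coeff_sumOver, MonoidAlgebra.one_def, Finsupp.single_apply] at h2
  exact PadicInt.prime_p.not_isUnit (IsUnit.of_mul_eq_one _ h2)

theorem Cover.isReduced (φ : Cover D)
    (hD : ∀ j : Idx p, ⨆ i : {i : Idx p // i ≠ j}, (D i.1).toSubmodule = ⊤) :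
    IsReduced (U := φ.Lattice) p φ.lattice :=
  fun _ _ h => ⟨φ.free_not_summand h, φ.lam_not_summand hD h⟩

end Reduced

/-! ### Permutation lattices of rank prime to `p` -/

section Permutation

/-- A permutation basis of a lattice whose rank is prime to `p` has a fixed element. -/
theorem exists_lam_summand {U : Type*} [AddCommGroup U] [Module ℤ_[p] U]
    {σ : Representation ℤ_[p] (G p) U} (hσ : IsPermutation σ)
    (hrank : ¬ p ∣ Module.finrank ℤ_[p] U) :
    ∃ A B : Subrepresentation σ, IsCompl A B ∧
      Nonempty (A.toRepresentation.Equiv (lamRep p none)) := by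
  obtain ⟨m, b, hb⟩ := hσ
  choose f hf using hb
  let _ : MulAction (G p) (Fin m) :=
    { smul := f
      one_smul := fun i => b.injective (by
        change b (f 1 i) = b i
        rw [← hf 1 i]; simp)
      mul_smul := fun g h i => b.injective (by
        change b (f (g * h) i) = b (f g (f h i))
        rw [← hf, ← hf, ← hf]; simp) }
  -- For a `p`-group the number of fixed basis elements is congruent to the rank modulo `p`.
  have hpg : IsPGroup p (G p) := IsPGroup.of_card (n := 2) (by rw [natCard_G, sq])
  have hcard := hpg.card_modEq_card_fixedPoints (Fin m)
  rw [Nat.card_eq_fintype_card, Fintype.card_fin] at hcard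
  have hm : Module.finrank ℤ_[p] U = m := by
    rw [Module.finrank_eq_card_basis b, Fintype.card_fin]
  rw [hm] at hrank
  have hne : Nonempty (MulAction.fixedPoints (G p) (Fin m)) := by
    by_contra hne
    rw [not_nonempty_iff] at hne
    rw [Nat.card_of_isEmpty] at hcard
    exact hrank ((Nat.modEq_zero_iff_dvd).1 hcard)
  obtain ⟨i, hi⟩ := hne
  have hfix : ∀ g, σ g (b i) = b i := fun g => by
    rw [hf]; exact congrArg b (hi g)
  -- The coordinate at a fixed basis element is invariant, so its kernel is a stable complement to
  -- the span of that element.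
  have hcoord : ∀ g x, b.coord i (σ g x) = b.coord i x := by
    intro g x
    have : b.coord i ∘ₗ σ g = b.coord i := b.ext fun j => by
      rw [LinearMap.comp_apply, hf, Module.Basis.coord_apply, Module.Basis.coord_apply,
        Module.Basis.repr_self, Module.Basis.repr_self, Finsupp.single_apply, Finsupp.single_apply]
      refine if_congr ⟨fun hj => ?_, fun hj => ?_⟩ rfl rfl
      · have h1 : g • j = i := hj
        rw [← hi g⁻¹, ← h1, inv_smul_smul]
      · subst hj; exact hi g
    exact LinearMap.congr_fun this x
  let A : Subrepresentation σ := ⟨Submodule.span ℤ_[p] {b i}, fun g x hx => by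
    obtain ⟨r, rfl⟩ := Submodule.mem_span_singleton.1 hx
    rwa [map_smul, hfix]⟩
  let B : Subrepresentation σ := ⟨LinearMap.ker (b.coord i), fun g x hx => by
    rw [LinearMap.mem_ker] at hx ⊢
    rw [hcoord, hx]⟩
  have hbi : b.coord i (b i) = 1 := by simp
  refine ⟨A, B, ⟨disjoint_iff.2 ?_, codisjoint_iff.2 ?_⟩, ?_⟩
  · apply Subrepresentation.toSubmodule_injective
    rw [Subrepresentation.toSubmodule_inf]
    change _ = (⊥ : Submodule ℤ_[p] U)
    rw [eq_bot_iff]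
    rintro x ⟨hx, hx'⟩
    obtain ⟨r, rfl⟩ := Submodule.mem_span_singleton.1 hx
    have hx2 : b.coord i (r • b i) = 0 := hx'
    rw [map_smul, hbi, smul_eq_mul, mul_one] at hx2
    rw [hx2, zero_smul]
    exact Submodule.zero_mem _
  · apply Subrepresentation.toSubmodule_injective
    rw [Subrepresentation.toSubmodule_sup]
    change _ = (⊤ : Submodule ℤ_[p] U)
    rw [eq_top_iff]
    intro x _
    rw [← add_sub_cancel (b.coord i x • b i) x]
    refine Submodule.add_mem_sup
      (Submodule.smul_mem _ _ (Submodule.mem_span_singleton_self _)) ?_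
    change b.coord i _ = 0
    rw [map_sub, map_smul, hbi, smul_eq_mul, mul_one, sub_self]
  · have htf : Module.IsTorsionFree ℤ_[p] U := by
      have := Module.Free.of_basis b
      infer_instance
    let E1 : ℤ_[p] ≃ₗ[ℤ_[p]] A.toSubmodule :=
      LinearEquiv.toSpanNonzeroSingleton ℤ_[p] U (b i) (b.ne_zero i)
    let E2 : ℤ_[p] ≃ₗ[ℤ_[p]] Lam p none :=
      LinearEquiv.ofFinrankEq _ _ (by rw [finrank_lam_none, Module.finrank_self])
    refine ⟨Representation.Equiv.mk (E1.symm.trans E2) fun g => ?_⟩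
    ext1 x
    rw [LinearMap.comp_apply, LinearMap.comp_apply, lamRep_none]
    congr 1
    obtain ⟨x, hx⟩ := x
    obtain ⟨r, rfl⟩ := Submodule.mem_span_singleton.1 hx
    apply Subtype.ext
    change σ g (r • b i) = r • b i
    rw [map_smul, hfix]

theorem Cover.not_isPermutation (φ : Cover D)
    (hD : ∀ j : Idx p, ⨆ i : {i : Idx p // i ≠ j}, (D i.1).toSubmodule = ⊤)
    (hrank : ¬ p ∣ Module.finrank ℤ_[p] φ.Lattice) : ¬ IsPermutation φ.lattice := by
  intro h
  obtain ⟨A, B, hAB, ⟨ψ⟩⟩ := exists_lam_summand (U := φ.Lattice) h hrank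
  exact (φ.lam_not_summand hD hAB none).false ψ

end Permutation

end CpCpLattice

namespace CpCpLattice

open Representation

variable {p : ℕ} [Fact p.Prime]

/-! ### The subgroups of order `p` as kernels of characters indexed by `2, …, p + 2` -/

section Lines

/-- The linear character of `G` by which `G` moves `v_j`: `g v_j = v_j + character j g • v_1`. -/
def character (j : ℕ) (g : G p) : ZMod p :=
  Multiplicative.toAdd g.1 * coeffN p j + Multiplicative.toAdd g.2 * coeffC p j

theorem character_mul (j : ℕ) (g h : G p) :
    character j (g * h) = character j g + character j h := by
  simp only [character, Prod.fst_mul, Prod.snd_mul, toAdd_mul]; ring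

theorem character_one (j : ℕ) : character j (1 : G p) = 0 := by simp [character]

theorem character_pow (j : ℕ) (g : G p) (m : ℕ) : character j (g ^ m) = m * character j g := by
  induction m with
  | zero => simp [character_one]
  | succ m ih => rw [pow_succ, character_mul, ih]; push_cast; ring

theorem character_n (j : ℕ) : character j (n p) = coeffN p j := by simp [character, n]

theorem character_c (j : ℕ) : character j (c p) = coeffC p j := by simp [character, c]

theorem rho_apply_v (g : G p) {j : ℕ} (h1 : 1 ≤ j) (h2 : j ≤ p + 2) :
    rho p g (v p j) = v p j + character j g • v p 1 := by
  rw [rho_apply, shift_v _ _ h1 h2]; rfl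

theorem coeffN_of_three_le {j : ℕ} (h : 3 ≤ j) : coeffN p j = 1 := if_pos h

/-- With the convention `0⁻¹ = 0`, the index `3` of the subgroup `C` obeys the same formulas as the
indices `j ≥ 4`. -/
theorem k_three : k p 3 = 0 := by simp [k]

theorem k_four : k p 4 = 1 := by
  rw [k, show ((4 : ℕ) : ZMod p) - 3 = 1 by push_cast; ring, inv_one]

theorem coeffC_of_three_le {j : ℕ} (h : 3 ≤ j) : coeffC p j = -k p j := by
  rcases h.eq_or_lt with rfl | h
  · simp [coeffC, k_three]
  · rw [coeffC, if_neg (by omega), if_pos (by omega)]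

theorem coeffN_two : coeffN p 2 = 0 := rfl

theorem coeffC_two : coeffC p 2 = 1 := rfl

/-- The kernel of `character j`. -/
def lineSubgroup (p : ℕ) [Fact p.Prime] (j : ℕ) : Subgroup (G p) where
  carrier := {g | character j g = 0}
  one_mem' := character_one j
  mul_mem' {g h} hg hh := by
    change character j (g * h) = 0
    rw [character_mul, show character j g = 0 from hg, show character j h = 0 from hh, add_zero]
  inv_mem' {g} hg := by
    have h := character_mul j g g⁻¹
    rw [mul_inv_cancel, character_one, show character j g = 0 from hg, zero_add] at h
    exact h.symm

theorem mem_lineSubgroup {j : ℕ} {g : G p} : g ∈ lineSubgroup p j ↔ character j g = 0 := Iff.rfl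

theorem eq_of_modEq {i j : ℕ} (hi : 3 ≤ i) (hi' : i ≤ p + 2) (hj : 3 ≤ j) (hj' : j ≤ p + 2)
    (h : (i : ZMod p) = j) : i = j := by
  rw [ZMod.natCast_eq_natCast_iff] at h
  have h1 : i - 3 ≡ j - 3 [MOD p] := by
    apply Nat.ModEq.add_right_cancel' 3
    rwa [Nat.sub_add_cancel hi, Nat.sub_add_cancel hj]
  have := Nat.ModEq.eq_of_lt_of_lt h1 (by omega) (by omega)
  omega

theorem lineSubgroup_injective {i j : ℕ} (hi : 2 ≤ i) (hi' : i ≤ p + 2) (hj : 2 ≤ j)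
    (hj' : j ≤ p + 2) (h : lineSubgroup p i = lineSubgroup p j) : i = j := by
  have key : ∀ {j : ℕ}, 3 ≤ j → lineSubgroup p 2 ≠ lineSubgroup p j := by
    intro j hj h
    have h1 : n p ∈ lineSubgroup p 2 := by rw [mem_lineSubgroup, character_n, coeffN_two]
    rw [h, mem_lineSubgroup, character_n, coeffN_of_three_le hj] at h1
    exact one_ne_zero h1
  rcases hi.eq_or_lt with rfl | hi3 <;> rcases hj.eq_or_lt with rfl | hj3
  · rfl
  · exact absurd h (key hj3)
  · exact absurd h.symm (key hi3)
  -- The character of index `i ≥ 3` is `(x, y) ↦ x - k_i y`. So `(k_i, 1)` lies in its kernel, and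
  -- it lies in the kernel of index `j` only if `k_i = k_j`.
  · have h1 : ((Multiplicative.ofAdd (k p i), Multiplicative.ofAdd 1) : G p) ∈
        lineSubgroup p i := by
      rw [mem_lineSubgroup, character, coeffN_of_three_le hi3, coeffC_of_three_le hi3]
      simp
    rw [h, mem_lineSubgroup, character, coeffN_of_three_le hj3, coeffC_of_three_le hj3] at h1
    simp only [toAdd_ofAdd, mul_one, one_mul, ← sub_eq_add_neg, sub_eq_zero, k, inv_inj] at h1
    exact eq_of_modEq hi3 hi' hj3 hj' (sub_left_injective h1)

theorem exists_character_ne_zero {j : ℕ} (hj : 2 ≤ j) : ∃ g : G p, character j g ≠ 0 := by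
  rcases hj.eq_or_lt with rfl | hj
  · exact ⟨c p, by rw [character_c, coeffC_two]; exact one_ne_zero⟩
  · exact ⟨n p, by rw [character_n, coeffN_of_three_le hj]; exact one_ne_zero⟩

theorem orderOf_eq_p {g : G p} (hg : g ≠ 1) : orderOf g = p :=
  orderOf_eq_prime (pow_p_eq_one g) hg

/-- The order divides `p²`, is at least the order `p` of `g`, and is not `p²` because the character
is nonzero. -/
theorem card_lineSubgroup {j : ℕ} (hj : 2 ≤ j) {g : G p} (hg : g ≠ 1)
    (hgj : g ∈ lineSubgroup p j) :
    Nat.card (lineSubgroup p j) = p ∧ lineSubgroup p j = Subgroup.zpowers g := by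
  have h1 : Nat.card (Subgroup.zpowers g) = p := by rw [Nat.card_zpowers, orderOf_eq_p hg]
  have hle : Subgroup.zpowers g ≤ lineSubgroup p j := Subgroup.zpowers_le.2 hgj
  have hcard : Nat.card (lineSubgroup p j) = p := by
    have hdvd : Nat.card (lineSubgroup p j) ∣ p ^ 2 := by
      rw [sq, ← natCard_G]; exact Subgroup.card_subgroup_dvd_card _
    obtain ⟨m, hm, hm'⟩ := (Nat.dvd_prime_pow Fact.out).1 hdvd
    have hlow := Subgroup.card_dvd_of_le hle
    rw [h1] at hlow
    interval_cases m
    · rw [hm', pow_zero, Nat.dvd_one] at hlow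
      exact absurd hlow (Fact.out : p.Prime).one_lt.ne'
    · simpa using hm'
    · obtain ⟨x, hx⟩ := exists_character_ne_zero (p := p) hj
      refine absurd ?_ hx
      have htop : lineSubgroup p j = ⊤ := Subgroup.eq_top_of_card_eq _ (by rw [hm', natCard_G, sq])
      rw [← mem_lineSubgroup, htop]
      trivial
  exact ⟨hcard, (Subgroup.eq_of_le_of_card_ge hle (by rw [h1, hcard])).symm⟩

theorem exists_mem_lineSubgroup (g : G p) :
    ∃ j, 2 ≤ j ∧ j ≤ p + 2 ∧ g ∈ lineSubgroup p j := by
  by_cases hy : Multiplicative.toAdd g.2 = 0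
  · exact ⟨2, le_rfl, by omega, by simp [mem_lineSubgroup, character, coeffN_two, hy]⟩
  -- For `g = (x, y)` with `y ≠ 0` the equation `x = k_j y` holds for `j - 3 = y / x`; when `x = 0`
  -- the convention `0⁻¹ = 0` yields `j = 3`.
  · have hlt := ZMod.val_lt (Multiplicative.toAdd g.2 * (Multiplicative.toAdd g.1)⁻¹)
    refine ⟨(Multiplicative.toAdd g.2 * (Multiplicative.toAdd g.1)⁻¹).val + 3, by omega,
      by omega, ?_⟩
    rw [mem_lineSubgroup, character, coeffN_of_three_le (by omega),
      coeffC_of_three_le (by omega), k]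
    push_cast
    rw [ZMod.natCast_zmod_val, add_sub_cancel_right, mul_inv, inv_inv]
    field_simp
    ring

theorem n_ne_one : n p ≠ 1 := by
  intro h
  have := congrArg (fun g : G p => Multiplicative.toAdd g.1) h
  simp [n] at this

theorem c_ne_one : c p ≠ 1 := by
  intro h
  have := congrArg (fun g : G p => Multiplicative.toAdd g.2) h
  simp [c] at this

theorem exists_generator_lineSubgroup {j : ℕ} (hj : 2 ≤ j) :
    ∃ g : G p, g ≠ 1 ∧ g ∈ lineSubgroup p j := by
  rcases hj.eq_or_lt with rfl | hj
  · exact ⟨n p, n_ne_one, by rw [mem_lineSubgroup, character_n, coeffN_two]⟩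
  · refine ⟨(Multiplicative.ofAdd (k p j), Multiplicative.ofAdd 1), fun h => ?_, ?_⟩
    · have := congrArg (fun g : G p => Multiplicative.toAdd g.2) h
      simp at this
    · rw [mem_lineSubgroup, character, coeffN_of_three_le hj, coeffC_of_three_le hj]
      simp

/-- The subgroups of order `p` are the kernels of the characters `2, …, p + 2`. -/
noncomputable def lineEquiv (p : ℕ) [Fact p.Prime] :
    Finset.Icc 2 (p + 2) ≃ {H : Subgroup (G p) // Nat.card H = p} :=
  Equiv.ofBijective
    (fun j => ⟨lineSubgroup p j.1, by
      obtain ⟨g, hg, hgj⟩ := exists_generator_lineSubgroup (p := p) (Finset.mem_Icc.1 j.2).1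
      exact (card_lineSubgroup (Finset.mem_Icc.1 j.2).1 hg hgj).1⟩)
    ⟨fun i j hij => Subtype.ext (lineSubgroup_injective (Finset.mem_Icc.1 i.2).1
        (Finset.mem_Icc.1 i.2).2 (Finset.mem_Icc.1 j.2).1 (Finset.mem_Icc.1 j.2).2
        (congrArg Subtype.val hij)),
      fun H => by
        have hnt : Nontrivial H.1 := by
          rw [← Finite.one_lt_card_iff_nontrivial, H.2]
          exact (Fact.out : p.Prime).one_lt
        obtain ⟨g, hg⟩ := exists_ne (1 : H.1)
        have hg' : (g : G p) ≠ 1 := fun h => hg (Subtype.ext h)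
        obtain ⟨j, h2, hp, hgj⟩ := exists_mem_lineSubgroup (g : G p)
        refine ⟨⟨j, Finset.mem_Icc.2 ⟨h2, hp⟩⟩, Subtype.ext ?_⟩
        change lineSubgroup p j = H.1
        rw [(card_lineSubgroup h2 hg' hgj).2]
        exact Subgroup.eq_of_le_of_card_ge (Subgroup.zpowers_le.2 g.2)
          (by rw [H.2, Nat.card_zpowers, orderOf_eq_p hg'])⟩

theorem lineEquiv_coe (j : Finset.Icc 2 (p + 2)) : (lineEquiv p j).1 = lineSubgroup p j := rfl

theorem lineSubgroup_two : lineSubgroup p 2 = N p :=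
  (card_lineSubgroup le_rfl n_ne_one (by rw [mem_lineSubgroup, character_n, coeffN_two])).2

theorem lineSubgroup_three : lineSubgroup p 3 = C p :=
  (card_lineSubgroup (by omega) c_ne_one
    (by rw [mem_lineSubgroup, character_c, coeffC_of_three_le le_rfl, k_three, neg_zero])).2

theorem lineSubgroup_add_three {a : ℕ} (h1 : 1 ≤ a) (h2 : a ≤ p - 1) :
    lineSubgroup p (a + 3) = Subgroup.zpowers (n p * c p ^ a) := by
  have ha : (a : ZMod p) ≠ 0 := by
    rw [Ne, ZMod.natCast_eq_zero_iff]
    intro h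
    have := Nat.le_of_dvd h1 h
    have := (Fact.out : p.Prime).pos
    omega
  refine (card_lineSubgroup (by omega) (fun h => ?_) ?_).2
  · have := congrArg (fun g : G p => Multiplicative.toAdd g.1) h
    simp [n, c] at this
  · rw [mem_lineSubgroup, character_mul, character_pow, character_n, character_c,
      coeffN_of_three_le (by omega), coeffC_of_three_le (by omega), k]
    push_cast
    rw [add_sub_cancel_right, mul_neg, mul_inv_cancel₀ ha, add_neg_cancel]

end Lines

/-! ### Generators of the subspaces `V_i` -/

section Vectors

theorem v_apply (j : ℕ) (i : Finset.Icc 1 (p + 2)) : v p j i = if i.1 = j then 1 else 0 := rfl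

theorem sum_smul_v (x : V p) : x = ∑ j : Finset.Icc 1 (p + 2), x j • v p j := by
  ext i
  rw [Finset.sum_apply, Finset.sum_eq_single i]
  · simp [v_apply]
  · intro j _ hj
    have : i.1 ≠ j.1 := fun h => hj (Subtype.ext h.symm)
    simp [v_apply, this]
  · simp

theorem eq_top_of_forall_v_mem {S : Submodule (ZMod p) (V p)}
    (h : ∀ j, 1 ≤ j → j ≤ p + 2 → v p j ∈ S) : S = ⊤ := by
  rw [eq_top_iff]
  intro x _
  rw [sum_smul_v x]
  exact Submodule.sum_mem _ fun j _ =>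
    Submodule.smul_mem _ _ (h j (Finset.mem_Icc.1 j.2).1 (Finset.mem_Icc.1 j.2).2)

/-- The index of the subgroup `lineSubgroup p j`. -/
noncomputable def lineIdx (j : Finset.Icc 2 (p + 2)) : Idx p := some (lineEquiv p j)

theorem gens_lineIdx (j : Finset.Icc 2 (p + 2)) : gens p (lineIdx j) = {v p 1, v p j} := by
  have h2 := (Finset.mem_Icc.1 j.2).1
  have hp := (Finset.mem_Icc.1 j.2).2
  have hp1 := (Fact.out : p.Prime).two_le
  ext x
  change (x = v p 1 ∨ ((lineEquiv p j).1 = N p ∧ x = v p 2) ∨ ((lineEquiv p j).1 = C p ∧ x = v p 3) ∨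
      ∃ a : ℕ, 1 ≤ a ∧ a ≤ p - 1 ∧ (lineEquiv p j).1 = Subgroup.zpowers (n p * c p ^ a) ∧
        x = v p (a + 3)) ↔ x = v p 1 ∨ x = v p j
  rw [lineEquiv_coe]
  refine or_congr_right ⟨?_, fun hx => ?_⟩
  · rintro (⟨h, rfl⟩ | ⟨h, rfl⟩ | ⟨a, ha1, ha2, h, rfl⟩)
    · rw [← lineSubgroup_two] at h
      rw [lineSubgroup_injective h2 hp le_rfl (by omega) h]
    · rw [← lineSubgroup_three] at h
      rw [lineSubgroup_injective h2 hp (by omega) (by omega) h]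
    · rw [← lineSubgroup_add_three ha1 ha2] at h
      rw [lineSubgroup_injective h2 hp (by omega) (by omega) h]
  · obtain ⟨j, hj⟩ := j
    dsimp only at h2 hp hx ⊢
    rcases h2.eq_or_lt with rfl | h2
    · exact Or.inl ⟨lineSubgroup_two, hx⟩
    · rcases (Nat.succ_le_of_lt h2).eq_or_lt with rfl | h3
      · exact Or.inr (Or.inl ⟨lineSubgroup_three, hx⟩)
      · refine Or.inr (Or.inr ⟨j - 3, by omega, by omega, ?_, ?_⟩)
        · rw [← lineSubgroup_add_three (by omega) (by omega), Nat.sub_add_cancel (by omega)]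
        · rw [Nat.sub_add_cancel (by omega), hx]

theorem diagram_lineIdx (j : Finset.Icc 2 (p + 2)) :
    (diagram p (lineIdx j)).toSubmodule = Submodule.span (ZMod p) {v p 1, v p j} := by
  rw [← gens_lineIdx]; rfl

theorem v_one_mem_diagram (i : Idx p) : v p 1 ∈ (diagram p i).toSubmodule := by
  apply Submodule.subset_span
  cases i <;> simp [gens]

theorem v_mem_diagram (j : Finset.Icc 2 (p + 2)) : v p j ∈ (diagram p (lineIdx j)).toSubmodule := by
  rw [diagram_lineIdx]
  exact Submodule.subset_span (by simp)

/-- The vector `v_j - v_3 + k_j v_2`, fixed by `G`. -/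
def fixedVec (p j : ℕ) [Fact p.Prime] : V p := v p j - v p 3 + k p j • v p 2

/-- The generators of `V_0` telescope: the first is `fixedVec p 4` up to order since `k_4 = 1`, and
the others are the differences of consecutive `fixedVec`s. -/
theorem fixedVec_mem {j : ℕ} (h4 : 4 ≤ j) (hj : j ≤ p + 2) :
    fixedVec p j ∈ (diagram p none).toSubmodule := by
  induction j, h4 using Nat.le_induction with
  | base =>
    refine Submodule.subset_span (Or.inl ?_)
    rw [fixedVec, k_four, one_smul]
    right
    change _ = _
    module
  | succ j hj4 ih =>
    have h1 : (k p (j + 1) - k p j) • v p 2 - v p j + v p (j + 1) ∈ (diagram p none).toSubmodule :=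
      Submodule.subset_span (Or.inr ⟨j, hj4, by omega, rfl⟩)
    have h2 := Submodule.add_mem _ (ih (by omega)) h1
    have h3 : fixedVec p (j + 1) = fixedVec p j +
        ((k p (j + 1) - k p j) • v p 2 - v p j + v p (j + 1)) := by
      simp only [fixedVec]; module
    rwa [h3]

theorem two_lt_of_odd (hp : Odd p) : 2 < p :=
  (Fact.out : p.Prime).two_le.lt_of_ne' (by rintro rfl; exact absurd hp (by decide))

theorem diagram_none_le {S : Submodule (ZMod p) (V p)} (hp : Odd p) (h1 : v p 1 ∈ S)
    (h : ∀ j, 4 ≤ j → j ≤ p + 2 → fixedVec p j ∈ S) : (diagram p none).toSubmodule ≤ S := by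
  have hp2 := two_lt_of_odd hp
  refine Submodule.span_le.2 ?_
  rintro x ((rfl | hx) | ⟨j, h4, hj, rfl⟩)
  · exact h1
  · have := h 4 le_rfl (by omega)
    rw [fixedVec, k_four, one_smul] at this
    have h3 : x = v p 4 - v p 3 + v p 2 := by
      rw [show x = _ from hx]; abel
    rwa [h3]
  · have h3 : (k p (j + 1) - k p j) • v p 2 - v p j + v p (j + 1) =
        fixedVec p (j + 1) - fixedVec p j := by
      simp only [fixedVec]; module
    rw [h3]
    exact Submodule.sub_mem _ (h _ (by omega) (by omega)) (h _ h4 (by omega))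

/-- The characters satisfy `χ_j - χ_3 + k_j χ_2 = 0`, which is what dictates the coefficients of
`fixedVec`. -/
theorem rho_fixedVec (g : G p) {j : ℕ} (h4 : 4 ≤ j) (hj : j ≤ p + 2) :
    rho p g (fixedVec p j) = fixedVec p j := by
  rw [fixedVec, map_add, map_sub, map_smul, rho_apply_v g (by omega) hj,
    rho_apply_v g (by omega) (by omega), rho_apply_v g (by omega) (by omega)]
  simp only [character, coeffN_of_three_le (show 3 ≤ j by omega),
    coeffN_of_three_le (le_refl 3), coeffN_two, coeffC_two,
    coeffC_of_three_le (show 3 ≤ j by omega), coeffC_of_three_le (le_refl 3), k_three]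
  module

theorem rho_diagram_none (hp : Odd p) (g : G p) {x : V p} (hx : x ∈ (diagram p none).toSubmodule) :
    rho p g x = x := by
  have : (diagram p none).toSubmodule ≤ LinearMap.eqLocus (rho p g) LinearMap.id := by
    refine diagram_none_le hp ?_ fun j h4 hj => rho_fixedVec g h4 hj
    change rho p g (v p 1) = v p 1
    rw [rho_apply, shift_v_one, zero_smul, add_zero]
  exact this hx

end Vectors

end CpCpLattice

namespace CpCpLattice

open Representation

variable {p : ℕ} [Fact p.Prime]

/-! ### The tuple is a diagram -/

section Diagram

/-- The `V_H` alone contain every `v_i`. If the `V_H` with basis vector `v_i` is dropped, then `v_i`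
is recovered from the others by means of a fixed vector of `V_0`: `fixedVec p 4 = v_4 - v_3 + v_2`
for `i = 2, 3`, and `fixedVec p i` for `i ≥ 4`. -/
theorem iSup_diagram (hp : Odd p) (j : Idx p) :
    ⨆ i : {i : Idx p // i ≠ j}, (diagram p i.1).toSubmodule = ⊤ := by
  have hp2 := two_lt_of_odd hp
  set S := ⨆ i : {i : Idx p // i ≠ j}, (diagram p i.1).toSubmodule with hS
  have hle : ∀ i, i ≠ j → (diagram p i).toSubmodule ≤ S := fun i hi =>
    le_iSup (fun i : {i : Idx p // i ≠ j} => (diagram p i.1).toSubmodule) ⟨i, hi⟩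
  have hv : ∀ i : Finset.Icc 2 (p + 2), lineIdx i ≠ j → v p i ∈ S := fun i hi =>
    hle _ hi (v_mem_diagram i)
  have hne : ∃ i, i ≠ j := by
    rcases j with _ | j
    · exact ⟨lineIdx ⟨2, Finset.mem_Icc.2 ⟨le_rfl, by omega⟩⟩, by simp [lineIdx]⟩
    · exact ⟨none, by simp⟩
  obtain ⟨i0, hi0⟩ := hne
  have h1 : v p 1 ∈ S := hle _ hi0 (v_one_mem_diagram i0)
  refine eq_top_of_forall_v_mem fun i h1i hip => ?_
  rcases h1i.eq_or_lt with rfl | h2i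
  · exact h1
  by_cases hij : lineIdx ⟨i, Finset.mem_Icc.2 ⟨h2i, hip⟩⟩ = j
  swap
  · exact hv ⟨i, Finset.mem_Icc.2 ⟨h2i, hip⟩⟩ hij
  have hother : ∀ l (hl : 2 ≤ l) (hl' : l ≤ p + 2), l ≠ i → v p l ∈ S := by
    intro l hl hl' hli
    refine hv ⟨l, Finset.mem_Icc.2 ⟨hl, hl'⟩⟩ fun h => hli ?_
    rw [← hij] at h
    have := (lineEquiv p).injective (Option.some_injective _ h)
    exact congrArg Subtype.val this
  have hfix : ∀ l, 4 ≤ l → l ≤ p + 2 → fixedVec p l ∈ S := fun l h4 hl =>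
    hle none (by rw [← hij]; simp [lineIdx]) (fixedVec_mem h4 hl)
  have h4 := hfix 4 le_rfl (by omega)
  rw [fixedVec, k_four, one_smul] at h4
  rcases Nat.lt_or_ge i 4 with hi | hi
  · interval_cases i
    · have h := S.add_mem (S.sub_mem h4 (hother 4 (by omega) (by omega) (by omega)))
        (hother 3 (by omega) (by omega) (by omega))
      convert h using 1
      module
    · have h := S.sub_mem (S.add_mem (hother 4 (by omega) (by omega) (by omega))
        (hother 2 (by omega) (by omega) (by omega))) h4
      convert h using 1
      module
  · have h := S.sub_mem (S.add_mem (hfix i hi hip) (hother 3 (by omega) (by omega) (by omega)))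
      (S.smul_mem (k p i) (hother 2 (by omega) (by omega) (by omega)))
    convert h using 1
    simp only [fixedVec]
    module

/-- This is where oddness matters: it makes the norm of `G/H` act as zero on `V_H`, whose nontrivial
elements act unipotently. -/
theorem sum_fin_cast (hp : Odd p) : ∑ i : Fin p, ((i : ℕ) : ZMod p) = 0 := by
  rw [Fin.sum_univ_eq_sum_range (fun i => (i : ZMod p)), ← Nat.cast_sum, Finset.sum_range_id,
    ZMod.natCast_eq_zero_iff]
  obtain ⟨m, hm⟩ := hp
  have : p * (p - 1) / 2 = p * m := by
    rw [Nat.div_eq_of_eq_mul_left two_pos]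
    have : p - 1 = 2 * m := by omega
    rw [this]; ring
  rw [this]
  exact dvd_mul_right _ _

theorem rho_diagram_lineIdx {j : Finset.Icc 2 (p + 2)} {x : V p}
    (hx : x ∈ (diagram p (lineIdx j)).toSubmodule) :
    ∃ t : ZMod p, ∀ g : G p, rho p g x = x + (t * character j g) • v p 1 := by
  have h2 := Finset.mem_Icc.1 j.2
  rw [diagram_lineIdx, Submodule.mem_span_pair] at hx
  obtain ⟨a, b, rfl⟩ := hx
  refine ⟨b, fun g => ?_⟩
  rw [map_add, map_smul, map_smul, rho_apply_v g (by omega) h2.2, rho_apply, shift_v_one]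
  module

theorem lineIdx_surjective {H : {H : Subgroup (G p) // Nat.card H = p}} :
    ∃ j, some H = lineIdx j := by
  obtain ⟨j, rfl⟩ := (lineEquiv p).surjective H
  exact ⟨j, rfl⟩

/-- For `i = 0`, `e_0 a = 0` says that the augmentation of `a` vanishes, and `V_0` is a trivial
module. For a subgroup `H` it says that all coset sums of `a` agree, so `a` acts on `V_H` as a
multiple of the norm `∑ g ^ i`. This sends `x` to `p x` plus a multiple of `(∑ i) v_1`, which is
zero. -/
theorem factorsThrough_diagram (hp : Odd p) (i : Idx p) : FactorsThrough i (diagram p i) := by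
  intro a ha x hx
  rw [← asAlgebraHom_lamGen_eq_zero_iff] at ha
  rcases i with _ | H
  · have h1 : (lamRep p none).asAlgebraHom a (lamGen none) = (∑ g, a.coeff g) • lamGen none := by
      simp [asAlgebraHom_apply_eq_sum, lamRep_none, Finset.sum_smul]
    rw [h1, smul_eq_zero_iff_left (lamGen_ne_zero none)] at ha
    rw [asAlgebraHom_apply_eq_sum]
    simp only [rho_diagram_none hp _ hx, coeff_toFp, ← Finset.sum_smul, ← map_sum]
    rw [ha, map_zero, zero_smul]
  · obtain ⟨j, hj⟩ := lineIdx_surjective (H := H)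
    rw [hj] at hx
    obtain rfl : H = lineEquiv p j := Option.some_injective _ hj
    obtain ⟨g, hg⟩ := exists_notMem (lineEquiv p j).2
    obtain ⟨t, ht⟩ := rho_diagram_lineIdx hx
    rw [asAlgebraHom_eq_cosetSum (lineEquiv p j).2 hg _ (fun h hh => lamRep_of_mem hh _)] at ha
    have h1 := eq_sum_of_sum_smul_lamGen_eq_zero hg ha
    have h2 : ∀ i i' : Fin p, cosetSum (lineEquiv p j).1 g a i = cosetSum (lineEquiv p j).1 g a i' :=
      fun i i' => mul_left_cancel₀ prime_ne_zero_padicInt ((h1 i).trans (h1 i').symm)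
    have h3 : ∀ i : Fin p, cosetSum (lineEquiv p j).1 g (toFp p a) i =
        PadicInt.toZMod (cosetSum (lineEquiv p j).1 g a 0) := by
      intro i
      rw [cosetSum, ← h2 i ⟨0, (Fact.out : p.Prime).pos⟩, cosetSum, map_sum]
      simp only [coeff_toFp]
    rw [asAlgebraHom_eq_cosetSum (lineEquiv p j).2 hg _ (fun h hh => by
      rw [ht h, mem_lineSubgroup.1 (show h ∈ lineSubgroup p j from hh), mul_zero, zero_smul,
        add_zero])]
    simp only [h3, ← Finset.smul_sum, ht, character_pow]
    rw [Finset.sum_add_distrib, ← Finset.sum_smul]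
    have h4 : ∑ i : Fin p, t * (((i : ℕ) : ZMod p) * character j g) = 0 := by
      rw [← Finset.mul_sum, ← Finset.sum_mul, sum_fin_cast hp, zero_mul, mul_zero]
    rw [h4, zero_smul, add_zero, Finset.sum_const, Finset.card_univ, Fintype.card_fin,
      ← Nat.cast_smul_eq_nsmul (ZMod p)]
    simp

theorem isDiagram_diagram (hp : Odd p) : IsDiagram (diagram p) :=
  ⟨inferInstance, iSup_diagram hp, factorsThrough_diagram hp⟩

end Diagram

/-! ### Heads of the `V_i` and the rank of the lattice -/

section Basis

/-- A basis of `V_0` adapted to the coordinates of `v_1` and `v_2`. -/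
def fixedBasisVec (p : ℕ) [Fact p.Prime] (i : ℕ) : V p :=
  if i = 0 then v p 1 else if i = 1 then fixedVec p 4 else
    fixedVec p (i + 3) - k p (i + 3) • fixedVec p 4

theorem fixedBasisVec_zero : fixedBasisVec p 0 = v p 1 := rfl

theorem fixedBasisVec_one : fixedBasisVec p 1 = fixedVec p 4 := rfl

theorem fixedBasisVec_of_two_le {i : ℕ} (hi : 2 ≤ i) :
    fixedBasisVec p i = fixedVec p (i + 3) - k p (i + 3) • fixedVec p 4 := by
  rw [fixedBasisVec, if_neg (by omega), if_neg (by omega)]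

theorem fixedBasisVec_mem (hp : Odd p) {i : ℕ} (hi : i < p) :
    fixedBasisVec p i ∈ (diagram p none).toSubmodule := by
  have hp2 := two_lt_of_odd hp
  have h4 := fixedVec_mem (p := p) le_rfl (show 4 ≤ p + 2 by omega)
  rcases Nat.lt_or_ge i 2 with h | h
  · interval_cases i
    · exact v_one_mem_diagram none
    · exact h4
  · rw [fixedBasisVec_of_two_le h]
    exact Submodule.sub_mem _ (fixedVec_mem (by omega) (by omega)) (Submodule.smul_mem _ _ h4)

/-- The coordinate that detects `fixedBasisVec i`. -/
def fixedIndex (i : ℕ) : ℕ := if i = 0 then 1 else if i = 1 then 2 else i + 3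

theorem fixedIndex_mem (hp : Odd p) {i : ℕ} (hi : i < p) : fixedIndex i ∈ Finset.Icc 1 (p + 2) := by
  have hp2 := two_lt_of_odd hp
  rw [Finset.mem_Icc, fixedIndex]
  split_ifs <;> omega

/-- For `i ≥ 2` subtracting `k_(i+3)` times `fixedVec p 4` cancels the `v_2`-term because `k_4 = 1`.
So the basis is dual to the coordinates `1, 2, 5, …, p + 2`, and only the vectors of index `0` and
`1` involve `v_1` and `v_2`; the two gluings single out exactly these. -/
theorem fixedBasisVec_apply (hp : Odd p) {i j : ℕ} (hj : j < p) :
    fixedBasisVec p i ⟨fixedIndex j, fixedIndex_mem hp hj⟩ = if i = j then 1 else 0 := by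
  have hk4 := k_four (p := p)
  have hv : ∀ (l : ℕ) h, v p l ⟨fixedIndex j, h⟩ = if fixedIndex j = l then 1 else 0 := fun l h => rfl
  rcases Nat.lt_or_ge i 2 with h | h
  · interval_cases i
    · rw [fixedBasisVec_zero, hv]
      refine if_congr ?_ rfl rfl
      rw [fixedIndex]; split_ifs <;> omega
    · rw [fixedBasisVec_one, fixedVec, hk4]
      simp only [Pi.add_apply, Pi.sub_apply, hv, one_smul]
      rw [if_neg (by rw [fixedIndex]; split_ifs <;> omega),
        if_neg (by rw [fixedIndex]; split_ifs <;> omega), sub_self, zero_add]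
      refine if_congr ?_ rfl rfl
      rw [fixedIndex]; split_ifs <;> omega
  · rw [fixedBasisVec_of_two_le h, fixedVec, fixedVec, hk4]
    simp only [Pi.add_apply, Pi.sub_apply, Pi.smul_apply, hv, one_smul, smul_eq_mul]
    rw [if_neg (show fixedIndex j ≠ 3 by rw [fixedIndex]; split_ifs <;> omega),
      if_neg (show fixedIndex j ≠ 4 by rw [fixedIndex]; split_ifs <;> omega)]
    have : (fixedIndex j = i + 3) ↔ i = j := by rw [fixedIndex]; split_ifs <;> omega
    simp only [this]
    ring

theorem fixedBasisVec_linearIndependent (hp : Odd p) :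
    LinearIndependent (ZMod p) (fun i : Fin p => fixedBasisVec p i) := by
  rw [Fintype.linearIndependent_iff]
  intro l hl i
  have h := congrFun hl ⟨fixedIndex i, fixedIndex_mem hp i.2⟩
  simp only [Finset.sum_apply, Pi.smul_apply, fixedBasisVec_apply hp i.2, Pi.zero_apply,
    smul_eq_mul, mul_ite, mul_one, mul_zero, Fin.val_inj, Finset.sum_ite_eq', Finset.mem_univ,
    if_true] at h
  exact h

theorem span_fixedBasisVec (hp : Odd p) :
    Submodule.span (ZMod p) (Set.range fun i : Fin p => fixedBasisVec p i) =
      (diagram p none).toSubmodule := by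
  have hp2 := two_lt_of_odd hp
  apply le_antisymm
  · rw [Submodule.span_le]
    rintro _ ⟨i, rfl⟩
    exact fixedBasisVec_mem hp i.2
  · have h0 : ∀ i, i < p → fixedBasisVec p i ∈
        Submodule.span (ZMod p) (Set.range fun i : Fin p => fixedBasisVec p i) :=
      fun i hi => Submodule.subset_span ⟨⟨i, hi⟩, rfl⟩
    refine diagram_none_le hp (h0 0 (by omega)) fun j h4 hj => ?_
    rcases h4.eq_or_lt with rfl | h5
    · exact h0 1 (by omega)
    · have h1 := fixedBasisVec_of_two_le (p := p) (i := j - 3) (by omega)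
      rw [Nat.sub_add_cancel (by omega)] at h1
      have h2 : fixedVec p j = fixedBasisVec p (j - 3) + k p j • fixedBasisVec p 1 := by
        rw [h1, fixedBasisVec_one]; module
      rw [h2]
      exact Submodule.add_mem _ (h0 _ (by omega)) (Submodule.smul_mem _ _ (h0 1 (by omega)))

theorem finrank_diagram_none (hp : Odd p) :
    Module.finrank (ZMod p) (diagram p none).toSubmodule = p := by
  rw [← span_fixedBasisVec hp, finrank_span_eq_card (fixedBasisVec_linearIndependent hp),
    Fintype.card_fin]

theorem radical_diagram_none (hp : Odd p) : radical (diagram p none).toRepresentation = ⊥ := by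
  rw [radical_zmod, eq_bot_iff, augRadical, Submodule.span_le]
  rintro _ (⟨y, rfl⟩ | ⟨g, y, rfl⟩)
  · simp
  · rw [SetLike.mem_coe, Submodule.mem_bot, sub_eq_zero]
    exact Subtype.ext (rho_diagram_none hp g y.2)

theorem headDim_diagram_none (hp : Odd p) : headDim (diagram p none) = p := by
  rw [headDim, radical_diagram_none hp]
  rw [(Submodule.quotEquivOfEqBot _ rfl).finrank_eq, finrank_diagram_none hp]

/-- `(g - 1) v_j` is `v_1` times a character value, and the character is not zero. -/
theorem mem_radical_diagram_lineIdx (j : Finset.Icc 2 (p + 2))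
    (x : (diagram p (lineIdx j)).toSubmodule) :
    x ∈ radical (diagram p (lineIdx j)).toRepresentation ↔ ∃ b : ZMod p, x.1 = b • v p 1 := by
  rw [radical_zmod]
  constructor
  · intro hx
    have hle : augRadical p (diagram p (lineIdx j)).toRepresentation ≤
        (Submodule.span (ZMod p) {v p 1}).comap (diagram p (lineIdx j)).toSubmodule.subtype := by
      refine Submodule.span_le.2 ?_
      rintro _ (⟨y, rfl⟩ | ⟨g, y, rfl⟩)
      · simp
      · obtain ⟨t, ht⟩ := rho_diagram_lineIdx y.2
        change rho p g y.1 - y.1 ∈ Submodule.span (ZMod p) {v p 1}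
        rw [ht, add_sub_cancel_left]
        exact Submodule.smul_mem _ _ (Submodule.mem_span_singleton_self _)
    obtain ⟨b, hb⟩ := Submodule.mem_span_singleton.1 (hle hx)
    exact ⟨b, hb.symm⟩
  · rintro ⟨b, hb⟩
    have h2 := Finset.mem_Icc.1 j.2
    obtain ⟨g, hg⟩ := exists_character_ne_zero (p := p) h2.1
    have h := sub_mem_augRadical (p := p) (diagram p (lineIdx j)).toRepresentation g
      ⟨v p j, v_mem_diagram j⟩
    have h3 := Submodule.smul_mem _ (b * (character j g)⁻¹) h
    convert h3 using 1
    apply Subtype.ext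
    change x.1 = (b * (character j g)⁻¹) • (rho p g (v p j) - v p j)
    rw [hb, rho_apply_v g (by omega) h2.2, add_sub_cancel_left, smul_smul, mul_assoc,
      inv_mul_cancel₀ hg, mul_one]

theorem headDim_diagram_lineIdx (j : Finset.Icc 2 (p + 2)) :
    headDim (diagram p (lineIdx j)) = 1 := by
  have h2 := Finset.mem_Icc.1 j.2
  refine finrank_eq_one (Submodule.Quotient.mk ⟨v p j, v_mem_diagram j⟩) ?_ ?_
  · rw [Ne, Submodule.Quotient.mk_eq_zero, mem_radical_diagram_lineIdx]
    rintro ⟨b, hb⟩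
    have h := congrFun hb ⟨j, Finset.mem_Icc.2 ⟨by omega, h2.2⟩⟩
    dsimp only at h
    rw [Pi.smul_apply, v_apply, v_apply, if_pos rfl, if_neg (by dsimp only; omega), smul_zero] at h
    exact one_ne_zero h
  · intro w
    obtain ⟨x, rfl⟩ := Submodule.Quotient.mk_surjective _ w
    obtain ⟨a, b, hab⟩ := Submodule.mem_span_pair.1 ((diagram_lineIdx j).le x.2)
    refine ⟨b, ?_⟩
    rw [← Submodule.Quotient.mk_smul, Submodule.Quotient.eq, mem_radical_diagram_lineIdx]
    refine ⟨-a, ?_⟩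
    change b • v p j - x.1 = _
    rw [← hab]
    module

theorem sum_idx {M : Type*} [AddCommMonoid M] (F : Idx p → M) :
    ∑ i, F i = F none + ∑ j : Finset.Icc 2 (p + 2), F (lineIdx j) := by
  rw [← (lineEquiv p).optionCongr.sum_comp F, Fintype.sum_option]
  rfl

theorem finrank_lattice_diagram (hp : Odd p) (φ : Cover (diagram p)) :
    Module.finrank ℤ_[p] φ.Lattice = p ^ 2 + p - 1 := by
  rw [φ.finrank_lattice, sum_idx, headDim_diagram_none hp, finrank_lam_none]
  simp only [headDim_diagram_lineIdx]
  have h : ∀ j : Finset.Icc 2 (p + 2), Module.finrank ℤ_[p] (Lam p (lineIdx j)) = p - 1 :=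
    fun j => finrank_lam_some _
  simp only [h, Finset.sum_const, Finset.card_univ, Fintype.card_coe, Nat.card_Icc, smul_eq_mul]
  obtain ⟨m, rfl⟩ : ∃ m, p = m + 1 := ⟨p - 1, by have := (Fact.out : p.Prime).pos; omega⟩
  rw [show m + 1 + 2 + 1 - 2 = m + 2 by omega, Nat.add_sub_cancel]
  symm
  apply Nat.sub_eq_of_eq_add
  ring

/-- The rank is one less than a multiple of `p`. -/
theorem not_isPermutation_diagram (hp : Odd p) (φ : Cover (diagram p)) :
    ¬ IsPermutation φ.lattice := by
  refine φ.not_isPermutation (iSup_diagram hp) fun h => ?_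
  rw [finrank_lattice_diagram hp] at h
  have h1 : 1 ≤ p := (Fact.out : p.Prime).pos
  have h2 : p ∣ p ^ 2 + p - 1 + 1 := by
    rw [Nat.sub_add_cancel (by omega)]
    exact ⟨p + 1, by ring⟩
  exact (Fact.out : p.Prime).one_lt.ne' (Nat.dvd_one.1 ((Nat.dvd_add_right h).1 h2))

end Basis

end CpCpLattice

namespace CpCpLattice

open Representation

variable {p : ℕ} [Fact p.Prime]

/-! ### A criterion for permutation lattices of the cyclic group of order `p` -/

section Glue

theorem isPermutation_of_basis {R Q M ι : Type*} [CommRing R] [Monoid Q] [AddCommMonoid M]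
    [Module R M] [Fintype ι] {σ : Representation R Q M} (b : Module.Basis ι R M)
    (h : ∀ g i, ∃ j, σ g (b i) = b j) : IsPermutation σ := by
  refine ⟨Fintype.card ι, b.reindex (Fintype.equivFin ι), fun g i => ?_⟩
  obtain ⟨j, hj⟩ := h g ((Fintype.equivFin ι).symm i)
  exact ⟨Fintype.equivFin ι j, by simpa using hj⟩

variable {M F₀ F₁ : Type*} [AddCommGroup M] [Module ℤ_[p] M]
  [AddCommGroup F₀] [Module ℤ_[p] F₀] [AddCommGroup F₁] [Module ℤ_[p] F₁]

/-- A lattice for the cyclic group of order `p` glued from a trivial lattice with basis `t` and a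
lattice spanned by the orbit of one element with relation the norm. -/
theorem isPermutation_of_glue {Q : Type*} [Group Q] {σ : Representation ℤ_[p] Q M} {γ : Q}
    (hγ : ∀ x : Q, ∃ i : ℕ, x = γ ^ i) (hγp : γ ^ p = 1) (P₀ : M →ₗ[ℤ_[p]] F₀)
    (P₁ : M →ₗ[ℤ_[p]] F₁) (hinj : ∀ x, P₀ x = 0 → P₁ x = 0 → x = 0)
    (τ : F₁ →ₗ[ℤ_[p]] F₁) (hP₀ : ∀ x, P₀ (σ γ x) = P₀ x) (hP₁ : ∀ x, P₁ (σ γ x) = τ (P₁ x))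
    (t : Module.Basis (Fin p) ℤ_[p] F₀) (κ : Fin p) {r : ℤ_[p]} (hr : r ≠ 0)
    (q : M) (u : {k : Fin p // k ≠ κ} → M) (hq : P₀ q = -t κ) (hu₀ : ∀ k, P₀ (u k) = r • t k)
    (hu₁ : ∀ k, P₁ (u k) = 0)
    (hconst : ∀ l : Fin p → ℤ_[p], ∑ i, l i • (τ ^ (i : ℕ)) (P₁ q) = 0 → ∀ i j, l i = l j)
    (hsum : ∑ i : Fin p, (τ ^ (i : ℕ)) (P₁ q) = 0)
    (hspan : ∀ x, ∃ l : Fin p → ℤ_[p], P₁ x = ∑ i, l i • (τ ^ (i : ℕ)) (P₁ q))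
    (hdiv : ∀ x, P₁ x = 0 → ∃ m : Fin p → ℤ_[p],
      P₀ x = ∑ k, ((if k = κ then (p : ℤ_[p]) else r) * m k) • t k) :
    IsPermutation σ := by
  have hP₀' : ∀ (i : ℕ) x, P₀ (σ (γ ^ i) x) = P₀ x := by
    intro i x
    induction i with
    | zero => simp
    | succ i ih => rw [pow_succ', map_mul, Module.End.mul_apply, hP₀, ih]
  have hP₁' : ∀ (i : ℕ) x, P₁ (σ (γ ^ i) x) = (τ ^ i) (P₁ x) := by
    intro i x
    induction i with
    | zero => simp
    | succ i ih => rw [pow_succ', map_mul, Module.End.mul_apply, hP₁, ih, pow_succ',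
        Module.End.mul_apply]
  have hfix : ∀ (i : ℕ) k, σ (γ ^ i) (u k) = u k := by
    intro i k
    rw [← sub_eq_zero]
    refine hinj _ ?_ ?_
    · rw [map_sub, hP₀', sub_self]
    · rw [map_sub, hP₁', hu₁, map_zero, sub_zero]
  have hkey : ∀ x : Fin p → ℤ_[p], ∑ k, x k • t k =
      x κ • t κ + ∑ k : {k : Fin p // k ≠ κ}, x k • t k := by
    intro x
    rw [← Finset.add_sum_erase _ _ (Finset.mem_univ κ)]
    congr 1
    exact Finset.sum_subtype (p := fun k => k ≠ κ) _ (by simp) _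
  let w : Fin p ⊕ {k : Fin p // k ≠ κ} → M := Sum.elim (fun i => σ (γ ^ (i : ℕ)) q) u
  have hind : LinearIndependent ℤ_[p] w := by
    rw [Fintype.linearIndependent_iff]
    intro l hl
    rw [Fintype.sum_sum_type] at hl
    simp only [w, Sum.elim_inl, Sum.elim_inr] at hl
    have h1 := congrArg P₁ hl
    simp only [map_add, map_sum, map_smul, hP₁', hu₁, smul_zero, Finset.sum_const_zero, add_zero,
      map_zero] at h1
    -- `P₁` shows that the coefficients along the orbit of `q` are all equal. `P₀` then turns the
    -- relation into one between the `t k`, where `t κ` has coefficient `-p` times the common value.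
    have h2 := hconst (fun i => l (Sum.inl i)) h1
    have h3 := congrArg P₀ hl
    simp only [map_add, map_sum, map_smul, hP₀', hu₀, hq, map_zero] at h3
    have h4 := Fintype.linearIndependent_iff.1 t.linearIndependent
      (fun k => if hk : k = κ then -((p : ℤ_[p]) * l (Sum.inl κ)) else l (Sum.inr ⟨k, hk⟩) * r) (by
        rw [hkey, ← h3]
        congr 1
        · rw [dif_pos rfl, Finset.sum_congr rfl fun i _ => by rw [h2 i κ], Finset.sum_const,
            Finset.card_univ, Fintype.card_fin, ← Nat.cast_smul_eq_nsmul ℤ_[p]]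
          module
        · refine Finset.sum_congr rfl fun k _ => ?_
          rw [dif_neg k.2, mul_smul])
    rintro (i | k)
    · have := h4 κ
      rw [dif_pos rfl, neg_eq_zero] at this
      rw [h2 i κ]
      exact (mul_eq_zero.1 this).resolve_left prime_ne_zero_padicInt
    · have := h4 k
      rw [dif_neg k.2] at this
      exact (mul_eq_zero.1 this).resolve_right hr
  have hsp : ⊤ ≤ Submodule.span ℤ_[p] (Set.range w) := by
    intro x _
    obtain ⟨l, hl⟩ := hspan x
    have hx1 : P₁ (x - ∑ i, l i • σ (γ ^ (i : ℕ)) q) = 0 := by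
      rw [map_sub, map_sum]
      simp only [map_smul, hP₁']
      rw [hl, sub_self]
    obtain ⟨m, hm⟩ := hdiv _ hx1
    -- After `P₁` has been matched along the orbit, the remainder lies in the kernel of `P₁`. Its `t
    -- κ`-part is a multiple of `p t κ`, and this is supplied by the norm of `q`, which has `P₁ = 0`
    -- and `P₀ = -p t κ`.
    have hx2 : x = ∑ i, l i • σ (γ ^ (i : ℕ)) q +
        (∑ k : {k : Fin p // k ≠ κ}, m k • u k - m κ • ∑ i : Fin p, σ (γ ^ (i : ℕ)) q) := by
      rw [← sub_eq_iff_eq_add', ← sub_eq_zero]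
      refine hinj _ ?_ ?_
      · rw [map_sub, hm, hkey, if_pos rfl]
        simp only [map_sub, map_sum, map_smul, hu₀, hP₀', hq, Finset.sum_const, Finset.card_univ,
          Fintype.card_fin]
        rw [Finset.sum_congr rfl fun (k : {k : Fin p // k ≠ κ}) _ => by
          rw [if_neg k.2, mul_comm, mul_smul], ← Nat.cast_smul_eq_nsmul ℤ_[p]]
        module
      · rw [map_sub, hx1]
        simp only [map_sub, map_sum, map_smul, hu₁, hP₁', hsum]
        simp
    rw [hx2]
    have hwl : ∀ i : Fin p, σ (γ ^ (i : ℕ)) q ∈ Submodule.span ℤ_[p] (Set.range w) :=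
      fun i => Submodule.subset_span ⟨Sum.inl i, rfl⟩
    have hwr : ∀ k, u k ∈ Submodule.span ℤ_[p] (Set.range w) :=
      fun k => Submodule.subset_span ⟨Sum.inr k, rfl⟩
    refine Submodule.add_mem _ (Submodule.sum_mem _ fun i _ => Submodule.smul_mem _ _ (hwl i))
      (Submodule.sub_mem _ (Submodule.sum_mem _ fun k _ => Submodule.smul_mem _ _ (hwr k))
        (Submodule.smul_mem _ _ (Submodule.sum_mem _ fun i _ => hwl i)))
  refine isPermutation_of_basis (Module.Basis.mk hind hsp) fun g i => ?_
  obtain ⟨a, rfl⟩ := hγ g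
  simp only [Module.Basis.mk_apply]
  rcases i with i | k
  · refine ⟨Sum.inl ⟨(a + i) % p, Nat.mod_lt _ (Fact.out : p.Prime).pos⟩, ?_⟩
    simp only [w, Sum.elim_inl]
    rw [← Module.End.mul_apply, ← map_mul, ← pow_add]
    congr 2
    conv_lhs => rw [← Nat.mod_add_div (a + i) p, pow_add, pow_mul, hγp, one_pow, mul_one]
  · exact ⟨Sum.inr k, hfix a k⟩

end Glue

/-! ### The components `F_H`, generated by a preimage of `v_j` -/

section Line

variable {D : Idx p → Subrepresentation (rho p)}

theorem fiRep_of_mem {D : Idx p → Subrepresentation (rho p)} {j : Finset.Icc 2 (p + 2)} {h : G p}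
    (hh : h ∈ lineSubgroup p j) (x : Fi D (lineIdx j)) : fiRep D (lineIdx j) h x = x := by
  ext1 k
  exact lamRep_of_mem (H := lineEquiv p j) hh (x k)

theorem fiRep_none (g : G p) (x : Fi D none) : fiRep D none g x = x := by
  ext1 k
  exact lamRep_none g (x k)

theorem sum_fiRep_pow {j : Finset.Icc 2 (p + 2)} {g : G p} (hg : g ∉ lineSubgroup p j)
    (x : Fi D (lineIdx j)) : ∑ i : Fin p, fiRep D (lineIdx j) (g ^ (i : ℕ)) x = 0 := by
  ext1 k
  rw [Finset.sum_apply]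
  exact sum_lamRep_pow (H := lineEquiv p j) hg (x k)

theorem eq_zero_of_fixed {j : Finset.Icc 2 (p + 2)} {g : G p} (hg : g ∉ lineSubgroup p j)
    {x : Fi D (lineIdx j)} (hx : fiRep D (lineIdx j) g x = x) : x = 0 := by
  have h : ∀ i : ℕ, fiRep D (lineIdx j) (g ^ i) x = x := by
    intro i
    induction i with
    | zero => simp
    | succ i ih => rw [pow_succ, map_mul, Module.End.mul_apply, hx, ih]
  have h1 := sum_fiRep_pow hg x
  simp only [h, Finset.sum_const, Finset.card_univ, Fintype.card_fin] at h1
  rw [← Nat.cast_smul_eq_nsmul ℤ_[p]] at h1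
  exact (smul_eq_zero_iff_right prime_ne_zero_padicInt).1 h1

/-- `Rad F_H = (g - 1) F_H` for `g ∉ H`. Each `g ^ i - 1` is a multiple of `g - 1`, `H` acts
trivially, and `p y = -∑ (g ^ i - 1) y` because the norm vanishes. -/
theorem exists_sub_of_mem_radical {j : Finset.Icc 2 (p + 2)} {g : G p}
    (hg : g ∉ lineSubgroup p j) {x : Fi D (lineIdx j)} (hx : x ∈ radical (fiRep D (lineIdx j))) :
    ∃ y, x = fiRep D (lineIdx j) g y - y := by
  let T : Fi D (lineIdx j) →ₗ[ℤ_[p]] Fi D (lineIdx j) := fiRep D (lineIdx j) g - LinearMap.id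
  have hpow : ∀ (i : ℕ) y, fiRep D (lineIdx j) (g ^ i) y - y ∈ LinearMap.range T := by
    intro i y
    induction i with
    | zero => simp
    | succ i ih =>
      have h1 : T (fiRep D (lineIdx j) (g ^ i) y) = fiRep D (lineIdx j) (g ^ (i + 1)) y -
          fiRep D (lineIdx j) (g ^ i) y := by
        rw [pow_succ', map_mul]; rfl
      have h2 := Submodule.add_mem _ (LinearMap.mem_range_self T (fiRep D (lineIdx j) (g ^ i) y)) ih
      rw [h1] at h2
      simpa using h2
  have hle : augRadical p (fiRep D (lineIdx j)) ≤ LinearMap.range T := by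
    refine Submodule.span_le.2 ?_
    rintro _ (⟨y, rfl⟩ | ⟨h, y, rfl⟩)
    · have h1 : (p : ℤ_[p]) • y = -∑ i : Fin p, (fiRep D (lineIdx j) (g ^ (i : ℕ)) y - y) := by
        rw [Finset.sum_sub_distrib, sum_fiRep_pow hg, Finset.sum_const, Finset.card_univ,
          Fintype.card_fin, ← Nat.cast_smul_eq_nsmul ℤ_[p]]
        simp
      rw [h1]
      exact Submodule.neg_mem _ (Submodule.sum_mem _ fun i _ => hpow i y)
    · obtain ⟨⟨h', i⟩, rfl⟩ := (decomp_bijective (lineEquiv p j).2 hg).2 h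
      dsimp only
      rw [map_mul, Module.End.mul_apply, fiRep_of_mem h'.2]
      exact hpow i y
  rw [radical_padicInt] at hx
  obtain ⟨y, hy⟩ := hle hx
  exact ⟨y, hy.symm⟩

namespace Cover

variable (φ : Cover (diagram p))

/-- A preimage of `v_j` in `F_j`. -/
noncomputable def lineGen (j : Finset.Icc 2 (p + 2)) : Fi (diagram p) (lineIdx j) :=
  (φ.surjective (lineIdx j) ⟨v p j, v_mem_diagram j⟩).choose

theorem f_lineGen (j : Finset.Icc 2 (p + 2)) : (φ.f _ (φ.lineGen j) : V p) = v p j :=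
  congrArg Subtype.val (φ.surjective (lineIdx j) ⟨v p j, v_mem_diagram j⟩).choose_spec

theorem f_fiRep (i : Idx p) (g : G p) (x : Fi (diagram p) i) :
    (φ.f i (fiRep _ i g x) : V p) = rho p g (φ.f i x) :=
  congrArg Subtype.val (φ.equivariant i g x)

theorem f_smul (i : Idx p) (r : ℤ_[p]) (x : Fi (diagram p) i) :
    (φ.f i (r • x) : V p) = PadicInt.toZMod r • (φ.f i x : V p) := by
  rw [map_smulₛₗ]; rfl

theorem f_lineIdx (j : Finset.Icc 2 (p + 2)) (x : Fi (diagram p) (lineIdx j)) :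
    ∃ a b : ZMod p, (φ.f _ x : V p) = a • v p 1 + b • v p j := by
  obtain ⟨a, b, h⟩ := Submodule.mem_span_pair.1 ((diagram_lineIdx j).le (φ.f _ x).2)
  exact ⟨a, b, h.symm⟩

/-- Nakayama: the head of `V_j` is spanned by `v_j`, and `f_j` identifies the heads of `F_j` and
`V_j`. -/
theorem exists_asAlgebraHom_lineGen (j : Finset.Icc 2 (p + 2)) (x : Fi (diagram p) (lineIdx j)) :
    ∃ a, x = (fiRep (diagram p) (lineIdx j)).asAlgebraHom a (φ.lineGen j) := by
  let T : MonoidAlgebra ℤ_[p] (G p) →ₗ[ℤ_[p]] Fi (diagram p) (lineIdx j) :=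
    ((fiRep (diagram p) (lineIdx j)).asAlgebraHom.toLinearMap).flip (φ.lineGen j)
  let S : Subrepresentation (fiRep (diagram p) (lineIdx j)) := ⟨LinearMap.range T, by
    rintro g _ ⟨a, rfl⟩
    refine ⟨MonoidAlgebra.single g 1 * a, ?_⟩
    change (fiRep (diagram p) (lineIdx j)).asAlgebraHom _ _ = fiRep (diagram p) (lineIdx j) g
      ((fiRep (diagram p) (lineIdx j)).asAlgebraHom a _)
    rw [map_mul, asAlgebraHom_single_one]; rfl⟩
  have hS : S.toSubmodule = ⊤ := by
    refine eq_top_of_sup_radical_eq_top S ?_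
    rw [eq_top_iff]
    intro x _
    obtain ⟨a, b, h⟩ := φ.f_lineIdx j x
    obtain ⟨r, rfl⟩ := toZMod_surjective b
    have h1 : x - r • φ.lineGen j ∈ radical (fiRep (diagram p) (lineIdx j)) := by
      rw [← φ.mem_radical_iff, mem_radical_diagram_lineIdx]
      refine ⟨a, ?_⟩
      rw [map_sub, Submodule.coe_sub, f_smul, f_lineGen, h, add_sub_cancel_right]
    rw [← add_sub_cancel (r • φ.lineGen j) x]
    refine Submodule.add_mem_sup (Submodule.smul_mem _ _ ⟨1, ?_⟩) h1
    change (fiRep (diagram p) (lineIdx j)).asAlgebraHom 1 _ = _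
    rw [map_one]; rfl
  have : x ∈ S.toSubmodule := by rw [hS]; trivial
  obtain ⟨a, ha⟩ := this
  exact ⟨a, ha.symm⟩

theorem exists_eq_sum_lineGen {j : Finset.Icc 2 (p + 2)} {g : G p} (hg : g ∉ lineSubgroup p j)
    (x : Fi (diagram p) (lineIdx j)) : ∃ l : Fin p → ℤ_[p],
      x = ∑ i, l i • fiRep (diagram p) (lineIdx j) (g ^ (i : ℕ)) (φ.lineGen j) := by
  obtain ⟨a, rfl⟩ := φ.exists_asAlgebraHom_lineGen j x
  exact ⟨_, asAlgebraHom_eq_cosetSum (lineEquiv p j).2 hg _ (fun h hh => fiRep_of_mem hh _) a⟩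

end Cover

end Line

end CpCpLattice

namespace CpCpLattice

open Representation

variable {p : ℕ} [Fact p.Prime]

/-! ### Relations and bases adapted to the maps `f_i` -/

section Generators

/-- All but the last of the `m` generators still span a free module of rank `m - 1`, so they form a
basis. Subtracting the last coefficient times the all-ones relation leaves a relation among them.
This serves for `lineGen`, an arbitrary lift with no explicit coefficients. -/
theorem eq_of_sum_smul_eq_zero {R M : Type*} [CommRing R] [Nontrivial R] [AddCommGroup M]
    [Module R M] [Module.Free R M] [Module.Finite R M] {m : ℕ} (z : Fin m → M)
    (hspan : ⊤ ≤ Submodule.span R (Set.range z)) (hsum : ∑ i, z i = 0)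
    (hrank : Module.finrank R M = m - 1) {l : Fin m → R} (hl : ∑ i, l i • z i = 0) (i j : Fin m) :
    l i = l j := by
  obtain _ | m := m
  · exact i.elim0
  have hsp : ⊤ ≤ Submodule.span R (Set.range fun i : Fin m => z i.castSucc) := by
    refine hspan.trans (Submodule.span_le.2 ?_)
    rintro _ ⟨i, rfl⟩
    refine Fin.lastCases ?_ (fun i => Submodule.subset_span ⟨i, rfl⟩) i
    rw [Fin.sum_univ_castSucc] at hsum
    rw [SetLike.mem_coe, eq_neg_of_add_eq_zero_right hsum]
    exact Submodule.neg_mem _ (Submodule.sum_mem _ fun i _ => Submodule.subset_span ⟨i, rfl⟩)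
  have hind := linearIndependent_of_top_le_span_of_card_eq_finrank hsp (by simp [hrank])
  have h1 : ∑ i : Fin m, (l i.castSucc - l (Fin.last m)) • z i.castSucc = 0 := by
    rw [Fin.sum_univ_castSucc] at hl hsum
    simp only [sub_smul, Finset.sum_sub_distrib, ← Finset.smul_sum]
    rw [eq_neg_of_add_eq_zero_left hl, eq_neg_of_add_eq_zero_left hsum, smul_neg, sub_neg_eq_add,
      neg_add_cancel]
  have h2 : ∀ i, l i = l (Fin.last m) := by
    intro i
    refine Fin.lastCases rfl (fun i => ?_) i
    exact sub_eq_zero.1 (Fintype.linearIndependent_iff.1 hind _ h1 i)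
  rw [h2 i, h2 j]

namespace Cover

variable (φ : Cover (diagram p))

theorem finrank_Fi_lineIdx (j : Finset.Icc 2 (p + 2)) :
    Module.finrank ℤ_[p] (Fi (diagram p) (lineIdx j)) = p - 1 := by
  rw [Module.finrank_pi_fintype]
  simp only [Finset.sum_const, Finset.card_univ, Fintype.card_fin, smul_eq_mul]
  rw [headDim_diagram_lineIdx, one_mul]
  exact finrank_lam_some _

theorem eq_of_sum_lineGen_eq_zero {j : Finset.Icc 2 (p + 2)} {g : G p} (hg : g ∉ lineSubgroup p j)
    {l : Fin p → ℤ_[p]}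
    (hl : ∑ i, l i • fiRep (diagram p) (lineIdx j) (g ^ (i : ℕ)) (φ.lineGen j) = 0)
    (i i' : Fin p) : l i = l i' := by
  refine eq_of_sum_smul_eq_zero _ ?_ (sum_fiRep_pow hg _) (finrank_Fi_lineIdx j) hl i i'
  intro x _
  obtain ⟨l, rfl⟩ := φ.exists_eq_sum_lineGen hg x
  exact Submodule.sum_mem _ fun i _ => Submodule.smul_mem _ _ (Submodule.subset_span ⟨i, rfl⟩)

/-- `V_0` is its own head, so any lifts of a basis generate `F_0` by Nakayama, and their number `p`
is the rank. -/
theorem exists_fixedBasis (hp : Odd p) :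
    ∃ t : Module.Basis (Fin p) ℤ_[p] (Fi (diagram p) none),
      ∀ i, (φ.f none (t i) : V p) = fixedBasisVec p i := by
  choose t ht using fun i : Fin p =>
    φ.surjective none ⟨fixedBasisVec p i, fixedBasisVec_mem hp i.2⟩
  let S : Subrepresentation (fiRep (diagram p) none) :=
    ⟨Submodule.span ℤ_[p] (Set.range t), fun g x hx => by rwa [fiRep_none]⟩
  have hS : S.toSubmodule = ⊤ := by
    refine eq_top_of_sup_radical_eq_top S ?_
    rw [eq_top_iff]
    intro x _
    have hx : (φ.f none x : V p) ∈
        Submodule.span (ZMod p) (Set.range fun i : Fin p => fixedBasisVec p i) := by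
      rw [span_fixedBasisVec hp]; exact (φ.f none x).2
    obtain ⟨l, hl⟩ := (Submodule.mem_span_range_iff_exists_fun _).1 hx
    choose r hr using fun i => toZMod_surjective (p := p) (l i)
    have h1 : x - ∑ i, r i • t i ∈ radical (fiRep (diagram p) none) := by
      rw [← φ.mem_radical_iff, radical_diagram_none hp, Submodule.mem_bot]
      apply Subtype.ext
      rw [map_sub, map_sum, Submodule.coe_sub, Submodule.coe_sum]
      simp only [f_smul, ht, hr]
      rw [hl, sub_self]; rfl
    rw [← add_sub_cancel (∑ i, r i • t i) x]
    exact Submodule.add_mem_sup (Submodule.sum_mem _ fun i _ => Submodule.smul_mem _ _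
      (Submodule.subset_span ⟨i, rfl⟩)) h1
  have hrank : Fintype.card (Fin p) = Module.finrank ℤ_[p] (Fi (diagram p) none) := by
    rw [Module.finrank_pi_fintype]
    simp only [Finset.sum_const, Finset.card_univ, Fintype.card_fin, smul_eq_mul]
    rw [headDim_diagram_none hp, finrank_lam_none, mul_one]
  refine ⟨Module.Basis.mk (linearIndependent_of_top_le_span_of_card_eq_finrank hS.ge hrank) hS.ge,
    fun i => ?_⟩
  rw [Module.Basis.mk_apply, ht]

theorem f_sum_fixedBasis {t : Module.Basis (Fin p) ℤ_[p] (Fi (diagram p) none)}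
    (ht : ∀ i, (φ.f none (t i) : V p) = fixedBasisVec p i) (hp : Odd p) (b : Fin p → ℤ_[p])
    (i : Fin p) : (φ.f none (∑ k, b k • t k) : V p) ⟨fixedIndex i, fixedIndex_mem hp i.2⟩ =
      PadicInt.toZMod (b i) := by
  rw [map_sum, Submodule.coe_sum, Finset.sum_apply]
  simp only [f_smul, ht, Pi.smul_apply, fixedBasisVec_apply hp i.2, Fin.val_inj, smul_eq_mul,
    mul_ite, mul_one, mul_zero, Finset.sum_ite_eq', Finset.mem_univ, if_true]

/-- The components outside `P` may be prescribed as soon as the `V_i` with `P i` can absorb their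
total image in `V`. -/
theorem exists_mem_kernel_of {V : Type*} [AddCommGroup V] [Module (ZMod p) V]
    {ρ : Representation (ZMod p) (G p) V} {D : Idx p → Subrepresentation ρ} (φ : Cover D)
    (P : Idx p → Prop) [DecidablePred P] (x : ∀ i, Fi D i)
    (h : -(∑ i, if P i then 0 else (φ.f i (x i) : V)) ∈
      ⨆ i : {i : Idx p // P i}, (D i.1).toSubmodule) :
    ∃ u : φ.Lattice, ∀ i, ¬ P i → u.1 i = x i := by
  obtain ⟨w, hw1, hw2⟩ := (Submodule.mem_iSup_iff_exists_finsupp _ _).1 h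
  choose z hz using fun i : {i : Idx p // P i} => φ.surjective i.1 ⟨w i, hw1 i⟩
  refine ⟨⟨fun i => if hi : P i then z ⟨i, hi⟩ else x i, ?_⟩, fun i hi => dif_neg hi⟩
  rw [mem_kernel]
  have h1 : ∀ i, (φ.f i (if hi : P i then z ⟨i, hi⟩ else x i) : V) =
      (if hi : P i then w ⟨i, hi⟩ else 0) + if P i then 0 else (φ.f i (x i) : V) := by
    intro i
    by_cases hi : P i
    · rw [dif_pos hi, dif_pos hi, if_pos hi, add_zero]
      exact congrArg Subtype.val (hz ⟨i, hi⟩)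
    · simp only [dif_neg hi, if_neg hi, zero_add]
  have h2 : ∑ i, (if hi : P i then w ⟨i, hi⟩ else 0) = ∑ i : {i : Idx p // P i}, w i := by
    rw [← Finset.sum_subset (Finset.subset_univ (Finset.univ.filter P))
      (fun i _ hi => dif_neg (by simpa using hi)), Finset.sum_subtype (p := P) _ (by simp)]
    exact Finset.sum_congr rfl fun i _ => dif_pos i.2
  rw [Finsupp.sum_fintype _ _ (fun _ => rfl)] at hw2
  rw [Finset.sum_congr rfl fun i _ => h1 i, Finset.sum_add_distrib, h2, hw2, neg_add_cancel]

end Cover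

end Generators

end CpCpLattice

namespace CpCpLattice

open Representation

variable {p : ℕ} [Fact p.Prime]

/-! ### The projection of the lattice to `F_0 ⊕ F_N` -/

section Quotient

/-- The index of `v_2`, i.e. of the subgroup `N`. -/
def twoIdx (p : ℕ) : Finset.Icc 2 (p + 2) := ⟨2, Finset.mem_Icc.2 ⟨le_rfl, by omega⟩⟩

theorem c_notMem : c p ∉ lineSubgroup p (twoIdx p) := by
  change ¬ character 2 (c p) = 0
  rw [character_c, coeffC_two]
  exact one_ne_zero

theorem n_mem : n p ∈ lineSubgroup p (twoIdx p) := by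
  change character 2 (n p) = 0
  rw [character_n, coeffN_two]

theorem three_le_of_ne {j : Finset.Icc 2 (p + 2)} (hj : lineIdx j ≠ lineIdx (twoIdx p)) :
    3 ≤ j.1 := by
  have h2 := (Finset.mem_Icc.1 j.2).1
  by_contra h
  apply hj
  congr 1
  exact Subtype.ext (by change j.1 = 2; omega)

theorem character_n_of_three_le {j : ℕ} (hj : 3 ≤ j) : character j (n p) = 1 := by
  rw [character_n, coeffN_of_three_le hj]

theorem n_notMem {j : Finset.Icc 2 (p + 2)} (hj : 3 ≤ j.1) : n p ∉ lineSubgroup p j := by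
  rw [mem_lineSubgroup, character_n_of_three_le hj]
  exact one_ne_zero

theorem exists_eq_mk_c_pow (x : G p ⧸ N p) : ∃ i : ℕ, x = (QuotientGroup.mk (c p)) ^ i := by
  obtain ⟨g, rfl⟩ := QuotientGroup.mk_surjective x
  obtain ⟨⟨h, i⟩, rfl⟩ := (decomp_bijective (lineEquiv p (twoIdx p)).2 c_notMem).2 g
  refine ⟨i, ?_⟩
  dsimp only
  rw [QuotientGroup.mk_mul, QuotientGroup.mk_pow,
    (QuotientGroup.eq_one_iff (h : G p)).2 (by rw [← lineSubgroup_two]; exact h.2), one_mul]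

theorem mk_c_pow_p : (QuotientGroup.mk (c p) : G p ⧸ N p) ^ p = 1 := by
  rw [← QuotientGroup.mk_pow, pow_p_eq_one, QuotientGroup.mk_one]

theorem fiRep_two_of_mem {h : G p} (hh : h ∈ N p) (x : Fi (diagram p) (lineIdx (twoIdx p))) :
    fiRep _ _ h x = x :=
  fiRep_of_mem (by change h ∈ lineSubgroup p 2; rwa [lineSubgroup_two]) x

theorem eq_none_or_lineIdx (i : Idx p) : i = none ∨ ∃ j, i = lineIdx j := by
  rcases i with _ | H
  · exact Or.inl rfl
  · exact Or.inr lineIdx_surjective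

namespace Cover

variable (φ : Cover (diagram p))

/-- The projection of the lattice to the component of index `i`. -/
noncomputable def component (i : Idx p) : φ.Lattice →ₗ[ℤ_[p]] Fi (diagram p) i :=
  LinearMap.proj i ∘ₗ φ.kernel.toSubmodule.subtype

theorem component_apply (i : Idx p) (u : φ.Lattice) : φ.component i u = u.1 i := rfl

theorem component_lattice (i : Idx p) (g : G p) (u : φ.Lattice) :
    φ.component i (φ.lattice g u) = fiRep _ i g (φ.component i u) := rfl

theorem component_ext {u w : φ.Lattice} (h : ∀ i, φ.component i u = φ.component i w) : u = w :=
  Subtype.ext (funext h)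

theorem sum_f_component (u : φ.Lattice) : ∑ i, (φ.f i (φ.component i u) : V p) = 0 :=
  φ.mem_kernel.1 u.2

/-- The family with components `x₀` at `0`, `x₁` at `N` and zero elsewhere. -/
noncomputable def pair (x₀ : Fi (diagram p) none) (x₁ : Fi (diagram p) (lineIdx (twoIdx p))) :
    ∀ i, Fi (diagram p) i := by
  classical
  exact Function.update (Function.update 0 none x₀) (lineIdx (twoIdx p)) x₁

theorem pair_none (x₀ : Fi (diagram p) none) (x₁ : Fi (diagram p) (lineIdx (twoIdx p))) :
    pair x₀ x₁ none = x₀ := by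
  classical
  rw [pair, Function.update_of_ne (by simp [lineIdx]), Function.update_self]

theorem pair_two (x₀ : Fi (diagram p) none) (x₁ : Fi (diagram p) (lineIdx (twoIdx p))) :
    pair x₀ x₁ (lineIdx (twoIdx p)) = x₁ := by
  classical
  rw [pair, Function.update_self]

theorem pair_of_ne (x₀ : Fi (diagram p) none) (x₁ : Fi (diagram p) (lineIdx (twoIdx p)))
    {i : Idx p} (h0 : i ≠ none) (h1 : i ≠ lineIdx (twoIdx p)) : pair x₀ x₁ i = 0 := by
  classical
  rw [pair, Function.update_of_ne h1, Function.update_of_ne h0]; rfl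

theorem sum_eq_add {M : Type*} [AddCommMonoid M] (F : Idx p → M)
    (h : ∀ i, i ≠ none → i ≠ lineIdx (twoIdx p) → F i = 0) :
    ∑ i, F i = F none + F (lineIdx (twoIdx p)) :=
  Fintype.sum_eq_add _ _ (by simp [lineIdx]) fun i hi => h i hi.1 hi.2

theorem coord_two_f {j : Finset.Icc 2 (p + 2)} (hj : 3 ≤ j.1) (x : Fi (diagram p) (lineIdx j))
    (h : 2 ∈ Finset.Icc 1 (p + 2)) : (φ.f _ x : V p) ⟨2, h⟩ = 0 := by
  obtain ⟨a, b, hab⟩ := φ.f_lineIdx j x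
  rw [hab]
  simp only [Pi.add_apply, Pi.smul_apply, v_apply]
  rw [if_neg (by decide), if_neg (by omega), smul_zero, smul_zero, add_zero]

theorem two_mem_Icc {p : ℕ} : 2 ∈ Finset.Icc 1 (p + 2) := Finset.mem_Icc.2 ⟨by omega, by omega⟩

/-- The elements of `F_0 ⊕ F_N` that extend to an element of the lattice. -/
theorem exists_component_eq (hp : Odd p) (x₀ : Fi (diagram p) none)
    (x₁ : Fi (diagram p) (lineIdx (twoIdx p)))
    (h : (φ.f _ x₀ : V p) ⟨2, two_mem_Icc⟩ + (φ.f _ x₁ : V p) ⟨2, two_mem_Icc⟩ = 0) :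
    ∃ u : φ.Lattice, φ.component none u = x₀ ∧ φ.component (lineIdx (twoIdx p)) u = x₁ := by
  classical
  have hp2 := two_lt_of_odd hp
  let P : Idx p → Prop := fun i => i ≠ none ∧ i ≠ lineIdx (twoIdx p)
  set S := ⨆ i : {i : Idx p // P i}, (diagram p i.1).toSubmodule with hS
  have hle : ∀ i, P i → (diagram p i).toSubmodule ≤ S := fun i hi =>
    le_iSup (fun i : {i : Idx p // P i} => (diagram p i.1).toSubmodule) ⟨i, hi⟩
  have hP : ∀ j : Finset.Icc 2 (p + 2), 3 ≤ j.1 → P (lineIdx j) := by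
    intro j hj
    refine ⟨by simp [lineIdx], fun h => ?_⟩
    have := congrArg Subtype.val ((lineEquiv p).injective (Option.some_injective _ h))
    change j.1 = 2 at this
    omega
  -- The `V_H` with `H ≠ N` contain all `v_j` except `v_2`, so the `v_2`-coordinate is the only
  -- obstruction to extending.
  have hmem : ∀ w : V p, w ⟨2, two_mem_Icc⟩ = 0 → w ∈ S := by
    intro w hw
    rw [sum_smul_v w]
    refine Submodule.sum_mem _ fun j _ => ?_
    have hj := Finset.mem_Icc.1 j.2
    rcases Nat.lt_or_ge j.1 3 with h3 | h3
    · rcases Nat.lt_or_ge j.1 2 with h2 | h2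
      · have hj1 : j.1 = 1 := by omega
        rw [hj1]
        exact Submodule.smul_mem _ _ (hle _ (hP ⟨3, Finset.mem_Icc.2 ⟨by omega, by omega⟩⟩ le_rfl)
          (v_one_mem_diagram _))
      · have hj2 : j = ⟨2, two_mem_Icc⟩ := Subtype.ext (by change j.1 = 2; omega)
        rw [hj2, hw, zero_smul]
        exact Submodule.zero_mem _
    · exact Submodule.smul_mem _ _ (hle _ (hP ⟨j, Finset.mem_Icc.2 ⟨by omega, hj.2⟩⟩ h3)
        (v_mem_diagram _))
  have hsum : ∑ i, (if P i then 0 else (φ.f i (pair x₀ x₁ i) : V p)) = φ.f _ x₀ + φ.f _ x₁ := by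
    rw [sum_eq_add _ fun i h0 h1 => if_pos ⟨h0, h1⟩, if_neg (fun h => h.1 rfl),
      if_neg (fun h => h.2 rfl), pair_none, pair_two]
  obtain ⟨u, hu⟩ := φ.exists_mem_kernel_of P (pair x₀ x₁) (by
    rw [hsum]
    refine S.neg_mem (hmem _ ?_)
    rw [Pi.add_apply, h])
  exact ⟨u, (hu none fun h => h.1 rfl).trans (pair_none _ _),
    (hu _ fun h => h.2 rfl).trans (pair_two _ _)⟩

/-- An element of the lattice with zero components at `0` and `N` lies in `(n - 1) U`. -/
theorem exists_eq_sub (hp : Odd p) {u : φ.Lattice} (h0 : φ.component none u = 0)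
    (h1 : φ.component (lineIdx (twoIdx p)) u = 0) : ∃ w, u = φ.lattice (n p) w - w := by
  classical
  have hp2 := two_lt_of_odd hp
  have hsum := φ.sum_f_component u
  rw [sum_idx, h0, map_zero, Submodule.coe_zero, zero_add] at hsum
  -- Among the `V_H`, only the one of index `j` involves `v_j`. As component `0` vanishes, the
  -- `v_j`-coordinate of the kernel relation puts component `j` into the radical, which is `(n - 1)
  -- F_j` for `j ≥ 3`.
  have hrad : ∀ j : Finset.Icc 2 (p + 2),
      φ.component (lineIdx j) u ∈ radical (fiRep (diagram p) (lineIdx j)) := by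
    choose a b hab using fun j => φ.f_lineIdx j (φ.component (lineIdx j) u)
    intro j
    have hj := Finset.mem_Icc.1 j.2
    rw [← φ.mem_radical_iff, mem_radical_diagram_lineIdx]
    refine ⟨a j, ?_⟩
    have h3 := congrFun hsum ⟨j, Finset.mem_Icc.2 ⟨by omega, hj.2⟩⟩
    have h4 : b j = 0 := by
      simp only [Finset.sum_apply, hab, Pi.add_apply, Pi.smul_apply, v_apply, smul_eq_mul] at h3
      rw [Finset.sum_eq_single j, if_neg (by omega), if_pos rfl] at h3
      · simpa using h3
      · intro i _ hi
        rw [if_neg (by omega), if_neg (fun h => hi (Subtype.ext h.symm)), mul_zero, mul_zero,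
          add_zero]
      · simp
    rw [hab, h4, zero_smul, add_zero]
  have hex : ∀ i : Idx p, ∃ y : Fi (diagram p) i, i ≠ none → i ≠ lineIdx (twoIdx p) →
      φ.component i u = fiRep _ i (n p) y - y := by
    intro i
    rcases eq_none_or_lineIdx i with rfl | ⟨j, rfl⟩
    · exact ⟨0, fun h => absurd rfl h⟩
    · by_cases hj : lineIdx j = lineIdx (twoIdx p)
      · exact ⟨0, fun _ h => absurd hj h⟩
      · obtain ⟨y, hy⟩ := exists_sub_of_mem_radical (n_notMem (three_le_of_ne hj)) (hrad j)
        exact ⟨y, fun _ _ => hy⟩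
  choose y hy using hex
  let P : Idx p → Prop := fun i => i = none ∨ i = lineIdx (twoIdx p)
  set S := ⨆ i : {i : Idx p // P i}, (diagram p i.1).toSubmodule with hS
  have hle : ∀ i, P i → (diagram p i).toSubmodule ≤ S := fun i hi =>
    le_iSup (fun i : {i : Idx p // P i} => (diagram p i.1).toSubmodule) ⟨i, hi⟩
  have hv1 : v p 1 ∈ S := hle none (Or.inl rfl) (v_one_mem_diagram none)
  have hv2 : v p 2 ∈ S := hle _ (Or.inr rfl) (v_mem_diagram (twoIdx p))
  have hv3 : ∀ j, 3 ≤ j → j ≤ p + 2 → v p j - v p 3 ∈ S := by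
    intro j hj hj'
    rcases hj.eq_or_lt with rfl | h4
    · rw [sub_self]; exact S.zero_mem
    · have := S.sub_mem (hle none (Or.inl rfl) (fixedVec_mem h4 hj')) (S.smul_mem (k p j) hv2)
      rwa [fixedVec, add_sub_cancel_right] at this
  choose a b hab using fun j => φ.f_lineIdx j (y (lineIdx j))
  -- Since `(n - 1) v_j = v_1` for `j ≥ 3`, the image of `(n - 1) y_j` is `b_j v_1`; the kernel
  -- relation then gives `∑ b_j = 0`.
  have hb : ∀ j : Finset.Icc 2 (p + 2), (φ.f _ (φ.component (lineIdx j) u) : V p) =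
      (if j = twoIdx p then 0 else b j) • v p 1 := by
    intro j
    by_cases hj : j = twoIdx p
    · rw [if_pos hj, hj, h1, map_zero, zero_smul]; rfl
    · have hj' : lineIdx j ≠ lineIdx (twoIdx p) := fun h =>
        hj ((lineEquiv p).injective (Option.some_injective _ h))
      have hjm := Finset.mem_Icc.1 j.2
      rw [if_neg hj, hy _ (by simp [lineIdx]) hj', map_sub, Submodule.coe_sub, f_fiRep, hab,
        map_add, map_smul, map_smul, rho_apply_v _ (by omega) hjm.2,
        character_n_of_three_le (three_le_of_ne hj'), rho_apply, shift_v_one]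
      module
  have hb0 : ∑ j : Finset.Icc 2 (p + 2), (if j = twoIdx p then 0 else b j) = 0 := by
    simp only [hb, ← Finset.sum_smul] at hsum
    have := congrFun hsum ⟨1, Finset.mem_Icc.2 ⟨le_rfl, by omega⟩⟩
    simpa [v_apply] using this
  -- Because `∑ b_j = 0`, every `v_j` may be replaced by `v_j - v_3`, which lies in `V_0 + V_N`. So
  -- the `y_j` extend to an element of the lattice, and the added components at `0` and `N` are
  -- killed by `n - 1`.
  have hmem : ∑ i, (if P i then 0 else (φ.f i (y i) : V p)) ∈ S := by
    rw [sum_idx, if_pos (Or.inl rfl), zero_add]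
    have h5 : ∀ j : Finset.Icc 2 (p + 2), (if P (lineIdx j) then 0 else (φ.f _ (y (lineIdx j)) : V p)) =
        (if j = twoIdx p then 0 else a j • v p 1 + b j • (v p j - v p 3)) +
          (if j = twoIdx p then 0 else b j) • v p 3 := by
      intro j
      have : P (lineIdx j) ↔ j = twoIdx p := by
        refine ⟨fun h => ?_, fun h => Or.inr (by rw [h])⟩
        rcases h with h | h
        · simp [lineIdx] at h
        · exact (lineEquiv p).injective (Option.some_injective _ h)
      by_cases hj : j = twoIdx p
      · rw [if_pos (this.2 hj), if_pos hj, if_pos hj, zero_smul, add_zero]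
      · rw [if_neg (fun h => hj (this.1 h)), if_neg hj, if_neg hj, hab]
        module
    rw [Finset.sum_congr rfl fun j _ => h5 j, Finset.sum_add_distrib, ← Finset.sum_smul, hb0,
      zero_smul, add_zero]
    refine S.sum_mem fun j _ => ?_
    split_ifs with hj
    · exact S.zero_mem
    · have hj' : lineIdx j ≠ lineIdx (twoIdx p) := fun h =>
        hj ((lineEquiv p).injective (Option.some_injective _ h))
      exact S.add_mem (S.smul_mem _ hv1)
        (S.smul_mem _ (hv3 _ (three_le_of_ne hj') (Finset.mem_Icc.1 j.2).2))
  obtain ⟨w, hw⟩ := φ.exists_mem_kernel_of P y (S.neg_mem hmem)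
  refine ⟨w, φ.component_ext fun i => ?_⟩
  change φ.component i u = fiRep _ i (n p) (φ.component i w) - φ.component i w
  by_cases hi : P i
  · rcases hi with rfl | rfl
    · rw [h0, fiRep_none, sub_self]
    · rw [h1, fiRep_two_of_mem (Subgroup.mem_zpowers _), sub_self]
  · have hwi : φ.component i w = y i := hw i hi
    rw [hwi]
    exact hy i (fun h => hi (Or.inl h)) (fun h => hi (Or.inr h))

end Cover

end Quotient

end CpCpLattice

namespace CpCpLattice

open Representation

variable {p : ℕ} [Fact p.Prime]

/-! ### The invariants and the coinvariants of `N` -/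

section QuotientModules

variable {M F₀ F₁ : Type*} [AddCommGroup M] [Module ℤ_[p] M]
  [AddCommGroup F₀] [Module ℤ_[p] F₀] [AddCommGroup F₁] [Module ℤ_[p] F₁]

theorem isPermutation_quotientToInvariants_of_glue {σ : Representation ℤ_[p] (G p) M}
    (P₀ : M →ₗ[ℤ_[p]] F₀) (P₁ : M →ₗ[ℤ_[p]] F₁)
    (hinj : ∀ x, σ (n p) x = x → P₀ x = 0 → P₁ x = 0 → x = 0)
    (τ : F₁ →ₗ[ℤ_[p]] F₁) (hP₀ : ∀ x, P₀ (σ (c p) x) = P₀ x)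
    (hP₁ : ∀ x, P₁ (σ (c p) x) = τ (P₁ x))
    (t : Module.Basis (Fin p) ℤ_[p] F₀) (κ : Fin p) {r : ℤ_[p]} (hr : r ≠ 0)
    (q : M) (u : {k : Fin p // k ≠ κ} → M) (hqn : ∀ h ∈ N p, σ h q = q)
    (hun : ∀ k, ∀ h ∈ N p, σ h (u k) = u k) (hq : P₀ q = -t κ) (hu₀ : ∀ k, P₀ (u k) = r • t k)
    (hu₁ : ∀ k, P₁ (u k) = 0)
    (hconst : ∀ l : Fin p → ℤ_[p], ∑ i, l i • (τ ^ (i : ℕ)) (P₁ q) = 0 → ∀ i j, l i = l j)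
    (hsum : ∑ i : Fin p, (τ ^ (i : ℕ)) (P₁ q) = 0)
    (hspan : ∀ x, σ (n p) x = x → ∃ l : Fin p → ℤ_[p], P₁ x = ∑ i, l i • (τ ^ (i : ℕ)) (P₁ q))
    (hdiv : ∀ x, σ (n p) x = x → P₁ x = 0 → ∃ m : Fin p → ℤ_[p],
      P₀ x = ∑ k, ((if k = κ then (p : ℤ_[p]) else r) * m k) • t k) :
    IsPermutation (σ.quotientToInvariants (N p)) := by
  have hn : ∀ x : invariants (σ.comp (N p).subtype), σ (n p) x.1 = x.1 :=
    fun x => x.2 ⟨n p, Subgroup.mem_zpowers _⟩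
  exact isPermutation_of_glue (γ := QuotientGroup.mk (c p)) exists_eq_mk_c_pow mk_c_pow_p
    (P₀ ∘ₗ Submodule.subtype _) (P₁ ∘ₗ Submodule.subtype _)
    (fun x h0 h1 => Subtype.ext (hinj x.1 (hn x) h0 h1)) τ (fun x => hP₀ x.1) (fun x => hP₁ x.1)
    t κ hr ⟨q, fun h => hqn h.1 h.2⟩ (fun k => ⟨u k, fun h => hun k h.1 h.2⟩) hq hu₀ hu₁ hconst hsum
    (fun x => hspan x.1 (hn x)) (fun x => hdiv x.1 (hn x))

/-- Injectivity of the pair of projections on the coinvariants is expressed upstairs: their common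
kernel has to lie in `(n - 1) M`. -/
theorem isPermutation_quotientToCoinvariants_of_glue {σ : Representation ℤ_[p] (G p) M}
    (P₀ : M →ₗ[ℤ_[p]] F₀) (P₁ : M →ₗ[ℤ_[p]] F₁)
    (hP₀n : ∀ h ∈ N p, ∀ x, P₀ (σ h x) = P₀ x) (hP₁n : ∀ h ∈ N p, ∀ x, P₁ (σ h x) = P₁ x)
    (hinj : ∀ x, P₀ x = 0 → P₁ x = 0 → ∃ y, x = σ (n p) y - y)
    (τ : F₁ →ₗ[ℤ_[p]] F₁) (hP₀ : ∀ x, P₀ (σ (c p) x) = P₀ x)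
    (hP₁ : ∀ x, P₁ (σ (c p) x) = τ (P₁ x))
    (t : Module.Basis (Fin p) ℤ_[p] F₀) (κ : Fin p) {r : ℤ_[p]} (hr : r ≠ 0)
    (q : M) (u : {k : Fin p // k ≠ κ} → M) (hq : P₀ q = -t κ) (hu₀ : ∀ k, P₀ (u k) = r • t k)
    (hu₁ : ∀ k, P₁ (u k) = 0)
    (hconst : ∀ l : Fin p → ℤ_[p], ∑ i, l i • (τ ^ (i : ℕ)) (P₁ q) = 0 → ∀ i j, l i = l j)
    (hsum : ∑ i : Fin p, (τ ^ (i : ℕ)) (P₁ q) = 0)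
    (hspan : ∀ x, ∃ l : Fin p → ℤ_[p], P₁ x = ∑ i, l i • (τ ^ (i : ℕ)) (P₁ q))
    (hdiv : ∀ x, P₁ x = 0 → ∃ m : Fin p → ℤ_[p],
      P₀ x = ∑ k, ((if k = κ then (p : ℤ_[p]) else r) * m k) • t k) :
    IsPermutation (σ.quotientToCoinvariants (N p)) := by
  refine isPermutation_of_glue (γ := QuotientGroup.mk (c p)) exists_eq_mk_c_pow mk_c_pow_p
    (Coinvariants.lift (σ.comp (N p).subtype) P₀ fun g => LinearMap.ext (hP₀n g.1 g.2))
    (Coinvariants.lift (σ.comp (N p).subtype) P₁ fun g => LinearMap.ext (hP₁n g.1 g.2)) ?_ τ ?_ ?_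
    t κ hr (Coinvariants.mk _ q) (fun k => Coinvariants.mk _ (u k)) hq hu₀ hu₁ hconst hsum ?_ ?_
  · intro x
    induction x using Coinvariants.induction_on with
    | h x =>
      intro h0 h1
      obtain ⟨y, rfl⟩ := hinj x h0 h1
      exact (Coinvariants.mk_eq_zero _).2 (Coinvariants.sub_mem_ker
        (ρ := σ.comp (N p).subtype) ⟨n p, Subgroup.mem_zpowers _⟩ y)
  · intro x
    induction x using Coinvariants.induction_on with
    | h x => exact hP₀ x
  · intro x
    induction x using Coinvariants.induction_on with
    | h x => exact hP₁ x
  · intro x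
    induction x using Coinvariants.induction_on with
    | h x => exact hspan x
  · intro x
    induction x using Coinvariants.induction_on with
    | h x => exact hdiv x

namespace Cover

variable (φ : Cover (diagram p))

theorem exists_pair_mem {x₀ : Fi (diagram p) none} {x₁ : Fi (diagram p) (lineIdx (twoIdx p))}
    (h : (φ.f _ x₀ : V p) + φ.f _ x₁ = 0) : ∃ u : φ.Lattice, u.1 = pair x₀ x₁ := by
  refine ⟨⟨pair x₀ x₁, φ.mem_kernel.2 ?_⟩, rfl⟩
  rw [sum_eq_add, pair_none, pair_two, h]
  intro i h0 h1
  rw [pair_of_ne _ _ h0 h1, map_zero]; rfl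

theorem lattice_eq_self_of_pair {x₀ : Fi (diagram p) none}
    {x₁ : Fi (diagram p) (lineIdx (twoIdx p))} {u : φ.Lattice} (hu : u.1 = pair x₀ x₁) {h : G p}
    (hh : h ∈ N p) : φ.lattice h u = u := by
  refine φ.component_ext fun i => ?_
  rw [component_lattice]
  by_cases h0 : i = none
  · subst h0; rw [fiRep_none]
  by_cases h1 : i = lineIdx (twoIdx p)
  · subst h1; rw [fiRep_two_of_mem hh]
  · rw [component_apply, hu, pair_of_ne _ _ h0 h1, map_zero]

theorem component_eq_zero_of_fixed {u : φ.Lattice} (hu : φ.lattice (n p) u = u) {i : Idx p}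
    (h0 : i ≠ none) (h1 : i ≠ lineIdx (twoIdx p)) : φ.component i u = 0 := by
  rcases eq_none_or_lineIdx i with rfl | ⟨j, rfl⟩
  · exact absurd rfl h0
  · refine eq_zero_of_fixed (n_notMem (three_le_of_ne h1)) ?_
    rw [← component_lattice, hu]

theorem sum_component_of_fixed {u : φ.Lattice} (hu : φ.lattice (n p) u = u) :
    (φ.f _ (φ.component none u) : V p) + φ.f _ (φ.component (lineIdx (twoIdx p)) u) = 0 := by
  rw [← φ.sum_f_component u, sum_eq_add]
  intro i h0 h1
  rw [φ.component_eq_zero_of_fixed hu h0 h1, map_zero]; rfl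

theorem pow_fiRep (i : ℕ) (x : Fi (diagram p) (lineIdx (twoIdx p))) :
    ((fiRep (diagram p) (lineIdx (twoIdx p)) (c p)) ^ i) x =
      fiRep (diagram p) (lineIdx (twoIdx p)) (c p ^ i) x := by
  rw [map_pow]

theorem f_sub_lineGen : (φ.f _ (fiRep _ _ (c p) (φ.lineGen (twoIdx p)) - φ.lineGen (twoIdx p)) :
    V p) = v p 1 := by
  rw [map_sub, Submodule.coe_sub, f_fiRep, f_lineGen]
  change rho p (c p) (v p 2) - v p 2 = _
  rw [rho_c_two, add_sub_cancel_right]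

theorem sum_smul_sub_lineGen (l : Fin p → ℤ_[p]) :
    ∑ i, l i • fiRep (diagram p) (lineIdx (twoIdx p)) (c p ^ (i : ℕ))
      (fiRep _ _ (c p) (φ.lineGen (twoIdx p)) - φ.lineGen (twoIdx p)) =
    fiRep _ _ (c p) (∑ i, l i • fiRep _ _ (c p ^ (i : ℕ)) (φ.lineGen (twoIdx p))) -
      ∑ i, l i • fiRep _ _ (c p ^ (i : ℕ)) (φ.lineGen (twoIdx p)) := by
  simp only [map_sum, map_smul, map_sub, smul_sub, Finset.sum_sub_distrib]
  congr 1
  refine Finset.sum_congr rfl fun i _ => ?_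
  rw [← Module.End.mul_apply, ← map_mul, ← Module.End.mul_apply, ← map_mul, mul_comm]

theorem mem_radical_two_of_fixed {x : Fi (diagram p) (lineIdx (twoIdx p))}
    (hx : rho p (c p) (φ.f _ x) = φ.f _ x) : x ∈ radical (fiRep (diagram p) _) := by
  obtain ⟨a, b, hab⟩ := φ.f_lineIdx _ x
  rw [← φ.mem_radical_iff, mem_radical_diagram_lineIdx]
  refine ⟨a, ?_⟩
  change (φ.f _ x : V p) = a • v p 1 + b • v p 2 at hab
  rw [hab, map_add, map_smul, map_smul, rho_c_one, rho_c_two, smul_add, add_right_inj,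
    add_eq_right] at hx
  have hb : b = 0 := by
    have := congrFun hx ⟨1, Finset.mem_Icc.2 ⟨le_rfl, by omega⟩⟩
    simpa [v_apply] using this
  rw [hab, hb, zero_smul, add_zero]

theorem rho_c_f_none (x : Fi (diagram p) none) :
    rho p (c p) (φ.f none x) = φ.f none x := by
  rw [← f_fiRep, fiRep_none]

/-- The invariants of `N` on the lattice form a permutation module. -/
theorem isPermutation_invariants (hp : Odd p) :
    IsPermutation (quotientToInvariants (k := ℤ_[p]) (V := φ.Lattice) φ.lattice (N p)) := by
  obtain ⟨t, ht⟩ := φ.exists_fixedBasis hp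
  have hp0 := (Fact.out : p.Prime).pos
  set s := φ.lineGen (twoIdx p) with hs
  -- `t 0` lifts `v_1`, which spans the intersection of `V_0` and `V_N`. It is glued to `(c - 1) s`,
  -- which also lifts `v_1`; the other basis vectors enter only through their multiples by `p`.
  let κ : Fin p := ⟨0, hp0⟩
  have hmk : ∀ {x₀ x₁}, (φ.f _ x₀ : V p) + φ.f _ x₁ = 0 →
      ∃ x : φ.Lattice, (∀ h ∈ N p, φ.lattice h x = x) ∧ φ.component none x = x₀ ∧
        φ.component (lineIdx (twoIdx p)) x = x₁ := by
    intro x₀ x₁ h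
    obtain ⟨u, hu⟩ := φ.exists_pair_mem h
    refine ⟨u, fun g hg => φ.lattice_eq_self_of_pair hu hg, ?_, ?_⟩
    · rw [component_apply, hu, pair_none]
    · rw [component_apply, hu, pair_two]
  obtain ⟨q, hqn, hq₀, hq₁⟩ := hmk (x₀ := -t κ) (x₁ := fiRep _ _ (c p) s - s) (by
    rw [f_sub_lineGen, map_neg, Submodule.coe_neg, ht, fixedBasisVec_zero, neg_add_cancel])
  have hu : ∀ k : {k : Fin p // k ≠ κ}, ∃ x : φ.Lattice, (∀ h ∈ N p, φ.lattice h x = x) ∧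
      φ.component none x = (p : ℤ_[p]) • t k ∧ φ.component (lineIdx (twoIdx p)) x = 0 :=
    fun k => hmk (by
      rw [f_smul, map_zero, map_natCast, ZMod.natCast_self, zero_smul, zero_add]; rfl)
  choose u hun hu₀ hu₁ using hu
  refine isPermutation_quotientToInvariants_of_glue (M := φ.Lattice) (φ.component none)
    (φ.component (lineIdx (twoIdx p))) ?_ (fiRep _ _ (c p)) (fun x => fiRep_none (c p) _)
    (fun x => rfl) t κ (r := p) prime_ne_zero_padicInt q u hqn hun hq₀ hu₀ hu₁ ?_ ?_ ?_ ?_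
  · intro x hx h0 h1
    refine φ.component_ext fun i => ?_
    by_cases h0' : i = none
    · subst h0'; exact h0.trans (map_zero _).symm
    by_cases h1' : i = lineIdx (twoIdx p)
    · subst h1'; exact h1.trans (map_zero _).symm
    · exact (φ.component_eq_zero_of_fixed hx h0' h1').trans (map_zero _).symm
  · intro l hl
    simp only [pow_fiRep, hq₁] at hl
    -- A relation for `(c - 1) s` says that the same combination for `s` is fixed by `c`, hence
    -- zero.
    rw [hs, sum_smul_sub_lineGen, sub_eq_zero] at hl
    exact φ.eq_of_sum_lineGen_eq_zero c_notMem (eq_zero_of_fixed c_notMem hl)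
  · simp only [pow_fiRep]
    exact sum_fiRep_pow c_notMem _
  · intro x hx
    have h := φ.sum_component_of_fixed hx
    -- The image of the `N`-component lies in `V_0` and is therefore fixed by `c`; so that component
    -- is in `Rad F_N = (c - 1) F_N`.
    obtain ⟨y, hy⟩ := exists_sub_of_mem_radical c_notMem
      (φ.mem_radical_two_of_fixed (x := φ.component _ x) (by
        rw [eq_neg_of_add_eq_zero_right h, map_neg, rho_c_f_none]))
    obtain ⟨l, hl⟩ := φ.exists_eq_sum_lineGen c_notMem y
    refine ⟨l, ?_⟩
    simp only [pow_fiRep, hq₁]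
    rw [hs, sum_smul_sub_lineGen, ← hl]
    exact hy
  · intro x hx hx1
    have h := φ.sum_component_of_fixed hx
    rw [hx1, map_zero, Submodule.coe_zero, add_zero, ← t.sum_repr (φ.component none x)] at h
    have hb : ∀ i, ∃ m, t.repr (φ.component none x) i = p * m := by
      intro i
      rw [← toZMod_eq_zero_iff, ← φ.f_sum_fixedBasis ht hp, h, Pi.zero_apply]
    choose m hm using hb
    refine ⟨m, (t.sum_repr _).symm.trans (Finset.sum_congr rfl fun i _ => ?_)⟩
    rw [ite_self, ← hm]

/-- The coinvariants of `N` on the lattice form a permutation module. -/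
theorem isPermutation_coinvariants (hp : Odd p) :
    IsPermutation (quotientToCoinvariants (k := ℤ_[p]) (V := φ.Lattice) φ.lattice (N p)) := by
  obtain ⟨t, ht⟩ := φ.exists_fixedBasis hp
  have hp2 := two_lt_of_odd hp
  set s := φ.lineGen (twoIdx p) with hs
  -- `t 1` lifts `fixedVec p 4`, the only vector of the basis with a `v_2`-coordinate. It is glued
  -- to the lift `s` of `v_2`; the other `t k` already satisfy the condition, so `r = 1`.
  let κ : Fin p := ⟨1, by omega⟩
  have hf2 : ∀ k : Fin p, (φ.f none (t k) : V p) ⟨2, two_mem_Icc⟩ = if k = κ then 1 else 0 := by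
    intro k
    rw [ht]
    refine (fixedBasisVec_apply hp κ.2).trans (if_congr ?_ rfl rfl)
    rw [Fin.val_inj]
  obtain ⟨q, hq₀, hq₁⟩ := φ.exists_component_eq hp (-t κ) s (by
    rw [map_neg, Submodule.coe_neg, Pi.neg_apply, hf2, if_pos rfl, f_lineGen]
    change -1 + v p 2 _ = 0
    rw [v_apply, if_pos rfl, neg_add_cancel])
  have hu : ∀ k : {k : Fin p // k ≠ κ}, ∃ x : φ.Lattice,
      φ.component none x = (1 : ℤ_[p]) • t k ∧ φ.component (lineIdx (twoIdx p)) x = 0 :=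
    fun k => φ.exists_component_eq hp _ _ (by
      rw [one_smul, hf2, if_neg k.2, map_zero, zero_add]; rfl)
  choose u hu₀ hu₁ using hu
  refine isPermutation_quotientToCoinvariants_of_glue (M := φ.Lattice) (φ.component none)
    (φ.component (lineIdx (twoIdx p))) (fun h _ x => fiRep_none h _)
    (fun h hh x => fiRep_two_of_mem hh _) (fun x h0 h1 => φ.exists_eq_sub hp h0 h1)
    (fiRep _ _ (c p)) (fun x => fiRep_none (c p) _)
    (fun x => rfl) t κ (r := 1) one_ne_zero q u hq₀ hu₀ hu₁ ?_ ?_ ?_ ?_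
  · intro l hl
    simp only [pow_fiRep, hq₁] at hl
    exact φ.eq_of_sum_lineGen_eq_zero c_notMem hl
  · simp only [pow_fiRep]
    exact sum_fiRep_pow c_notMem _
  · intro x
    simp only [pow_fiRep, hq₁]
    exact φ.exists_eq_sum_lineGen c_notMem _
  · intro x hx1
    have h : (φ.f none (φ.component none x) : V p) ⟨2, two_mem_Icc⟩ = 0 := by
      have := congrFun (φ.sum_f_component x) ⟨2, two_mem_Icc⟩
      rw [sum_idx, Pi.add_apply, Finset.sum_apply, Finset.sum_eq_zero, add_zero] at this
      · exact this
      · intro j _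
        by_cases hj : lineIdx j = lineIdx (twoIdx p)
        · rw [hj, hx1, map_zero]; rfl
        · exact φ.coord_two_f (three_le_of_ne hj) _ _
    rw [← t.sum_repr (φ.component none x)] at h
    obtain ⟨m, hm⟩ := toZMod_eq_zero_iff.1 ((φ.f_sum_fixedBasis ht hp _ κ).symm.trans h)
    refine ⟨fun k => if k = κ then m else t.repr (φ.component none x) k,
      (t.sum_repr (φ.component none x)).symm.trans (Finset.sum_congr rfl fun k _ => ?_)⟩
    dsimp only
    split_ifs with hk
    · rw [hk, hm]
    · rw [one_mul]

end Cover

end QuotientModules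

end CpCpLattice

namespace CpCpLattice

open Representation

/-! ### The case `p = 3`: integer matrices and relations -/

section Three

/-- The matrix of `n` on `F` for `p = 3`, in terms of `coverGen`. -/
def actN : Matrix (Fin 11) (Fin 11) ℤ :=
  !![1, 0, 0, 0, 0, 0, 0, 0, 0, 0, 0;
     0, 1, 0, 0, 0, 0, 0, 0, 0, 0, 0;
     0, 0, 1, 0, 0, 0, 0, 0, 0, 0, 0;
     0, 0, 0, 1, 0, 0, 0, 0, 0, 0, 0;
     0, 0, 0, 0, 1, 0, 0, 0, 0, 0, 0;
     0, 0, 0, 0, 0, 0, -1, 0, 0, 0, 0;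
     0, 0, 0, 0, 0, 1, -1, 0, 0, 0, 0;
     0, 0, 0, 0, 0, 0, 0, 0, -1, 0, 0;
     0, 0, 0, 0, 0, 0, 0, 1, -1, 0, 0;
     0, 0, 0, 0, 0, 0, 0, 0, 0, 0, -1;
     0, 0, 0, 0, 0, 0, 0, 0, 0, 1, -1]

/-- The matrix of `c` on `F` for `p = 3`, in terms of `coverGen`. -/
def actC : Matrix (Fin 11) (Fin 11) ℤ :=
  !![1, 0, 0, 0, 0, 0, 0, 0, 0, 0, 0;
     0, 1, 0, 0, 0, 0, 0, 0, 0, 0, 0;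
     0, 0, 1, 0, 0, 0, 0, 0, 0, 0, 0;
     0, 0, 0, 0, -1, 0, 0, 0, 0, 0, 0;
     0, 0, 0, 1, -1, 0, 0, 0, 0, 0, 0;
     0, 0, 0, 0, 0, 1, 0, 0, 0, 0, 0;
     0, 0, 0, 0, 0, 0, 1, 0, 0, 0, 0;
     0, 0, 0, 0, 0, 0, 0, -1, 1, 0, 0;
     0, 0, 0, 0, 0, 0, 0, -1, 0, 0, 0;
     0, 0, 0, 0, 0, 0, 0, 0, 0, 0, -1;
     0, 0, 0, 0, 0, 0, 0, 0, 0, 1, -1]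

/-- The matrix of `f : F → V` for `p = 3`, in terms of `coverGen`. -/
def totalMat : Matrix (Fin 5) (Fin 11) ℤ :=
  !![1, 0, 0, 0, 1, 0, 1, 0, 1, 0, 1;
     0, 1, 0, 1, 1, 0, 0, 0, 0, 0, 0;
     0, -1, 1, 0, 0, 1, 1, 0, 0, 0, 0;
     0, 1, 1, 0, 0, 0, 0, 1, 1, 0, 0;
     0, 0, 1, 0, 0, 0, 0, 0, 0, 1, 1]

/-- The coordinates of a basis of `Ker f` for `p = 3`, in terms of `coverGen`. -/
def latticeMat : Matrix (Fin 11) (Fin 11) ℤ :=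
  !![-3, 0, 0, 0, 0, 0, -1, 1, 1, 1, 1;
     0, 0, 0, 0, 0, 0, -1, 0, 0, 0, 0;
     0, 0, 0, 0, 0, -1, 0, 0, 0, 0, 0;
     0, 0, 0, 0, 0, 0, 0, 1, 0, 0, 0;
     0, 3, 0, 0, 0, 0, 1, -1, 0, 0, 0;
     0, 0, 0, 0, 0, 0, 0, 0, 1, 0, 0;
     0, 0, 3, 0, 0, 1, -1, 0, -1, 0, 0;
     0, 0, 0, 0, 0, 0, 0, 0, 0, 1, 0;
     0, 0, 0, 3, 0, 1, 1, 0, 0, -1, 0;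
     0, 0, 0, 0, 0, 0, 0, 0, 0, 0, 1;
     0, 0, 0, 0, 3, 1, 0, 0, 0, 0, -1]

/-- Together with `relInvMat`, this inverts `latticeMat` on `Ker f`. -/
def leftInvMat : Matrix (Fin 11) (Fin 11) ℤ :=
  !![0, 0, -1, 0, 0, 0, 0, 0, 0, 0, 0;
     0, 0, 0, 0, 0, 0, 0, 0, 0, 0, 0;
     0, 0, 0, 0, 0, 0, 0, 0, 0, 0, 0;
     0, 0, 0, 0, 0, 0, 0, 0, 0, 0, 0;
     0, 0, 0, 0, 0, 0, 0, 0, 0, 0, 0;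
     0, 0, -1, 0, 0, 0, 0, 0, 0, 0, 0;
     0, -1, 0, 0, 0, 0, 0, 0, 0, 0, 0;
     0, 0, 0, 1, 0, 0, 0, 0, 0, 0, 0;
     0, 0, 0, 0, 0, 1, 0, 0, 0, 0, 0;
     0, 0, 0, 0, 0, 0, 0, 1, 0, 0, 0;
     0, 0, 0, 0, 0, 0, 0, 0, 0, 1, 0]

/-- Together with `leftInvMat`, this inverts `latticeMat` on `Ker f`. -/
def relInvMat : Matrix (Fin 11) (Fin 5) ℤ :=
  !![-1, 1, 1, 1, 1;
     0, 1, 0, 0, 0;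
     0, 0, 1, 0, 0;
     0, 0, 0, 1, 0;
     0, 0, 0, 0, 1;
     0, 0, 0, 0, 0;
     0, 0, 0, 0, 0;
     0, 0, 0, 0, 0;
     0, 0, 0, 0, 0;
     0, 0, 0, 0, 0;
     0, 0, 0, 0, 0]


theorem actN_mul_latticeMat : actN * latticeMat = latticeMat * matN := by decide +kernel

theorem actC_mul_latticeMat : actC * latticeMat = latticeMat * matC := by decide +kernel

theorem totalMat_mul_latticeMat :
    (totalMat * latticeMat).map (Int.cast : ℤ → ZMod 3) = 0 := by decide +kernel

/-- If `totalMat` sends `a` to `3 z`, this identity gives `a = latticeMat (leftInvMat a + relInvMat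
z)` after division by `3`. So the columns of `latticeMat` generate the kernel of `f`. -/
theorem three_smul_one_eq :
    3 • (latticeMat * leftInvMat) + latticeMat * relInvMat * totalMat = 3 • 1 := by decide +kernel

-- Only the action on the family `E` is used, not its independence: `T E = E A` and `b = E B` give
-- `T b = E A B = E B D = b D`.
open Matrix in
theorem toMatrix_eq_of_comb {R M : Type*} [CommRing R] [AddCommGroup M] [Module R M] {m : ℕ}
    {M' : Submodule R M} (E : Fin m → M) (b : Module.Basis (Fin m) R M')
    {A B D : Matrix (Fin m) (Fin m) R}
    (hb : ∀ j, (b j : M) = ∑ i, B i j • E i) (T : M →ₗ[R] M) (hT : ∀ j, T (E j) = ∑ i, A i j • E i)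
    (hAB : A * B = B * D) (T' : M' →ₗ[R] M') (hT' : ∀ x : M', (T' x : M) = T x) :
    LinearMap.toMatrix b b T' = D := by
  ext i j
  have h : T' (b j) = ∑ i, D i j • b i := by
    apply Subtype.ext
    rw [hT', hb, map_sum, Submodule.coe_sum]
    simp only [map_smul, hT, Submodule.coe_smul, hb, Finset.smul_sum, smul_smul]
    refine Finset.sum_comm.trans (Eq.trans (Finset.sum_congr rfl fun k _ => ?_) Finset.sum_comm)
    rw [← Finset.sum_smul, ← Finset.sum_smul]
    congr 1
    have := congrFun (congrFun hAB k) j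
    rw [mul_apply, mul_apply] at this
    simpa only [mul_comm] using this
  rw [LinearMap.toMatrix_apply, h, b.repr_sum_self]

variable [Fact (Nat.Prime 3)]

/-- The index `r + 2` of a subgroup of order three. -/
def lineThree (r : Fin 4) : Finset.Icc 2 (3 + 2) :=
  ⟨r + 2, Finset.mem_Icc.2 ⟨by omega, by omega⟩⟩

theorem fiRep_fiRep_of_notMem {D : Idx 3 → Subrepresentation (rho 3)} {j : Finset.Icc 2 (3 + 2)}
    {g : G 3} (hg : g ∉ lineSubgroup 3 j) (x : Fi D (lineIdx j)) :
    fiRep D _ g (fiRep D _ g x) = -x - fiRep D _ g x := by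
  have h := sum_fiRep_pow hg x
  rw [Fin.sum_univ_three] at h
  simp only [Fin.val_zero, pow_zero, map_one, Module.End.one_apply, Fin.val_one, pow_one,
    Fin.val_two, pow_two, map_mul, Module.End.mul_apply] at h
  rw [eq_neg_of_add_eq_zero_right h]
  abel

theorem k_five : k 3 5 = 2 := by
  rw [k]
  exact inv_eq_of_mul_eq_one_right rfl

theorem c_mem_three : c 3 ∈ lineSubgroup 3 (lineThree 1) := by
  change character 3 (c 3) = 0
  rw [character_c, coeffC_of_three_le le_rfl, k_three, neg_zero]

theorem n_mul_c_mem : n 3 * c 3 ∈ lineSubgroup 3 (lineThree 2) := by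
  change character 4 (n 3 * c 3) = 0
  rw [character_mul, character_n, character_c, coeffN_of_three_le (by omega),
    coeffC_of_three_le (by omega), k_four, add_neg_cancel]

theorem n_sq_mul_c_mem : n 3 * n 3 * c 3 ∈ lineSubgroup 3 (lineThree 3) := by
  change character 5 (n 3 * n 3 * c 3) = 0
  rw [character_mul, character_mul, character_n, character_c, coeffN_of_three_le (by omega),
    coeffC_of_three_le (by omega), k_five]
  ring

theorem n_cube : n 3 * n 3 * n 3 = 1 := by
  rw [← pow_two, ← pow_succ, pow_p_eq_one]

/-- `n c` acts trivially here, so `c` acts as the inverse of `n`, which is `n²`. -/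
theorem fiRep_c_four {D : Idx 3 → Subrepresentation (rho 3)} (x : Fi D (lineIdx (lineThree 2))) :
    fiRep D _ (c 3) x = fiRep D _ (n 3) (fiRep D _ (n 3) x) := by
  have h : c 3 = n 3 * (n 3 * (n 3 * c 3)) := by
    rw [← mul_assoc, ← mul_assoc, n_cube, one_mul]
  conv_lhs => rw [h, map_mul, map_mul, Module.End.mul_apply, Module.End.mul_apply,
    fiRep_of_mem n_mul_c_mem]

theorem fiRep_c_five {D : Idx 3 → Subrepresentation (rho 3)} (x : Fi D (lineIdx (lineThree 3))) :
    fiRep D _ (c 3) x = fiRep D _ (n 3) x := by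
  have h : c 3 = n 3 * (n 3 * n 3 * c 3) := by
    rw [← mul_assoc, ← mul_assoc, n_cube, one_mul]
  conv_lhs => rw [h, map_mul, Module.End.mul_apply, fiRep_of_mem n_sq_mul_c_mem]

end Three

end CpCpLattice

namespace CpCpLattice

open Representation

/-! ### The case `p = 3`: the basis of the lattice -/

section ThreeBasis

variable [Fact (Nat.Prime 3)]

namespace Cover

variable (φ : Cover (diagram 3)) (t : Module.Basis (Fin 3) ℤ_[3] (Fi (diagram 3) none))

open scoped Classical in
/-- A family of generators of `F` for `p = 3`, adapted to the decomposition `F = ⨁ F_i`. -/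
noncomputable def coverGen : Fin 11 → ∀ i, Fi (diagram 3) i :=
  ![Pi.single none (t 0), Pi.single none (t 1), Pi.single none (t 2),
    Pi.single (lineIdx (lineThree 0)) (φ.lineGen _),
    Pi.single (lineIdx (lineThree 0)) (fiRep _ _ (c 3) (φ.lineGen _)),
    Pi.single (lineIdx (lineThree 1)) (φ.lineGen _),
    Pi.single (lineIdx (lineThree 1)) (fiRep _ _ (n 3) (φ.lineGen _)),
    Pi.single (lineIdx (lineThree 2)) (φ.lineGen _),
    Pi.single (lineIdx (lineThree 2)) (fiRep _ _ (n 3) (φ.lineGen _)),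
    Pi.single (lineIdx (lineThree 3)) (φ.lineGen _),
    Pi.single (lineIdx (lineThree 3)) (fiRep _ _ (n 3) (φ.lineGen _))]

open scoped Classical in
theorem fRep_single {D : Idx 3 → Subrepresentation (rho 3)} (g : G 3) (i : Idx 3) (x : Fi D i) :
    fRep D g (Pi.single i x) = Pi.single i (fiRep D i g x) := by
  funext k
  change fiRep D k g (Pi.single i x k) = _
  by_cases h : k = i
  · subst h; rw [Pi.single_eq_same, Pi.single_eq_same]
  · rw [Pi.single_eq_of_ne h, Pi.single_eq_of_ne h, map_zero]

open scoped Classical in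
theorem total_single (i : Idx 3) (x : Fi (diagram 3) i) :
    φ.total (Pi.single i x) = (φ.f i x : V 3) := by
  rw [total_apply, Finset.sum_eq_single i, Pi.single_eq_same]
  · intro k _ hk
    rw [Pi.single_eq_of_ne hk, map_zero]; rfl
  · simp

open scoped Classical in
theorem single_neg_sub {D : Idx 3 → Subrepresentation (rho 3)} (i : Idx 3) (x y : Fi D i) :
    (Pi.single i (-x - y) : ∀ i, Fi D i) =
      (-1 : ℤ_[3]) • Pi.single i x + (-1 : ℤ_[3]) • Pi.single i y := by
  have h : ∀ {M : Type} [AddCommGroup M] [Module ℤ_[3] M] (a b : M),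
      -a - b = (-1 : ℤ_[3]) • a + (-1 : ℤ_[3]) • b := fun a b => by module
  rw [Pi.single_sub, Pi.single_neg]
  exact h _ _

theorem map_intCast_mul {l m k : ℕ} (A : Matrix (Fin l) (Fin m) ℤ) (B : Matrix (Fin m) (Fin k) ℤ) :
    (A * B).map (Int.cast : ℤ → ℤ_[3]) =
      (A.map Int.cast : Matrix (Fin l) (Fin m) ℤ_[3]) *
        (B.map Int.cast : Matrix (Fin m) (Fin k) ℤ_[3]) :=
  Matrix.map_mul (f := Int.castRingHom ℤ_[3])

theorem n_notMem_lineThree {r : Fin 4} (hr : r ≠ 0) : n 3 ∉ lineSubgroup 3 (lineThree r) := by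
  refine n_notMem (j := lineThree r) ?_
  have : (r : ℕ) ≠ 0 := fun h => hr (Fin.ext h)
  change 3 ≤ (r : ℕ) + 2
  omega

theorem fRep_n_coverGen (j : Fin 11) : fRep (diagram 3) (n 3) (φ.coverGen t j) =
    ∑ i, (actN.map (Int.cast : ℤ → ℤ_[3])) i j • φ.coverGen t i := by
  classical
  have h2 : ∀ x : Fi (diagram 3) (lineIdx (lineThree 0)), fiRep _ _ (n 3) x = x :=
    fun x => fiRep_of_mem n_mem x
  have h3 := fun x : Fi (diagram 3) (lineIdx (lineThree 1)) =>
    fiRep_fiRep_of_notMem (n_notMem_lineThree (by decide)) x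
  have h4 := fun x : Fi (diagram 3) (lineIdx (lineThree 2)) =>
    fiRep_fiRep_of_notMem (n_notMem_lineThree (by decide)) x
  have h5 := fun x : Fi (diagram 3) (lineIdx (lineThree 3)) =>
    fiRep_fiRep_of_notMem (n_notMem_lineThree (by decide)) x
  fin_cases j <;>
    simp [coverGen, actN, fRep_single, fiRep_none, h2, h3, h4, h5, Fin.sum_univ_succ,
      single_neg_sub]

theorem fRep_c_coverGen (j : Fin 11) : fRep (diagram 3) (c 3) (φ.coverGen t j) =
    ∑ i, (actC.map (Int.cast : ℤ → ℤ_[3])) i j • φ.coverGen t i := by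
  classical
  have h2 := fun x : Fi (diagram 3) (lineIdx (lineThree 0)) =>
    fiRep_fiRep_of_notMem (j := lineThree 0) c_notMem x
  have h3 : ∀ x : Fi (diagram 3) (lineIdx (lineThree 1)), fiRep _ _ (c 3) x = x :=
    fun x => fiRep_of_mem c_mem_three x
  have h4 : ∀ x : Fi (diagram 3) (lineIdx (lineThree 2)),
      fiRep _ _ (c 3) x = -x - fiRep _ _ (n 3) x := fun x => by
    rw [fiRep_c_four, fiRep_fiRep_of_notMem (n_notMem_lineThree (by decide))]
  have h4' : ∀ x : Fi (diagram 3) (lineIdx (lineThree 2)),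
      fiRep _ _ (c 3) (fiRep _ _ (n 3) x) = x := fun x => by
    rw [h4, fiRep_fiRep_of_notMem (n_notMem_lineThree (by decide))]
    abel
  have h5 := fun x : Fi (diagram 3) (lineIdx (lineThree 3)) =>
    fiRep_fiRep_of_notMem (n_notMem_lineThree (by decide)) x
  fin_cases j <;>
    simp [coverGen, actC, fRep_single, fiRep_none, h2, h3, h4 (φ.lineGen _), h4', h5, fiRep_c_five,
      Fin.sum_univ_succ, single_neg_sub]

theorem f_fiRep_lineGen_lineThree {r : Fin 4} (g : G 3) (hg : character (r + 2) g = 1) :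
    (φ.f _ (fiRep _ _ g (φ.lineGen (lineThree r))) : V 3) = v 3 (r + 2) + v 3 1 := by
  rw [f_fiRep, f_lineGen]
  change rho 3 g (v 3 (r + 2)) = _
  rw [rho_apply_v _ (by omega) (by omega), hg, one_smul]

theorem total_coverGen (ht : ∀ i, (φ.f none (t i) : V 3) = fixedBasisVec 3 i) (j : Fin 11)
    (r : Fin 5) : φ.total (φ.coverGen t j) ⟨r + 1, Finset.mem_Icc.2 ⟨by omega, by omega⟩⟩ =
      totalMat r j := by
  classical
  have hc := φ.f_fiRep_lineGen_lineThree (r := 0) (c 3) (by rw [character_c]; exact coeffC_two)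
  have hn : ∀ r : Fin 4, r ≠ 0 → (φ.f _ (fiRep _ _ (n 3) (φ.lineGen (lineThree r))) : V 3) =
      v 3 (r + 2) + v 3 1 := fun r hr => φ.f_fiRep_lineGen_lineThree (n 3) (by
    have : (r : ℕ) ≠ 0 := fun h => hr (Fin.ext h)
    exact character_n_of_three_le (by omega))
  have hl : ∀ r : Fin 4, (φ.f _ (φ.lineGen (lineThree r)) : V 3) = v 3 (r + 2) :=
    fun r => φ.f_lineGen _
  have h1 : fixedBasisVec 3 1 = v 3 4 - v 3 3 + v 3 2 := by
    change fixedVec 3 4 = _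
    rw [fixedVec, k_four, one_smul]
  have h2 : fixedBasisVec 3 2 = v 3 3 + v 3 4 + v 3 5 := by
    -- The vector is `v_5 - v_3 + 2 v_2 - 2 (v_4 - v_3 + v_2) = v_3 - 2 v_4 + v_5`, and `-2 = 1`
    -- modulo `3`.
    have h3 : (3 : ZMod 3) = 0 := rfl
    rw [fixedBasisVec_of_two_le le_rfl, fixedVec, fixedVec, k_four, k_five]
    ext i
    simp only [Pi.add_apply, Pi.sub_apply, Pi.smul_apply, smul_eq_mul]
    linear_combination (-v 3 4 i) * h3
  fin_cases j <;> simp [coverGen, total_single, ht, hc, hn, hl, h1, h2, totalMat,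
    fixedBasisVec_zero] <;> fin_cases r <;> simp [v_apply]

theorem exists_sum_coverGen (x : ∀ i, Fi (diagram 3) i) :
    ∃ a : Fin 11 → ℤ_[3], x = ∑ j, a j • φ.coverGen t j := by
  classical
  set S := Submodule.span ℤ_[3] (Set.range (φ.coverGen t)) with hS
  have hE : ∀ j, φ.coverGen t j ∈ S := fun j => Submodule.subset_span ⟨j, rfl⟩
  have hline : ∀ {j : Finset.Icc 2 (3 + 2)} {g : G 3}, g ∉ lineSubgroup 3 j →
      Pi.single (lineIdx j) (φ.lineGen j) ∈ S →
      Pi.single (lineIdx j) (fiRep _ _ g (φ.lineGen j)) ∈ S →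
      ∀ y, (Pi.single (lineIdx j) y : ∀ i, Fi (diagram 3) i) ∈ S := by
    intro j g hg h0 h1 y
    obtain ⟨l, rfl⟩ := φ.exists_eq_sum_lineGen hg y
    change LinearMap.single ℤ_[3] (fun i => Fi (diagram 3) i) (lineIdx j) _ ∈ S
    rw [map_sum]
    refine Submodule.sum_mem _ fun i _ => ?_
    rw [map_smul]
    refine Submodule.smul_mem _ _ ?_
    change Pi.single (lineIdx j) _ ∈ S
    fin_cases i
    · simpa using h0
    · simpa using h1
    · change Pi.single (lineIdx j) (fiRep _ _ (g ^ 2) _) ∈ S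
      -- The norm relation `1 + g + g² = 0` makes the third element of each orbit redundant.
      rw [pow_two, map_mul, Module.End.mul_apply, fiRep_fiRep_of_notMem hg, single_neg_sub]
      exact Submodule.add_mem _ (Submodule.smul_mem _ _ h0) (Submodule.smul_mem _ _ h1)
  have hsingle : ∀ (i : Idx 3) y, (Pi.single i y : ∀ i, Fi (diagram 3) i) ∈ S := by
    intro i y
    rcases eq_none_or_lineIdx i with rfl | ⟨j, rfl⟩
    · rw [← t.sum_repr y]
      change LinearMap.single ℤ_[3] (fun i => Fi (diagram 3) i) none _ ∈ S
      rw [map_sum]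
      refine Submodule.sum_mem _ fun i _ => ?_
      rw [map_smul]
      refine Submodule.smul_mem _ _ ?_
      fin_cases i
      exacts [hE 0, hE 1, hE 2]
    · have hj := Finset.mem_Icc.1 j.2
      obtain ⟨r, rfl⟩ : ∃ r, j = lineThree r :=
        ⟨⟨j - 2, by omega⟩, Subtype.ext (show j.1 = j.1 - 2 + 2 by omega)⟩
      fin_cases r
      · exact hline (j := lineThree 0) c_notMem (hE 3) (hE 4) y
      · exact hline (n_notMem_lineThree (r := 1) (by decide)) (hE 5) (hE 6) y
      · exact hline (n_notMem_lineThree (r := 2) (by decide)) (hE 7) (hE 8) y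
      · exact hline (n_notMem_lineThree (r := 3) (by decide)) (hE 9) (hE 10) y
  have hx : x ∈ S := by
    rw [← Finset.univ_sum_single x]
    exact Submodule.sum_mem _ fun i _ => hsingle i _
  obtain ⟨a, ha⟩ := (Submodule.mem_span_range_iff_exists_fun _).1 hx
  exact ⟨a, ha.symm⟩

/-- For `p = 3` the lattice has a basis with respect to which `n` and `c` act by the matrices
`matN` and `matC`. -/
theorem exists_basis_toMatrix : ∃ b : Module.Basis (Fin 11) ℤ_[3] φ.Lattice,
    LinearMap.toMatrix b b (φ.lattice (n 3)) = matN.map (Int.cast : ℤ → ℤ_[3]) ∧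
      LinearMap.toMatrix b b (φ.lattice (c 3)) = matC.map (Int.cast : ℤ → ℤ_[3]) := by
  obtain ⟨t, ht⟩ := φ.exists_fixedBasis (by decide)
  let E := φ.coverGen t
  have htot : ∀ a : Fin 11 → ℤ_[3], ∀ r : Fin 5, φ.total (∑ j, a j • E j)
      ⟨r + 1, Finset.mem_Icc.2 ⟨by omega, by omega⟩⟩ =
        PadicInt.toZMod ((totalMat.map (Int.cast : ℤ → ℤ_[3])).mulVec a r) := by
    intro a r
    rw [map_sum, Finset.sum_apply, Matrix.mulVec, dotProduct, map_sum]
    refine Finset.sum_congr rfl fun j _ => ?_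
    rw [map_smulₛₗ, Pi.smul_apply, φ.total_coverGen t ht, map_mul, Matrix.map_apply, map_intCast,
      smul_eq_mul, mul_comm]
  have hmem : ∀ k, ∑ j, (latticeMat.map (Int.cast : ℤ → ℤ_[3])) j k • E j ∈
      φ.kernel.toSubmodule := by
    intro k
    refine LinearMap.mem_ker.2 (funext fun ⟨i, hi⟩ => ?_)
    have hi' := Finset.mem_Icc.1 hi
    obtain ⟨r, rfl⟩ : ∃ r : Fin 5, i = r + 1 := ⟨⟨i - 1, by omega⟩, by dsimp only; omega⟩
    rw [htot]
    have h1 := congrFun (congrFun totalMat_mul_latticeMat r) k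
    rw [Matrix.map_apply, ← map_intCast (PadicInt.toZMod (p := 3)), ← Matrix.map_apply
      (f := (Int.cast : ℤ → ℤ_[3])), map_intCast_mul] at h1
    exact h1
  let u : Fin 11 → φ.Lattice := fun k => ⟨_, hmem k⟩
  have hspan : ⊤ ≤ Submodule.span ℤ_[3] (Set.range u) := by
    intro x _
    obtain ⟨a, ha⟩ := φ.exists_sum_coverGen t x.1
    change x.1 = ∑ j, a j • E j at ha
    have hx := LinearMap.mem_ker.1 x.2
    rw [ha] at hx
    have hz : ∀ r, ∃ z, (totalMat.map (Int.cast : ℤ → ℤ_[3])).mulVec a r = (3 : ℕ) * z := by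
      intro r
      rw [← toZMod_eq_zero_iff, ← htot]
      exact congrFun hx _
    choose z hz using hz
    let y := (leftInvMat.map (Int.cast : ℤ → ℤ_[3])).mulVec a +
      (relInvMat.map (Int.cast : ℤ → ℤ_[3])).mulVec z
    have hz' : (3 : ℤ_[3]) • z = (totalMat.map (Int.cast : ℤ → ℤ_[3])).mulVec a :=
      funext fun r => (hz r).symm
    have hy : (latticeMat.map (Int.cast : ℤ → ℤ_[3])).mulVec y = a := by
      have h3 : (3 : ℤ_[3]) ≠ 0 := prime_ne_zero_padicInt
      have key : 3 • ((latticeMat.map Int.cast : Matrix (Fin 11) (Fin 11) ℤ_[3]) *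
            (leftInvMat.map Int.cast : Matrix (Fin 11) (Fin 11) ℤ_[3])) +
          (latticeMat.map Int.cast : Matrix (Fin 11) (Fin 11) ℤ_[3]) *
            (relInvMat.map Int.cast : Matrix (Fin 11) (Fin 5) ℤ_[3]) *
            (totalMat.map Int.cast : Matrix (Fin 5) (Fin 11) ℤ_[3]) = 3 • 1 := by
        rw [← map_intCast_mul, ← map_intCast_mul, ← map_intCast_mul]
        ext i j
        have h := congrFun (congrFun three_smul_one_eq i) j
        rw [Matrix.add_apply, Matrix.smul_apply, Matrix.smul_apply, Matrix.one_apply] at h ⊢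
        rw [Matrix.map_apply, Matrix.map_apply]
        rw [nsmul_eq_mul, nsmul_eq_mul] at h ⊢
        split_ifs at h ⊢ <;> exact_mod_cast congrArg (Int.cast : ℤ → ℤ_[3]) h
      have h := congrArg (fun A => Matrix.mulVec A a) key
      simp only [Matrix.add_mulVec, ← Matrix.mulVec_mulVec, ← hz', Matrix.mulVec_smul,
        Matrix.smul_mulVec, Matrix.one_mulVec, ← Nat.cast_smul_eq_nsmul ℤ_[3], Nat.cast_ofNat,
        ← smul_add, ← Matrix.mulVec_add] at h
      exact smul_right_injective _ h3 h
    have hxu : x = ∑ k, y k • u k := by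
      apply Subtype.ext
      rw [ha, Submodule.coe_sum]
      simp only [Submodule.coe_smul, u, Finset.smul_sum, smul_smul]
      rw [Finset.sum_comm]
      refine Finset.sum_congr rfl fun j _ => ?_
      rw [← Finset.sum_smul, ← congrFun hy j, Matrix.mulVec, dotProduct]
      simp only [mul_comm]
    rw [hxu]
    exact Submodule.sum_mem _ fun k _ => Submodule.smul_mem _ _ (Submodule.subset_span ⟨k, rfl⟩)
  -- Eleven generators of a lattice of rank `9 + 3 - 1` are automatically independent.
  have hind := linearIndependent_of_top_le_span_of_card_eq_finrank hspan
    (by rw [finrank_lattice_diagram (by decide)]; rfl)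
  have hb : ∀ j, (Module.Basis.mk hind hspan j : ∀ i, Fi (diagram 3) i) =
      ∑ i, (latticeMat.map (Int.cast : ℤ → ℤ_[3])) i j • E i := by
    intro j
    rw [Module.Basis.mk_apply]
  refine ⟨Module.Basis.mk hind hspan, ?_, ?_⟩
  · exact toMatrix_eq_of_comb E _ hb (fRep (diagram 3) (n 3)) (φ.fRep_n_coverGen t)
      (by rw [← map_intCast_mul, actN_mul_latticeMat, map_intCast_mul]) _ fun x => rfl
  · exact toMatrix_eq_of_comb E _ hb (fRep (diagram 3) (c 3)) (φ.fRep_c_coverGen t)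
      (by rw [← map_intCast_mul, actC_mul_latticeMat, map_intCast_mul]) _ fun x => rfl

end Cover

end ThreeBasis

end CpCpLattice

theorem mainTheorem1 (p : ℕ) [Fact p.Prime] (hp : Odd p) :
    CpCpLattice.IsDiagram (CpCpLattice.diagram p) ∧
    Nonempty (CpCpLattice.Cover (CpCpLattice.diagram p)) ∧
    (∀ φ : CpCpLattice.Cover (CpCpLattice.diagram p),
      CpCpLattice.IsLattice φ.lattice ∧
      CpCpLattice.IsReduced (U := φ.Lattice) p φ.lattice ∧
      Module.finrank ℤ_[p] φ.Lattice = p ^ 2 + p - 1 ∧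
      CpCpLattice.IsPermutation
        (Representation.quotientToInvariants (k := ℤ_[p]) (V := φ.Lattice) φ.lattice (CpCpLattice.N p)) ∧
      CpCpLattice.IsPermutation
        (Representation.quotientToCoinvariants (k := ℤ_[p]) (V := φ.Lattice) φ.lattice (CpCpLattice.N p)) ∧
      ¬ CpCpLattice.IsPermutation φ.lattice ∧
      (p = 3 → ∃ b : Module.Basis (Fin 11) ℤ_[p] φ.Lattice,
        LinearMap.toMatrix b b (φ.lattice (CpCpLattice.n p)) =
          CpCpLattice.matN.map (Int.cast : ℤ → ℤ_[p]) ∧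
        LinearMap.toMatrix b b (φ.lattice (CpCpLattice.c p)) =
          CpCpLattice.matC.map (Int.cast : ℤ → ℤ_[p]))) ∧
    ¬ ∀ (U : Type) [AddCommGroup U] [Module ℤ_[p] U]
        (σ : Representation ℤ_[p] (CpCpLattice.G p) U),
        CpCpLattice.IsLattice σ →
        CpCpLattice.IsPermutation (σ.quotientToInvariants (CpCpLattice.N p)) →
        CpCpLattice.IsPermutation (σ.quotientToCoinvariants (CpCpLattice.N p)) →
        CpCpLattice.IsPermutation σ := by
  have hD := CpCpLattice.isDiagram_diagram hp
  have hne := hD.nonempty_cover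
  refine ⟨hD, hne, fun φ => ⟨φ.isLattice,
    CpCpLattice.Cover.isReduced φ (CpCpLattice.iSup_diagram hp),
    CpCpLattice.finrank_lattice_diagram hp φ, φ.isPermutation_invariants hp,
    φ.isPermutation_coinvariants hp, CpCpLattice.not_isPermutation_diagram hp φ, ?_⟩, fun h => ?_⟩
  · rintro rfl
    exact φ.exists_basis_toMatrix
  · obtain ⟨φ⟩ := hne
    have h1 := @h φ.Lattice inferInstance inferInstance φ.lattice
    have h2 := h1 φ.isLattice
    have h3 := h2 (φ.isPermutation_invariants hp)
    have h4 := h3 (φ.isPermutation_coinvariants hp)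
    exact CpCpLattice.not_isPermutation_diagram hp φ h4
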